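/- Let $N,M\ge 1$, $q\in\mathbb C$ with $0<|q|<1$, fix a value of $\log q$, and let $a_j=q^{\alpha_j}$, $c_j=q^{\gamma_j}$ $(1\le j\le N)$, $b_i=q^{\beta_i}$ $(1\le i\le M)$ with $\alpha_j,\beta_i,\gamma_j\in\mathbb C$. For $n\ge 0$ put $(x)_n=\prod_{k=0}^{n-1}(1-xq^k)$ and $(x)_{-n}=\prod_{k=1}^{n}(1-xq^{-k})^{-1}$; for $m\in\mathbb Z_{\ge0}^M$ and $0\le l\le M$ put $m(l)=\sum_{i\le l}m_i-\sum_{i>l}m_i$. Let $T_s$ be the $q$-shift $t_s\mapsto qt_s$ and $T=T_1\cdots T_M$. The system $E_{N,M}$ is $$\Big\{t_s\prod_{j=1}^N(1-a_jT)\,(1-b_sT_s)-\prod_{j=1}^N(1-c_jq^{-1}T)\,(1-T_s)\Big\}f=0\quad(1\le s\le M),$$ $$\{t_r(1-b_rT_r)(1-T_s)-t_s(1-b_sT_s)(1-T_r)\}f=0\quad(1\le r<s\le M).$$ For $0\le L\le M$, $1\le k\le N$, define the following series, where each sum is over $m\in\mathbb Z_{\ge0}^M$: $$\mathcal F^{L}(b;t)=\sum_{m}\prod_{j=1}^N\frac{(a_j/b_{L+1}\cdots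 b_M)_{m(L)}}{(c_j/b_{L+1}\cdots b_M)_{m(L)}}\prod_{i=1}^M\frac{(b_i)_{m_i}}{(q)_{m_i}}\prod_{i=1}^Lt_i^{m_i}\prod_{i=L+1}^M\Big(\frac q{b_it_i}\Big)^{m_i};$$ for $L+1\le l\le M$, with $m'_i=m_i$ for $i\le L$ or $i>l$ and $m'_i=m_{i+1}$ for $L<i<l$, $$\mathcal F^{L;k,l}(b;t)=\sum_m\prod_{j=1}^N\frac{(qa_k/c_j)_{m_{L+1}}}{(qa_k/a_j)_{m_{L+1}}}\prod_{i\ne l}\frac{(b_i)_{m'_i}}{(q)_{m'_i}}\cdot\frac{(a_k/b_{l+1}\cdots b_M)_{m(l)}}{(qa_k/b_l\cdots b_M)_{m(l)}}\prod_{i<l}\Big(\frac{qt_i}{b_lt_l}\Big)^{m'_i}\prod_{i>l}\Big(\frac{b_lt_l}{b_it_i}\Big)^{m'_i}\Big(\prod_{j=1}^N\frac{c_j}{a_j}\cdot\frac q{b_lt_l}\Big)^{m_{L+1}};$$ for $1\le l\le L$, with $m''_i=m_i$ for $i<l$ or $i>L$ and $m''_i=m_{i-1}$ for $l<i\le L$,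 $$\mathcal G^{L;k,l}(b;t)=\sum_m\prod_{j=1}^N\frac{(qa_j/c_k)_{m_L}}{(qc_j/c_k)_{m_L}}\prod_{i\ne l}\frac{(b_i)_{m''_i}}{(q)_{m''_i}}\cdot\frac{(c_k/(qb_{l+1}\cdots b_M))_{m(l-1)}}{(c_k/b_l\cdots b_M)_{m(l-1)}}\prod_{i<l}\Big(\frac{qt_i}{b_lt_l}\Big)^{m''_i}\prod_{i>l}\Big(\frac{b_lt_l}{b_it_i}\Big)^{m''_i}\Big(\frac{b_lt_l}q\Big)^{m_L}.$$ For $\sigma\in\mathfrak S_M$ write $b^\sigma=(b_{\sigma(i)})_i$, $t^\sigma=(t_{\sigma(i)})_i$ and set $$u_0^{L,\sigma}=\prod_{i=L+1}^Mt_{\sigma(i)}^{-\beta_{\sigma(i)}}\,\mathcal F^L(b^\sigma;t^\sigma),$$ $$u_{k,l}^{L,\sigma}=t_{\sigma(l)}^{1+\sum_{i>l}\beta_{\sigma(i)}-\gamma_k}\prod_{i>l}t_{\sigma(i)}^{-\beta_{\sigma(i)}}\,\mathcal G^{L;k,l}(b^\sigma;t^\sigma)\ (1\le l\le L),\qquad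 u_{k,l}^{L,\sigma}=t_{\sigma(l)}^{-\alpha_k+\sum_{i>l}\beta_{\sigma(i)}}\prod_{i>l}t_{\sigma(i)}^{-\beta_{\sigma(i)}}\,\mathcal F^{L;k,l}(b^\sigma;t^\sigma)\ (L<l\le M).$$ Let $$D^{L,\sigma}=\Big\{|t_{\sigma(i)}|<1\ (i\le L),\ \Big|\prod_{j=1}^N\frac{c_j}{a_j}\cdot\frac q{b_{\sigma(i)}t_{\sigma(i)}}\Big|<1\ (i>L),\ \Big|\frac{qt_{\sigma(i)}}{b_{\sigma(j)}t_{\sigma(j)}}\Big|<1\ (i<j)\Big\}\subset(\mathbb C^*)^M,$$ and assume that $a_j/a_k,\ c_j/c_k\notin q^{\mathbb Z}$ for $j\ne k$ and $a_j/(b_{\sigma(i)}\cdots b_{\sigma(M)}),\ c_j/(b_{\sigma(i)}\cdots b_{\sigma(M)})\notin q^{\mathbb Z}$ for $1\le j\le N$, $1\le i\le M+1$. Then all the series in $u_0^{L,\sigma}$, $u_{k,l}^{L,\sigma}$ converge absolutely in $D^{L,\sigma}$, and the vector of these $NM+1$ functions is a fundamental solution of $E_{N,M}$ in $D^{L,\sigma}$.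 That is: each of them is a solution in $D^{L,\sigma}$; they are linearly independent over the pseudo-constants $K=\{C(t):T_sC=C\text{ for all }s\}$; and every solution in $D^{L,\sigma}$ is a linear combination of them with coefficients in $K$. Here functions may be multivalued, i.e. they are functions of $(\log t_1,\dots,\log t_M)$, with $T_s$ acting by $\log t_s\mapsto\log t_s+\log q$, and a solution in a region $D$ is a function on $D$ that satisfies each equation at every point of $D$ for which all the shifted points that occur in the equation lie in $D$. -/

import Mathlib

/-!
Conventions.

* `0 < ‖q‖ < 1`, and `τ` is a fixed logarithm of `q` (`exp τ = q`), so that `q ^ δ = exp (τ * δ)`.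
* The functions `t ^ δ` are multivalued, so all functions live on the universal covering of the
  torus `(ℂ^*)^M`: a point is `z : Fin M → ℂ`, its coordinates are `t i = exp (z i)`,
  `t i ^ δ = exp (δ * z i)`, and the `q`-shift `t s ↦ q * t s` is `z s ↦ z s + τ`.
* Indices start at `0`: the index `i` of a formula with `1 ≤ i ≤ M` is the element of `Fin M`
  with value `i - 1`. The cut `L` with `0 ≤ L ≤ M` is a number of variables and is not shifted:
  "`1 ≤ i ≤ L`" is `(i : ℕ) < L`, and "`L + 1 ≤ i ≤ M`" is `L ≤ (i : ℕ)`.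
-/

noncomputable section

namespace QHyp

/-- The `q`-shifted factorial `(x)_n` for an integer `n`: `∏_{0 ≤ k < n} (1 - x q^k)` for `n ≥ 0`,
and `(x)_{-n} = 1 / ∏_{1 ≤ k ≤ n} (1 - x q^{-k})`. This is `(x)_∞ / (x q^n)_∞`, simplified. -/
def qPoch (q x : ℂ) : ℤ → ℂ
  | Int.ofNat n => ∏ k ∈ Finset.range n, (1 - x * q ^ k)
  | Int.negSucc n => (∏ k ∈ Finset.range (n + 1), (1 - x / q ^ (k + 1)))⁻¹

/-- `m(l) = ∑_{i=1}^{l} m_i - ∑_{i=l+1}^{M} m_i`, for `0 ≤ l ≤ M`. -/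
def signedSum {M : ℕ} (m : Fin M → ℕ) (l : ℕ) : ℤ :=
  ∑ i : Fin M, if (i : ℕ) < l then (m i : ℤ) else -(m i : ℤ)

/-- The product `b_{l+1} ⋯ b_M`, for `0 ≤ l ≤ M` (it is `1` for `l = M`). -/
def tailProd {M : ℕ} (b : Fin M → ℂ) (l : ℕ) : ℂ :=
  ∏ i : Fin M with l ≤ i.val, b i

/-! ### The three families of series -/

/-- The term of index `m` of the series `𝓕^L`. -/
def termF0 {N M : ℕ} (q : ℂ) (a : Fin N → ℂ) (b : Fin M → ℂ) (c : Fin N → ℂ) (L : ℕ)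
    (t : Fin M → ℂ) (m : Fin M → ℕ) : ℂ :=
  (∏ j, qPoch q (a j / tailProd b L) (signedSum m L) /
      qPoch q (c j / tailProd b L) (signedSum m L)) *
    (∏ i, qPoch q (b i) (m i) / qPoch q q (m i)) *
    (∏ i : Fin M with i.val < L, t i ^ m i) *
    (∏ i : Fin M with L ≤ i.val, (q / (b i * t i)) ^ m i)

/-- The term of index `m` of the series `𝓕^{L;k,l}`, `L + 1 ≤ l ≤ M`.

The summation index `m_{L+1}` is `m p`. The summation index that goes with `b_i`, `t_i` is `m_i`
for `i ≤ L` and for `i > l`, and it is `m_{i+1}` for `L + 1 ≤ i ≤ l - 1`; that is `m (s i)`,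
where `s` is the cycle `L+1 ↦ L+2 ↦ ⋯ ↦ l ↦ L+1`. -/
def termF {N M : ℕ} (q : ℂ) (a : Fin N → ℂ) (b : Fin M → ℂ) (c : Fin N → ℂ) (L : ℕ)
    (k : Fin N) (l : Fin M) (hl : L ≤ (l : ℕ)) (t : Fin M → ℂ) (m : Fin M → ℕ) : ℂ :=
  let p : Fin M := ⟨L, hl.trans_lt l.isLt⟩
  let s : Equiv.Perm (Fin M) := Fin.cycleIcc p l
  (∏ j, qPoch q (q * a k / c j) (m p) / qPoch q (q * a k / a j) (m p)) *
    (∏ i with i ≠ l, qPoch q (b i) (m (s i)) / qPoch q q (m (s i))) *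
    (qPoch q (a k / tailProd b ((l : ℕ) + 1)) (signedSum m ((l : ℕ) + 1)) /
      qPoch q (q * a k / tailProd b (l : ℕ)) (signedSum m ((l : ℕ) + 1))) *
    (∏ i with i < l, (q * t i / (b l * t l)) ^ m (s i)) *
    (∏ i with l < i, (b l * t l / (b i * t i)) ^ m (s i)) *
    ((∏ j, c j / a j) * (q / (b l * t l))) ^ m p

/-- The term of index `m` of the series `𝓖^{L;k,l}`, `1 ≤ l ≤ L`.

The summation index `m_L` is `m p`. The summation index that goes with `b_i`, `t_i` is `m_i`
for `i < l` and for `i > L`, and it is `m_{i-1}` for `l + 1 ≤ i ≤ L`; that is `m (s i)`,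
where `s` is the cycle `L ↦ L-1 ↦ ⋯ ↦ l ↦ L`. -/
def termG {N M : ℕ} (q : ℂ) (a : Fin N → ℂ) (b : Fin M → ℂ) (c : Fin N → ℂ) (L : ℕ) (hL : L ≤ M)
    (k : Fin N) (l : Fin M) (hl : (l : ℕ) < L) (t : Fin M → ℂ) (m : Fin M → ℕ) : ℂ :=
  let p : Fin M := ⟨L - 1, by omega⟩
  let s : Equiv.Perm (Fin M) := (Fin.cycleIcc l p).symm
  (∏ j, qPoch q (q * a j / c k) (m p) / qPoch q (q * c j / c k) (m p)) *
    (∏ i with i ≠ l, qPoch q (b i) (m (s i)) / qPoch q q (m (s i))) *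
    (qPoch q (c k / (q * tailProd b ((l : ℕ) + 1))) (signedSum m (l : ℕ)) /
      qPoch q (c k / tailProd b (l : ℕ)) (signedSum m (l : ℕ))) *
    (∏ i with i < l, (q * t i / (b l * t l)) ^ m (s i)) *
    (∏ i with l < i, (b l * t l / (b i * t i)) ^ m (s i)) *
    (b l * t l / q) ^ m p

/-! ### The functions `u_0^{L,σ}` and `u_{k,l}^{L,σ}`

They are indexed by `Option (Fin N × Fin M)`: `none` stands for `u_0`, `some (k, l)` for `u_{k,l}`.
The parameters are `a_j = q^{α_j}`, `b_i = q^{β_i}`, `c_j = q^{γ_j}`. -/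

/-- The terms of the series in the component `i` of `u^{L,id}`, at the point `t`. -/
def uTerm {N M : ℕ} (q : ℂ) (a : Fin N → ℂ) (b : Fin M → ℂ) (c : Fin N → ℂ) (L : ℕ) (hL : L ≤ M)
    (t : Fin M → ℂ) : Option (Fin N × Fin M) → (Fin M → ℕ) → ℂ
  | none => termF0 q a b c L t
  | some (k, l) =>
    if h : (l : ℕ) < L then termG q a b c L hL k l h t
    else termF q a b c L k l (not_lt.mp h) t

/-- The monomial prefactor `t^δ` of the component `i` of `u^{L,id}`, at `t = exp z`. -/
def uMonomial {N M : ℕ} (α : Fin N → ℂ) (β : Fin M → ℂ) (γ : Fin N → ℂ) (L : ℕ)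
    (z : Fin M → ℂ) : Option (Fin N × Fin M) → ℂ
  | none => ∏ i : Fin M with L ≤ i.val, Complex.exp (-β i * z i)
  | some (k, l) =>
    (if (l : ℕ) < L then Complex.exp ((1 + (∑ i with l < i, β i) - γ k) * z l)
      else Complex.exp ((-α k + ∑ i with l < i, β i) * z l)) *
    ∏ i with l < i, Complex.exp (-β i * z i)

/-- `x ↦ q^x` in each coordinate, where `q = exp τ`. -/
def qPow {ι : Type*} (τ : ℂ) (x : ι → ℂ) : ι → ℂ := fun i => Complex.exp (τ * x i)

/-- The terms of the series in the component `i` of `u^{L,σ}`, at `t = exp z`. -/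
def uSeriesTerm {N M : ℕ} (τ : ℂ) (α : Fin N → ℂ) (β : Fin M → ℂ) (γ : Fin N → ℂ)
    (L : ℕ) (hL : L ≤ M) (σ : Equiv.Perm (Fin M)) (i : Option (Fin N × Fin M))
    (z : Fin M → ℂ) (m : Fin M → ℕ) : ℂ :=
  uTerm (Complex.exp τ) (qPow τ α) (fun i => qPow τ β (σ i)) (qPow τ γ) L hL
    (fun i => Complex.exp (z (σ i))) i m

/-- The component `i` of the vector `u^{L,σ}`, as a function on the covering. -/
def u {N M : ℕ} (τ : ℂ) (α : Fin N → ℂ) (β : Fin M → ℂ) (γ : Fin N → ℂ)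
    (L : ℕ) (hL : L ≤ M) (σ : Equiv.Perm (Fin M)) (i : Option (Fin N × Fin M))
    (z : Fin M → ℂ) : ℂ :=
  uMonomial α (fun i => β (σ i)) γ L (fun i => z (σ i)) i *
    ∑' m : Fin M → ℕ, uSeriesTerm τ α β γ L hL σ i z m

/-! ### The `q`-difference system -/

/-- The point `(…, q t_s, …)`. -/
def shiftPt {M : ℕ} (τ : ℂ) (s : Fin M) (z : Fin M → ℂ) : Fin M → ℂ :=
  Function.update z s (z s + τ)

/-- The point `q t = (q t_1, …, q t_M)`. -/
def shiftAllPt {M : ℕ} (τ : ℂ) (z : Fin M → ℂ) : Fin M → ℂ := fun i => z i + τ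

/-- Linear operators on the functions on the covering. -/
abbrev Op (M : ℕ) : Type := Module.End ℂ ((Fin M → ℂ) → ℂ)

/-- The `q`-shift operator `T_s`. -/
def T {M : ℕ} (τ : ℂ) (s : Fin M) : Op M where
  toFun f z := f (shiftPt τ s z)
  map_add' _ _ := rfl
  map_smul' _ _ := rfl

/-- The operator `T = T_1 ⋯ T_M`. -/
def TAll {M : ℕ} (τ : ℂ) : Op M where
  toFun f z := f (shiftAllPt τ z)
  map_add' _ _ := rfl
  map_smul' _ _ := rfl

/-- The operator `∏_{j=1}^N (1 - x_j T)`. -/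
def prodOneSub {N M : ℕ} (τ : ℂ) (x : Fin N → ℂ) : Op M :=
  (List.ofFn fun j => 1 - x j • TAll τ).prod

/-- `f` is a solution in the region `D` of the system `E_{N,M}`
`{t_s ∏_j (1 - a_j T) (1 - b_s T_s) - ∏_j (1 - c_j q⁻¹ T) (1 - T_s)} f = 0`, `1 ≤ s ≤ M`,
`{t_r (1 - b_r T_r) (1 - T_s) - t_s (1 - b_s T_s) (1 - T_r)} f = 0`, `1 ≤ r < s ≤ M`.
`D` is not stable under the shifts, and only the values of `f` in `D` matter: an equation is imposed
at those points of `D` for which all the shifted points that occur in it lie in `D`. -/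
structure IsSolutionOn {N M : ℕ} (τ : ℂ) (a : Fin N → ℂ) (b : Fin M → ℂ) (c : Fin N → ℂ)
    (D : Set (Fin M → ℂ)) (f : (Fin M → ℂ) → ℂ) : Prop where
  eq_one : ∀ (s : Fin M) (z : Fin M → ℂ),
    (∀ n ≤ N, (shiftAllPt τ)^[n] z ∈ D ∧ (shiftAllPt τ)^[n] (shiftPt τ s z) ∈ D) →
    Complex.exp (z s) * (prodOneSub τ a * (1 - b s • T τ s) : Op M) f z -
      (prodOneSub τ (fun j => c j * (Complex.exp τ)⁻¹) * (1 - T τ s) : Op M) f z = 0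
  eq_two : ∀ (r s : Fin M), r < s → ∀ z : Fin M → ℂ,
    z ∈ D → shiftPt τ r z ∈ D → shiftPt τ s z ∈ D → shiftPt τ r (shiftPt τ s z) ∈ D →
    Complex.exp (z r) * ((1 - b r • T τ r) * (1 - T τ s) : Op M) f z -
      Complex.exp (z s) * ((1 - b s • T τ s) * (1 - T τ r) : Op M) f z = 0

/-- The pseudo-constants `K = {C ; T_s C = C for all s}`. -/
def IsPseudoConstant {M : ℕ} (τ : ℂ) (C : (Fin M → ℂ) → ℂ) : Prop :=
  ∀ s : Fin M, T τ s C = C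

/-- A finite family `v` is a fundamental solution of `E_{N,M}` in the region `D`: it is a basis, over
the pseudo-constants, of the space of solutions in `D`. -/
structure IsFundamentalSolutionOn {N M : ℕ} (τ : ℂ) (a : Fin N → ℂ) (b : Fin M → ℂ)
    (c : Fin N → ℂ) (D : Set (Fin M → ℂ)) {ι : Type*} [Fintype ι]
    (v : ι → (Fin M → ℂ) → ℂ) : Prop where
  isSolution : ∀ i, IsSolutionOn τ a b c D (v i)
  linearIndependent : ∀ C : ι → (Fin M → ℂ) → ℂ, (∀ i, IsPseudoConstant τ (C i)) →
    (∀ z ∈ D, ∑ i, C i z * v i z = 0) → ∀ i, C i = 0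
  spanning : ∀ f : (Fin M → ℂ) → ℂ, IsSolutionOn τ a b c D f →
    ∃ C : ι → (Fin M → ℂ) → ℂ, (∀ i, IsPseudoConstant τ (C i)) ∧
      ∀ z ∈ D, f z = ∑ i, C i z * v i z

/-! ### The region and the condition on the parameters -/

/-- The region `D^{L,σ}` (its preimage in the covering). -/
def region {N M : ℕ} (q : ℂ) (a : Fin N → ℂ) (b : Fin M → ℂ) (c : Fin N → ℂ) (L : ℕ)
    (σ : Equiv.Perm (Fin M)) : Set (Fin M → ℂ) :=
  {z | (∀ i : Fin M, (i : ℕ) < L → ‖Complex.exp (z (σ i))‖ < 1) ∧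
    (∀ i : Fin M, L ≤ (i : ℕ) →
      ‖(∏ j, c j / a j) * (q / (b (σ i) * Complex.exp (z (σ i))))‖ < 1) ∧
    (∀ i j : Fin M, i < j →
      ‖q * Complex.exp (z (σ i)) / (b (σ j) * Complex.exp (z (σ j)))‖ < 1)}

/-- The non-resonance condition: `a_j / a_k`, `c_j / c_k` (for `j ≠ k`) and
`a_j / (b_{σ(i)} ⋯ b_{σ(M)})`, `c_j / (b_{σ(i)} ⋯ b_{σ(M)})` (for all `j` and `1 ≤ i ≤ M + 1`)
are not in `q^ℤ`. -/
structure NonResonant {N M : ℕ} (q : ℂ) (a : Fin N → ℂ) (b : Fin M → ℂ) (c : Fin N → ℂ)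
    (σ : Equiv.Perm (Fin M)) : Prop where
  a_div_a : ∀ j k : Fin N, j ≠ k → ∀ n : ℤ, a j / a k ≠ q ^ n
  c_div_c : ∀ j k : Fin N, j ≠ k → ∀ n : ℤ, c j / c k ≠ q ^ n
  a_div_b : ∀ (j : Fin N) (i : ℕ), i ≤ M → ∀ n : ℤ, a j / tailProd (fun i => b (σ i)) i ≠ q ^ n
  c_div_b : ∀ (j : Fin N) (i : ℕ), i ≤ M → ∀ n : ℤ, c j / tailProd (fun i => b (σ i)) i ≠ q ^ n

end QHyp

end

/-!
Ratios `(x)_n / (y)_n` are bounded as `n → ∞` and grow at most geometrically as `n → -∞`, so the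
terms of all the series are bounded by multiple geometric series in `D^{L,σ}`. Each component of
`u^{L,σ}` is a permuted instance of one normal form, a monomial times a series over a lattice of
exponents; for such a series the equations follow from first order recurrences of the coefficients.

Independence over the pseudo-constants is seen on an orbit of the `q`-shifts: far out in a suitable
direction of the lattice `ℤ^M`, each component is asymptotic to a character, and by non-resonance
the `N M + 1` characters are distinct.

On an orbit, `D^{L,σ}` cuts out a polyhedron of `ℤ^M`, and the equations propagate zeros inside it,
so that a solution is determined there by `N M + 1` of its values. By a dimension count the
components span the solutions on each orbit, and coefficients chosen orbit by orbit are
pseudo-constants.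
-/

section

open Finset Filter Topology

namespace QHyp

/-! ### The `q`-shifted factorial -/

section QPoch

variable {q : ℂ}

@[simp]
lemma qPoch_zero (q x : ℂ) : qPoch q x 0 = 1 :=
  Finset.prod_range_zero _

lemma qPoch_natCast (q x : ℂ) (n : ℕ) :
    qPoch q x (n : ℤ) = ∏ k ∈ range n, (1 - x * q ^ k) := rfl

lemma qPoch_neg_natCast (q x : ℂ) (n : ℕ) :
    qPoch q x (-(n : ℤ)) = (∏ k ∈ range n, (1 - x / q ^ (k + 1)))⁻¹ := by
  cases n with
  | zero => simp
  | succ n => rfl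

lemma qPoch_add_one (x : ℂ) (n : ℤ) (h : n < 0 → x * q ^ n ≠ 1) :
    qPoch q x (n + 1) = qPoch q x n * (1 - x * q ^ n) := by
  obtain ⟨n, rfl⟩ | ⟨n, rfl⟩ : (∃ k : ℕ, n = k) ∨ ∃ k : ℕ, n = -((k + 1 : ℕ) : ℤ) := by
    rcases n with n | n
    exacts [.inl ⟨n, rfl⟩, .inr ⟨n, rfl⟩]
  · rw [← Nat.cast_add_one, qPoch_natCast, qPoch_natCast, prod_range_succ, zpow_natCast]
  · have hx : 1 - x / q ^ (n + 1) ≠ 0 := by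
      have := h (by lia)
      rw [zpow_neg, zpow_natCast, ← div_eq_mul_inv] at this
      exact sub_ne_zero.mpr this.symm
    rw [show -((n + 1 : ℕ) : ℤ) + 1 = -(n : ℤ) by push_cast; ring, qPoch_neg_natCast,
      qPoch_neg_natCast, prod_range_succ, mul_inv, zpow_neg, zpow_natCast, ← div_eq_mul_inv x,
      mul_assoc, inv_mul_cancel₀ hx, mul_one]

lemma qPoch_div_add_one {x y : ℂ} (n : ℤ) (hx : n < 0 → x * q ^ n ≠ 1) (hy : y * q ^ n ≠ 1) :
    qPoch q x (n + 1) / qPoch q y (n + 1) * (1 - y * q ^ n) =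
      qPoch q x n / qPoch q y n * (1 - x * q ^ n) := by
  rw [qPoch_add_one x n hx, qPoch_add_one y n fun _ => hy, mul_div_mul_comm, mul_assoc,
    div_mul_cancel₀ _ (sub_ne_zero.mpr hy.symm)]

lemma qPoch_neg_natCast_eq_inv_mul (hq : q ≠ 0) {x : ℂ} (hx : x ≠ 0) (n : ℕ) :
    qPoch q x (-(n : ℤ)) =
      ((∏ k ∈ range n, (-(q ^ (k + 1))⁻¹)) * (x ^ n * qPoch q (q / x) n))⁻¹ := by
  rw [qPoch_neg_natCast, qPoch_natCast]
  congr 1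
  induction n with
  | zero => simp
  | succ n ih =>
    rw [prod_range_succ, prod_range_succ, prod_range_succ, ih]
    field_simp
    ring

lemma qPoch_neg_div_qPoch_neg (hq : q ≠ 0) {x y : ℂ} (hx : x ≠ 0) (hy : y ≠ 0) (n : ℕ) :
    qPoch q x (-n) / qPoch q y (-n) =
      (y / x) ^ n * (qPoch q (q / y) n / qPoch q (q / x) n) := by
  have hP : ∏ k ∈ range n, (-(q ^ (k + 1))⁻¹) ≠ 0 :=
    prod_ne_zero_iff.mpr fun k _ => neg_ne_zero.mpr (inv_ne_zero (pow_ne_zero _ hq))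
  rw [qPoch_neg_natCast_eq_inv_mul hq hx, qPoch_neg_natCast_eq_inv_mul hq hy, inv_div_inv,
    mul_div_mul_left _ _ hP, div_pow, div_mul_div_comm]

lemma exists_norm_qPoch_natCast_div_le (hq1 : ‖q‖ < 1) (x : ℂ) {y : ℂ}
    (hy : ∀ n : ℕ, y * q ^ n ≠ 1) :
    ∃ K : ℝ, ∀ n : ℕ, ‖qPoch q x n / qPoch q y n‖ ≤ K := by
  have hne (n : ℕ) : 1 - y * q ^ n ≠ 0 := sub_ne_zero.mpr (hy n).symm
  set e : ℕ → ℂ := fun n => (y - x) / (1 - y * q ^ n) * q ^ n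
  have hlim : Tendsto (fun n : ℕ => (y - x) / (1 - y * q ^ n)) atTop (𝓝 ((y - x) / (1 - y * 0))) :=
    tendsto_const_nhds.div
      ((tendsto_pow_atTop_nhds_zero_of_norm_lt_one hq1).const_mul y |>.const_sub 1) (by simp)
  obtain ⟨B, hB⟩ := (Metric.isBounded_range_of_tendsto _ hlim).exists_norm_le
  have he : Summable fun n => ‖e n‖ := by
    refine Summable.of_nonneg_of_le (fun _ => norm_nonneg _) (fun n => ?_)
      ((summable_geometric_of_lt_one (norm_nonneg q) hq1).mul_left B)
    rw [norm_mul, norm_pow]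
    exact mul_le_mul_of_nonneg_right (hB _ ⟨n, rfl⟩) (by positivity)
  obtain ⟨K, hK⟩ := (Metric.isBounded_range_of_tendsto _
    (multipliable_one_add_of_summable he).hasProd.tendsto_prod_nat).exists_norm_le
  refine ⟨K, fun n => ?_⟩
  have hprod : qPoch q x n / qPoch q y n = ∏ k ∈ range n, (1 + e k) := by
    rw [qPoch_natCast, qPoch_natCast, ← prod_div_distrib]
    refine prod_congr rfl fun k _ => ?_
    rw [div_eq_iff (hne k), add_mul, mul_right_comm, div_mul_cancel₀ _ (hne k)]
    ring
  exact hprod ▸ hK _ ⟨n, rfl⟩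

/-- `R` is bounded at `+∞` and grows at most like `ρ ^ |n|` at `-∞`. This is the only property of
the coefficient of a signed sum of indices that matters for convergence. -/
def GrowthLE (R : ℤ → ℂ) (ρ : ℝ) : Prop :=
  ∃ K : ℝ, ∀ n : ℤ, ‖R n‖ ≤ K * ρ ^ (-n).toNat

lemma growthLE_qPoch_div (hq : q ≠ 0) (hq1 : ‖q‖ < 1) {x y : ℂ} (hx0 : x ≠ 0) (hy0 : y ≠ 0)
    (hx : ∀ n : ℤ, x * q ^ n ≠ 1) (hy : ∀ n : ℤ, y * q ^ n ≠ 1) :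
    GrowthLE (fun n => qPoch q x n / qPoch q y n) ‖y / x‖ := by
  obtain ⟨K₁, h₁⟩ := exists_norm_qPoch_natCast_div_le hq1 x (y := y)
    fun n => by exact_mod_cast hy n
  obtain ⟨K₂, h₂⟩ := exists_norm_qPoch_natCast_div_le hq1 (q / y) (y := q / x) fun n h => by
    refine hx (-(n + 1)) ?_
    rw [zpow_neg, zpow_add_one₀ hq, zpow_natCast]
    field_simp at h ⊢
    rw [← h]
  refine ⟨max K₁ K₂, fun n => ?_⟩
  obtain ⟨m, rfl | rfl⟩ := n.eq_nat_or_neg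
  · simpa using (h₁ m).trans (le_max_left _ _)
  · beta_reduce
    rw [qPoch_neg_div_qPoch_neg hq hx0 hy0, norm_mul, norm_pow, mul_comm, neg_neg,
      Int.toNat_natCast]
    exact mul_le_mul_of_nonneg_right ((h₂ m).trans (le_max_right _ _)) (by positivity)

lemma GrowthLE.prod {ι : Type*} (s : Finset ι) {R : ι → ℤ → ℂ} {ρ : ι → ℝ}
    (h : ∀ i ∈ s, GrowthLE (R i) (ρ i)) :
    GrowthLE (fun n => ∏ i ∈ s, R i n) (∏ i ∈ s, ρ i) := by
  choose! K hK using h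
  refine ⟨∏ i ∈ s, K i, fun n => ?_⟩
  rw [norm_prod, ← prod_pow, ← prod_mul_distrib]
  exact prod_le_prod (fun _ _ => norm_nonneg _) fun i hi => hK i hi n

end QPoch

/-! ### Multiple series with a coefficient in a signed sum of the indices -/

section SignedTerm

variable {M : ℕ}

/-- The general term `R(m(l)) ∏ w_i(m_i) ∏ x_i^{m_i}` of a multiple series: the normal form to which
the three families of series are reduced. -/
def signedTerm (l : ℕ) (R : ℤ → ℂ) (w : Fin M → ℕ → ℂ) (x : Fin M → ℂ) (m : Fin M → ℕ) : ℂ :=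
  R (signedSum m l) * (∏ i, w i (m i)) * ∏ i, x i ^ m i

lemma signedSum_eq_sub (m : Fin M → ℕ) (l : ℕ) :
    signedSum m l = ((∑ i : Fin M with i.val < l, m i : ℕ) : ℤ) -
      ((∑ i : Fin M with ¬ i.val < l, m i : ℕ) : ℤ) := by
  rw [signedSum, sum_ite, sum_neg_distrib]
  push_cast
  ring

lemma summable_prod_apply {κ : Type*} {f : Fin M → κ → ℝ} (h0 : ∀ i n, 0 ≤ f i n)
    (hf : ∀ i, Summable (f i)) : Summable fun m : Fin M → κ => ∏ i, f i (m i) := by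
  induction M with
  | zero => exact (hasSum_fintype _).summable
  | succ M ih =>
    rw [← (Fin.consEquiv fun _ : Fin (M + 1) => κ).summable_iff]
    refine ((hf 0).mul_of_nonneg (ih (fun i => h0 i.succ) fun i => hf i.succ) (h0 0)
      fun _ => prod_nonneg fun _ _ => h0 _ _).congr fun p => ?_
    simp [Fin.consEquiv, Fin.prod_univ_succ]

lemma exists_group_bounds {ι : Type*} [Finite ι] (p : ι → Prop)
    {y : ι → ℝ} {ρ : ℝ} (hy : ∀ i, 0 ≤ y i) (hρ : 0 ≤ ρ)
    (h1 : ∀ i, p i → y i < 1) (h2 : ∀ i, ¬ p i → ρ * y i < 1)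
    (h3 : ∀ i j, p i → ¬ p j → y i * y j < 1) :
    ∃ X Y : ℝ, 0 ≤ X ∧ 0 ≤ Y ∧ (∀ i, p i → y i ≤ X) ∧ (∀ i, ¬ p i → y i ≤ Y) ∧
      X < 1 ∧ ρ * Y < 1 ∧ X * Y < 1 := by
  classical
  have := Fintype.ofFinite ι
  lift y to ι → NNReal using hy
  lift ρ to NNReal using hρ
  have sup_lt (r : NNReal) (s : Finset ι) (h : ∀ i ∈ s, r * y i < 1) : r * s.sup y < 1 := by
    rw [NNReal.mul_finset_sup]
    exact (Finset.sup_lt_iff (by simp)).mpr h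
  set X : NNReal := ({i | p i} : Finset ι).sup y
  set Y : NNReal := ({i | ¬ p i} : Finset ι).sup y
  have hX : X < 1 := (Finset.sup_lt_iff (by simp)).mpr fun i hi => h1 i (by simpa using hi)
  have hY : ρ * Y < 1 := sup_lt ρ _ fun i hi => h2 i (by simpa using hi)
  have hXY : X * Y < 1 := sup_lt X _ fun j hj => by
    rw [mul_comm]
    refine sup_lt (y j) _ fun i hi => ?_
    rw [mul_comm]
    exact h3 i j (by simpa using hi) (by simpa using hj)
  exact ⟨X, Y, X.coe_nonneg, Y.coe_nonneg, fun i hi => le_sup (f := y) (by simpa using hi),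
    fun i hi => le_sup (f := y) (by simpa using hi), hX, hY, hXY⟩

lemma pow_mul_pow_mul_pow_le {X Y ρ η : ℝ} (hX : 0 ≤ X) (hY : 0 ≤ Y) (hρ : 0 ≤ ρ)
    (hη0 : 0 ≤ η) (hη1 : η ≤ 1) (h1 : X ≤ η ^ 2) (h2 : ρ * Y ≤ η ^ 2) (h3 : X * Y ≤ η ^ 2)
    (m n : ℕ) : ρ ^ (n - m) * (X ^ m * Y ^ n) ≤ η ^ (m + n) := by
  rcases le_total n m with h | h
  · obtain ⟨d, rfl⟩ := Nat.exists_eq_add_of_le h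
    calc ρ ^ (n - (n + d)) * (X ^ (n + d) * Y ^ n) = (X * Y) ^ n * X ^ d := by
          rw [Nat.sub_eq_zero_of_le h]; ring
      _ ≤ (η ^ 2) ^ n * (η ^ 2) ^ d := by gcongr
      _ = η ^ (n + d + n) * η ^ d := by ring
      _ ≤ η ^ (n + d + n) := mul_le_of_le_one_right (by positivity) (pow_le_one₀ hη0 hη1)
  · obtain ⟨d, rfl⟩ := Nat.exists_eq_add_of_le h
    calc ρ ^ (m + d - m) * (X ^ m * Y ^ (m + d)) = (X * Y) ^ m * (ρ * Y) ^ d := by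
          rw [Nat.add_sub_cancel_left]; ring
      _ ≤ (η ^ 2) ^ m * (η ^ 2) ^ d := by gcongr
      _ = η ^ (m + (m + d)) * η ^ d := by ring
      _ ≤ η ^ (m + (m + d)) := mul_le_of_le_one_right (by positivity) (pow_le_one₀ hη0 hη1)

/-- The conditions `y_i < 1`, `ρ y_j < 1`, `y_i y_j < 1` are strict, so a common ratio is left. -/
lemma exists_pow_signedSum_mul_prod_le (l : ℕ) {y : Fin M → ℝ} {ρ : ℝ} (hy : ∀ i, 0 ≤ y i)
    (hρ : 0 ≤ ρ) (h1 : ∀ i : Fin M, (i : ℕ) < l → y i < 1)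
    (h2 : ∀ i : Fin M, ¬ (i : ℕ) < l → ρ * y i < 1)
    (h3 : ∀ i j : Fin M, (i : ℕ) < l → ¬ (j : ℕ) < l → y i * y j < 1) :
    ∃ η : ℝ, 0 ≤ η ∧ η < 1 ∧ ∀ m : Fin M → ℕ,
      ρ ^ (-(signedSum m l)).toNat * ∏ i, y i ^ m i ≤ ∏ i, η ^ m i := by
  obtain ⟨X, Y, hX0, hY0, hX, hY, hX1, hY1, hXY⟩ :=
    exists_group_bounds (fun i : Fin M => (i : ℕ) < l) hy hρ h1 h2 h3
  set θ : ℝ := max (X * Y) (max X (ρ * Y))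
  have hθ : √θ ^ 2 = θ := Real.sq_sqrt (le_max_of_le_left (by positivity))
  have hη1 : √θ < 1 := by
    rw [Real.sqrt_lt' one_pos, one_pow]
    exact max_lt hXY (max_lt hX1 hY1)
  refine ⟨√θ, Real.sqrt_nonneg _, hη1, fun m => ?_⟩
  set m₁ := ∑ i : Fin M with i.val < l, m i with hm₁
  set m₂ := ∑ i : Fin M with ¬ i.val < l, m i with hm₂
  have hprod : ∏ i, y i ^ m i ≤ X ^ m₁ * Y ^ m₂ := by
    rw [← prod_filter_mul_prod_filter_not univ fun i : Fin M => (i : ℕ) < l, hm₁, hm₂,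
      ← prod_pow_eq_pow_sum, ← prod_pow_eq_pow_sum]
    refine mul_le_mul (prod_le_prod (fun i _ => pow_nonneg (hy i) _) fun i hi => ?_)
      (prod_le_prod (fun i _ => pow_nonneg (hy i) _) fun i hi => ?_)
      (prod_nonneg fun i _ => pow_nonneg (hy i) _) (prod_nonneg fun _ _ => by positivity)
    · exact pow_le_pow_left₀ (hy i) (hX i (by simpa using hi)) _
    · exact pow_le_pow_left₀ (hy i) (hY i (by simpa using hi)) _
  have hsum : ∑ i, m i = m₁ + m₂ := (sum_filter_add_sum_filter_not _ _ _).symm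
  rw [prod_pow_eq_pow_sum, hsum, signedSum_eq_sub, show (-((m₁ : ℤ) - m₂)).toNat = m₂ - m₁ by lia]
  refine (mul_le_mul_of_nonneg_left hprod (by positivity)).trans
    (pow_mul_pow_mul_pow_le hX0 hY0 hρ (Real.sqrt_nonneg _) hη1.le ?_ ?_ ?_ _ _)
  all_goals rw [hθ]
  exacts [le_max_of_le_right (le_max_left _ _), le_max_of_le_right (le_max_right _ _),
    le_max_left _ _]

lemma summable_signedTerm (l : ℕ) {R : ℤ → ℂ} {w : Fin M → ℕ → ℂ} {x : Fin M → ℂ} {ρ : ℝ}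
    (hρ : 0 ≤ ρ) (hR : GrowthLE R ρ) (hw : ∀ i, ∃ K : ℝ, ∀ n, ‖w i n‖ ≤ K)
    (h1 : ∀ i : Fin M, (i : ℕ) < l → ‖x i‖ < 1)
    (h2 : ∀ i : Fin M, ¬ (i : ℕ) < l → ρ * ‖x i‖ < 1)
    (h3 : ∀ i j : Fin M, (i : ℕ) < l → ¬ (j : ℕ) < l → ‖x i‖ * ‖x j‖ < 1) :
    Summable (signedTerm l R w x) := by
  obtain ⟨K, hK⟩ := hR
  choose B hB using hw
  obtain ⟨η, hη0, hη1, hη⟩ :=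
    exists_pow_signedSum_mul_prod_le l (fun i => norm_nonneg (x i)) hρ h1 h2 h3
  have hgeom : Summable fun m : Fin M → ℕ => ∏ i, η ^ m i :=
    summable_prod_apply (fun _ _ => by positivity) fun _ => summable_geometric_of_lt_one hη0 hη1
  have hK0 : 0 ≤ K := by simpa using (norm_nonneg _).trans (hK 0)
  have hB0 : 0 ≤ ∏ i, B i := prod_nonneg fun i _ => (norm_nonneg _).trans (hB i 0)
  refine Summable.of_norm_bounded (hgeom.mul_left (K * ∏ i, B i)) fun m => ?_
  calc ‖signedTerm l R w x m‖
      = ‖R (signedSum m l)‖ * (∏ i, ‖w i (m i)‖) * ∏ i, ‖x i‖ ^ m i := by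
        simp only [signedTerm, norm_mul, norm_prod, norm_pow]
    _ ≤ K * ρ ^ (-(signedSum m l)).toNat * (∏ i, B i) * ∏ i, ‖x i‖ ^ m i := by
        gcongr with i
        exacts [hK _, hB i _]
    _ = (K * ∏ i, B i) * (ρ ^ (-(signedSum m l)).toNat * ∏ i, ‖x i‖ ^ m i) := by ring
    _ ≤ (K * ∏ i, B i) * ∏ i, η ^ m i :=
        mul_le_mul_of_nonneg_left (hη m) (mul_nonneg hK0 hB0)

lemma tendsto_tsum_signedTerm_one (l : ℕ) {R : ℤ → ℂ} {w : Fin M → ℕ → ℂ}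
    {x : ℕ → Fin M → ℂ} {y : Fin M → ℂ} (hs : Summable (signedTerm l R w y)) (hR : R 0 = 1)
    (hw : ∀ i, w i 0 = 1) (hle : ∀ᶠ k in atTop, ∀ i, ‖x k i‖ ≤ ‖y i‖)
    (hx : ∀ i, Tendsto (fun k => x k i) atTop (𝓝 0)) :
    Tendsto (fun k => ∑' m, signedTerm l R w (x k) m) atTop (𝓝 1) := by
  have hsum : ∑' m : Fin M → ℕ, (if m = 0 then (1 : ℂ) else 0) = 1 := by simp
  rw [← hsum]
  refine tendsto_tsum_of_dominated_convergence (bound := fun m => ‖signedTerm l R w y m‖) hs.norm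
    (fun m => ?_) ?_
  · have hzero : signedTerm l R w 0 m = if m = 0 then 1 else 0 := by
      split_ifs with hm
      · simp [hm, hw, hR, signedTerm, signedSum]
      · obtain ⟨i, hi⟩ := Function.ne_iff.mp hm
        exact mul_eq_zero_of_right _ (prod_eq_zero (mem_univ i) (zero_pow hi))
    rw [← hzero]
    exact (tendsto_finsetProd univ fun i _ => (hx i).pow (m i)).const_mul
      (R (signedSum m l) * ∏ i, w i (m i))
  · filter_upwards [hle] with k hk m
    simp only [signedTerm, norm_mul, norm_prod, norm_pow]
    gcongr with i
    exact hk i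

end SignedTerm

/-! ### Reduction of the three families of series to the normal form -/

noncomputable section NormalForm

lemma tailProd_eq_mul {M : ℕ} (b : Fin M → ℂ) (l : Fin M) :
    tailProd b l = b l * tailProd b (l + 1) := by
  have hset : ({i : Fin M | (l : ℕ) ≤ i.val} : Finset (Fin M)) =
      insert l ({i : Fin M | (l : ℕ) + 1 ≤ i.val} : Finset (Fin M)) := by
    ext i
    simp only [mem_insert, mem_filter_univ, Fin.ext_iff]
    lia
  rw [tailProd, hset, prod_insert (by simp), tailProd]

lemma tailProd_ne_zero {M : ℕ} {b : Fin M → ℂ} (hb : ∀ i, b i ≠ 0) (l : ℕ) : tailProd b l ≠ 0 :=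
  prod_ne_zero_iff.mpr fun i _ => hb i

@[to_additive]
lemma prod_lt_mul_prod_gt_mul {ι R : Type*} [Fintype ι] [LinearOrder ι] [CommMonoid R] (l : ι)
    (f : ι → R) : (∏ i with i < l, f i) * (∏ i with l < i, f i) * f l = ∏ i, f i := by
  rw [← prod_erase_mul univ f (mem_univ l),
    ← prod_filter_mul_prod_filter_not (univ.erase l) fun i => i < l]
  congr 2 <;> refine prod_congr ?_ fun _ _ => rfl
  all_goals
    ext i
    simp only [mem_filter, mem_erase, mem_univ]
    grind

lemma perm_apply_iff_of_fixed {α : Type*} {s : Equiv.Perm α} {p : α → Prop}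
    (h : ∀ i, ¬ p i → s i = i) (i : α) : p (s i) ↔ p i := by
  by_cases hi : p i
  · refine iff_of_true (by_contra fun hsi => hsi ?_) hi
    rwa [s.injective (h _ hsi)]
  · rw [h i hi]

lemma signedSum_comp_perm {M : ℕ} (m : Fin M → ℕ) (s : Equiv.Perm (Fin M)) (l : ℕ)
    (h : ∀ i, (s i : ℕ) < l ↔ (i : ℕ) < l) : signedSum (fun i => m (s i)) l = signedSum m l := by
  unfold signedSum
  rw [← Equiv.sum_comp s fun i : Fin M => if (i : ℕ) < l then (m i : ℤ) else -(m i : ℤ)]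
  simp only [h]

variable {N M : ℕ} (q : ℂ) (a : Fin N → ℂ) (b : Fin M → ℂ) (c : Fin N → ℂ) (L : ℕ)

/-- The cut `l` of the signed sum `m(l)` in the component of `u` with the given index. -/
def compCut : Option (Fin N × Fin M) → ℕ
  | none => L
  | some (_, l) => if (l : ℕ) < L then l else l + 1

/-- The number `x` for which the factor of `u_{k,l}` in the signed sum `n` is
`(x)_n / (q x / b_l)_n`. -/
def twoSidedBase (k : Fin N) (l : Fin M) : ℂ :=
  if (l : ℕ) < L then c k / (q * tailProd b (l + 1)) else a k / tailProd b (l + 1)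

/-- The factor of a component of `u` that depends on the signed sum of the indices. -/
def compTwoSided : Option (Fin N × Fin M) → ℤ → ℂ
  | none => fun n => ∏ j, qPoch q (a j / tailProd b L) n / qPoch q (c j / tailProd b L) n
  | some (k, l) => fun n =>
      qPoch q (twoSidedBase q a b c L k l) n / qPoch q (q * twoSidedBase q a b c L k l / b l) n

/-- The one-sided factor that replaces `(b_l)_n / (q)_n` in `u_{k,l}`. -/
def pivotFactor (k : Fin N) (l : Fin M) (n : ℕ) : ℂ :=
  if (l : ℕ) < L then ∏ j, qPoch q (q * a j / c k) n / qPoch q (q * c j / c k) n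
  else ∏ j, qPoch q (q * a k / c j) n / qPoch q (q * a k / a j) n

/-- The factors of a component of `u` that depend on a single index. -/
def compOneSided : Option (Fin N × Fin M) → Fin M → ℕ → ℂ
  | none => fun i n => qPoch q (b i) n / qPoch q q n
  | some (k, l) => fun i n =>
      if i = l then pivotFactor q a c L k l n else qPoch q (b i) n / qPoch q q n

/-- The variables of the power series in a component of `u`. -/
def compVar (t : Fin M → ℂ) : Option (Fin N × Fin M) → Fin M → ℂ
  | none => fun i => if (i : ℕ) < L then t i else q / (b i * t i)
  | some (_, l) => fun i =>
      if i < l then q * t i / (b l * t l)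
      else if l < i then b l * t l / (b i * t i)
      else if (l : ℕ) < L then b l * t l / q
      else (∏ j, c j / a j) * (q / (b l * t l))

variable {L} in
lemma compVar_some_of_lt (t : Fin M → ℂ) (k : Fin N) {i l : Fin M} (h : i < l) :
    compVar q a b c L t (some (k, l)) i = q * t i / (b l * t l) :=
  if_pos h

variable {L} in
lemma compVar_some_of_gt (t : Fin M → ℂ) (k : Fin N) {i l : Fin M} (h : l < i) :
    compVar q a b c L t (some (k, l)) i = b l * t l / (b i * t i) :=
  (if_neg h.not_gt).trans (if_pos h)

lemma compVar_some_self (t : Fin M → ℂ) (k : Fin N) (l : Fin M) :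
    compVar q a b c L t (some (k, l)) l = if (l : ℕ) < L then b l * t l / q
      else (∏ j, c j / a j) * (q / (b l * t l)) := by
  simp only [compVar, lt_irrefl, if_false]

lemma compTwoSided_zero (i : Option (Fin N × Fin M)) : compTwoSided q a b c L i 0 = 1 := by
  rcases i with _ | ⟨k, l⟩ <;> simp [compTwoSided]

lemma compOneSided_zero (i : Option (Fin N × Fin M)) (j : Fin M) :
    compOneSided q a b c L i j 0 = 1 := by
  rcases i with _ | ⟨k, l⟩ <;> simp [compOneSided, pivotFactor]

/-- The terms of the component of `u` with the given index, with the summation indices permuted so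
that the index `m_i` goes with `t_i`. -/
def compTerm (t : Fin M → ℂ) (i : Option (Fin N × Fin M)) : (Fin M → ℕ) → ℂ :=
  signedTerm (compCut L i) (compTwoSided q a b c L i) (compOneSided q a b c L i)
    (compVar q a b c L t i)

lemma termF0_eq_compTerm (t : Fin M → ℂ) (m : Fin M → ℕ) :
    termF0 q a b c L t m = compTerm q a b c L t none m := by
  simp only [termF0, compTerm, signedTerm, compCut, compTwoSided, compOneSided, compVar]
  rw [mul_assoc]
  congr 1
  rw [← prod_filter_mul_prod_filter_not univ fun i : Fin M => (i : ℕ) < L]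
  simp only [not_lt]
  congr 1 <;> refine prod_congr rfl fun i hi => ?_
  · rw [if_pos (by simpa using hi)]
  · rw [if_neg (by simpa using hi)]

variable {b} in
lemma mul_div_tailProd_succ_div (hb : ∀ i, b i ≠ 0) (l : Fin M) (x : ℂ) :
    q * (x / tailProd b (l + 1)) / b l = q * x / tailProd b l := by
  have h1 := tailProd_ne_zero hb (l + 1)
  have h2 := hb l
  rw [tailProd_eq_mul]
  field_simp

lemma compTerm_some (t : Fin M → ℂ) (k : Fin N) (l : Fin M) (m : Fin M → ℕ) :
    compTerm q a b c L t (some (k, l)) m =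
    pivotFactor q a c L k l (m l) *
      (∏ i with i ≠ l, qPoch q (b i) (m i) / qPoch q q (m i)) *
      compTwoSided q a b c L (some (k, l)) (signedSum m (compCut L (some (k, l)))) *
      (∏ i with i < l, (q * t i / (b l * t l)) ^ m i) *
      (∏ i with l < i, (b l * t l / (b i * t i)) ^ m i) *
      compVar q a b c L t (some (k, l)) l ^ m l := by
  have hlocal : ∏ i, compOneSided q a b c L (some (k, l)) i (m i) =
      pivotFactor q a c L k l (m l) *
        ∏ i with i ≠ l, qPoch q (b i) (m i) / qPoch q q (m i) := by
    rw [← mul_prod_erase univ _ (mem_univ l), ← filter_ne']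
    congr 1
    · exact if_pos rfl
    · exact prod_congr rfl fun i hi => if_neg (by simpa using hi)
  have hlt : ∏ i with i < l, compVar q a b c L t (some (k, l)) i ^ m i =
      ∏ i with i < l, (q * t i / (b l * t l)) ^ m i :=
    prod_congr rfl fun i hi => by rw [compVar_some_of_lt q a b c t k (by simpa using hi)]
  have hgt : ∏ i with l < i, compVar q a b c L t (some (k, l)) i ^ m i =
      ∏ i with l < i, (b l * t l / (b i * t i)) ^ m i :=
    prod_congr rfl fun i hi => by rw [compVar_some_of_gt q a b c t k (by simpa using hi)]
  rw [compTerm, signedTerm,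
    ← prod_lt_mul_prod_gt_mul l fun i => compVar q a b c L t (some (k, l)) i ^ m i, hlocal, hlt,
    hgt]
  ring

variable {q b L}

lemma termG_eq_compTerm (hq : q ≠ 0) (hb : ∀ i, b i ≠ 0) (hL : L ≤ M) (k : Fin N) (l : Fin M)
    (hl : (l : ℕ) < L) (t : Fin M → ℂ) (m : Fin M → ℕ) :
    termG q a b c L hL k l hl t m = compTerm q a b c L t (some (k, l)) fun j =>
      m ((Fin.cycleIcc l ⟨L - 1, by lia⟩).symm j) := by
  have : NeZero M := ⟨by lia⟩
  set p : Fin M := ⟨L - 1, by lia⟩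
  have hlp : l ≤ p := by rw [Fin.le_def]; dsimp [p]; lia
  have hpivot : (Fin.cycleIcc l p).symm l = p := by
    rw [Equiv.symm_apply_eq, Fin.cycleIcc_of_last hlp]
  have hsum : signedSum (fun j => m ((Fin.cycleIcc l p).symm j)) l = signedSum m l := by
    refine signedSum_comp_perm m _ _ fun i => not_iff_not.mp ?_
    refine perm_apply_iff_of_fixed (p := fun i : Fin M => ¬ (i : ℕ) < l) (fun i hi => ?_) i
    rw [Equiv.symm_apply_eq, Fin.cycleIcc_of_lt (Fin.lt_def.mpr (not_not.mp hi))]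
  have hdenom : q * twoSidedBase q a b c L k l / b l = c k / tailProd b l := by
    rw [← mul_div_cancel₀ (c k) hq, ← mul_div_tailProd_succ_div q hb, twoSidedBase, if_pos hl,
      ← div_div]
  rw [compTerm_some]
  simp only [termG, compCut, if_pos hl, pivotFactor, compTwoSided, hsum, hpivot, hdenom, p]
  simp only [twoSidedBase, compVar_some_self, if_pos hl]

lemma termF_eq_compTerm (hb : ∀ i, b i ≠ 0) (k : Fin N) (l : Fin M) (hl : L ≤ (l : ℕ))
    (t : Fin M → ℂ) (m : Fin M → ℕ) :
    termF q a b c L k l hl t m = compTerm q a b c L t (some (k, l)) fun j =>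
      m (Fin.cycleIcc ⟨L, hl.trans_lt l.isLt⟩ l j) := by
  have : NeZero M := ⟨by lia⟩
  set p : Fin M := ⟨L, hl.trans_lt l.isLt⟩
  have hpl : p ≤ l := hl
  have hpivot : Fin.cycleIcc p l l = p := Fin.cycleIcc_of_last hpl
  have hsum : signedSum (fun j => m (Fin.cycleIcc p l j)) (l + 1) = signedSum m (l + 1) :=
    signedSum_comp_perm m _ _ <| perm_apply_iff_of_fixed (p := fun i : Fin M => (i : ℕ) < l + 1)
      fun i hi => Fin.cycleIcc_of_gt (by rw [Fin.lt_def]; lia)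
  have hdenom : q * twoSidedBase q a b c L k l / b l = q * a k / tailProd b l := by
    rw [← mul_div_tailProd_succ_div q hb, twoSidedBase, if_neg hl.not_gt]
  rw [compTerm_some]
  simp only [termF, compCut, if_neg hl.not_gt, pivotFactor, compTwoSided, hsum, hpivot, hdenom, p]
  simp only [twoSidedBase, compVar_some_self, if_neg hl.not_gt]

lemma exists_perm_uTerm_eq_compTerm (hq : q ≠ 0) (hb : ∀ i, b i ≠ 0) (hL : L ≤ M)
    (i : Option (Fin N × Fin M)) :
    ∃ s : Equiv.Perm (Fin M), ∀ (t : Fin M → ℂ) (m : Fin M → ℕ),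
      uTerm q a b c L hL t i m = compTerm q a b c L t i fun j => m (s j) := by
  rcases i with _ | ⟨k, l⟩
  · exact ⟨1, termF0_eq_compTerm q a b c L⟩
  by_cases hl : (l : ℕ) < L
  · exact ⟨_, fun t m => (congrFun (dif_pos hl) m).trans
      (termG_eq_compTerm a c hq hb hL k l hl t m)⟩
  · exact ⟨_, fun t m => (congrFun (dif_neg hl) m).trans
      (termF_eq_compTerm a c hb k l (not_lt.mp hl) t m)⟩

end NormalForm

/-! ### Convergence -/

section Convergence

variable {N M : ℕ} {q : ℂ} {a : Fin N → ℂ} {b : Fin M → ℂ} {c : Fin N → ℂ} {L : ℕ}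

/-- The assumptions of the theorem on `q` and on the parameters, for the trivial permutation. -/
structure Admissible (q : ℂ) (a : Fin N → ℂ) (b : Fin M → ℂ) (c : Fin N → ℂ) : Prop where
  q_ne : q ≠ 0
  q_lt : ‖q‖ < 1
  a_ne : ∀ j, a j ≠ 0
  b_ne : ∀ i, b i ≠ 0
  c_ne : ∀ j, c j ≠ 0
  a_div_a : ∀ j k : Fin N, j ≠ k → ∀ n : ℤ, a j / a k ≠ q ^ n
  c_div_c : ∀ j k : Fin N, j ≠ k → ∀ n : ℤ, c j / c k ≠ q ^ n
  a_div_b : ∀ (j : Fin N) (i : ℕ), i ≤ M → ∀ n : ℤ, a j / tailProd b i ≠ q ^ n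
  c_div_b : ∀ (j : Fin N) (i : ℕ), i ≤ M → ∀ n : ℤ, c j / tailProd b i ≠ q ^ n

lemma zpow_mul_mul_zpow_ne_one {x : ℂ} (hq : q ≠ 0) (h : ∀ n : ℤ, x ≠ q ^ n) (d n : ℤ) :
    q ^ d * x * q ^ n ≠ 1 := fun h1 => h (-(d + n)) <| by
  rw [zpow_neg, zpow_add₀ hq]
  exact eq_inv_of_mul_eq_one_left (by rw [← h1]; ring)

namespace Admissible

lemma zpow_ne_one (h : Admissible q a b c) {n : ℤ} (hn : n ≠ 0) : q ^ n ≠ 1 := fun h1 => by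
  have h2 := congrArg norm h1
  rw [norm_zpow, norm_one] at h2
  exact hn ((zpow_eq_one_iff_right₀ (norm_nonneg q) h.q_lt.ne).mp h2)

lemma mul_pow_ne_one (h : Admissible q a b c) (n : ℕ) : q * q ^ n ≠ 1 := by
  rw [← pow_succ']
  exact_mod_cast h.zpow_ne_one (n := (n + 1 : ℕ)) (by lia)

lemma tailProd_ne (h : Admissible q a b c) (l : ℕ) : tailProd b l ≠ 0 :=
  tailProd_ne_zero h.b_ne l

lemma a_div_tailProd_mul_zpow_ne_one (h : Admissible q a b c) (j : Fin N) {i : ℕ} (hi : i ≤ M)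
    (n : ℤ) : a j / tailProd b i * q ^ n ≠ 1 := by
  simpa using zpow_mul_mul_zpow_ne_one h.q_ne (h.a_div_b j i hi) 0 n

lemma c_div_tailProd_mul_zpow_ne_one (h : Admissible q a b c) (j : Fin N) {i : ℕ} (hi : i ≤ M)
    (n : ℤ) : c j / tailProd b i * q ^ n ≠ 1 := by
  simpa using zpow_mul_mul_zpow_ne_one h.q_ne (h.c_div_b j i hi) 0 n

lemma twoSidedBase_ne (h : Admissible q a b c) (k : Fin N) (l : Fin M) :
    twoSidedBase q a b c L k l ≠ 0 := by
  unfold twoSidedBase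
  split_ifs
  · exact div_ne_zero (h.c_ne k) (mul_ne_zero h.q_ne (h.tailProd_ne _))
  · exact div_ne_zero (h.a_ne k) (h.tailProd_ne _)

lemma twoSidedBase_mul_zpow_ne_one (h : Admissible q a b c) (k : Fin N) (l : Fin M) (n : ℤ) :
    twoSidedBase q a b c L k l * q ^ n ≠ 1 := by
  unfold twoSidedBase
  split_ifs
  · have := zpow_mul_mul_zpow_ne_one h.q_ne (h.c_div_b k (l + 1) l.isLt) (-1) n
    rwa [zpow_neg_one, inv_mul_eq_div, div_div, mul_comm (tailProd b _)] at this
  · exact h.a_div_tailProd_mul_zpow_ne_one k l.isLt n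

lemma mul_twoSidedBase_div_mul_zpow_ne_one (h : Admissible q a b c) (k : Fin N) (l : Fin M)
    (n : ℤ) : q * twoSidedBase q a b c L k l / b l * q ^ n ≠ 1 := by
  unfold twoSidedBase
  split_ifs
  · rw [← div_div, mul_div_tailProd_succ_div q h.b_ne, mul_div_cancel₀ _ h.q_ne]
    exact h.c_div_tailProd_mul_zpow_ne_one k l.isLt.le n
  · rw [mul_div_tailProd_succ_div q h.b_ne, mul_div_assoc]
    simpa using zpow_mul_mul_zpow_ne_one h.q_ne (h.a_div_b k l l.isLt.le) 1 n

end Admissible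

/-- The geometric growth rate of the two-sided factor at `-∞`. -/
noncomputable def compRate (q : ℂ) (a : Fin N → ℂ) (b : Fin M → ℂ) (c : Fin N → ℂ) :
    Option (Fin N × Fin M) → ℝ
  | none => ‖∏ j, c j / a j‖
  | some (_, l) => ‖q / b l‖

lemma compRate_nonneg (i : Option (Fin N × Fin M)) : 0 ≤ compRate q a b c i := by
  rcases i with _ | ⟨_, l⟩ <;> exact norm_nonneg _

lemma exists_norm_prod_le {ι κ : Type*} (s : Finset ι) {f : ι → κ → ℂ}
    (h : ∀ i ∈ s, ∃ K : ℝ, ∀ n, ‖f i n‖ ≤ K) : ∃ K : ℝ, ∀ n, ‖∏ i ∈ s, f i n‖ ≤ K := by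
  choose! K hK using h
  refine ⟨∏ i ∈ s, K i, fun n => ?_⟩
  rw [norm_prod]
  exact prod_le_prod (fun _ _ => norm_nonneg _) fun i hi => hK i hi n

namespace Admissible

lemma growthLE_compTwoSided (h : Admissible q a b c) (hL : L ≤ M) (i : Option (Fin N × Fin M)) :
    GrowthLE (compTwoSided q a b c L i) (compRate q a b c i) := by
  rcases i with _ | ⟨k, l⟩
  · have h1 := GrowthLE.prod univ fun j _ => growthLE_qPoch_div h.q_ne h.q_lt
      (div_ne_zero (h.a_ne j) (h.tailProd_ne L)) (div_ne_zero (h.c_ne j) (h.tailProd_ne L))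
      (h.a_div_tailProd_mul_zpow_ne_one j hL) (h.c_div_tailProd_mul_zpow_ne_one j hL)
    simp only [div_div_div_cancel_right₀ (h.tailProd_ne L), ← norm_prod] at h1
    exact h1
  · have h0 := h.twoSidedBase_ne (L := L) k l
    have h1 := growthLE_qPoch_div h.q_ne h.q_lt h0
      (div_ne_zero (mul_ne_zero h.q_ne h0) (h.b_ne l)) (h.twoSidedBase_mul_zpow_ne_one k l)
      (h.mul_twoSidedBase_div_mul_zpow_ne_one k l)
    rw [mul_div_right_comm, mul_div_cancel_right₀ _ h0, ← mul_div_right_comm] at h1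
    exact h1

lemma mul_c_div_c_mul_pow_ne_one (h : Admissible q a b c) (j k : Fin N) (n : ℕ) :
    q * c j / c k * q ^ n ≠ 1 := by
  rcases eq_or_ne j k with rfl | hjk
  · rw [mul_div_cancel_right₀ _ (h.c_ne j)]
    exact h.mul_pow_ne_one n
  · simpa [mul_div_assoc] using zpow_mul_mul_zpow_ne_one h.q_ne (h.c_div_c j k hjk) 1 n

lemma mul_a_div_a_mul_pow_ne_one (h : Admissible q a b c) (j k : Fin N) (n : ℕ) :
    q * a j / a k * q ^ n ≠ 1 := by
  rcases eq_or_ne j k with rfl | hjk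
  · rw [mul_div_cancel_right₀ _ (h.a_ne j)]
    exact h.mul_pow_ne_one n
  · simpa [mul_div_assoc] using zpow_mul_mul_zpow_ne_one h.q_ne (h.a_div_a j k hjk) 1 n

lemma exists_norm_pivotFactor_le (h : Admissible q a b c) (k : Fin N) (l : Fin M) :
    ∃ K : ℝ, ∀ n, ‖pivotFactor q a c L k l n‖ ≤ K := by
  unfold pivotFactor
  split_ifs
  · exact exists_norm_prod_le _ fun j _ =>
      exists_norm_qPoch_natCast_div_le h.q_lt _ (h.mul_c_div_c_mul_pow_ne_one j k)
  · exact exists_norm_prod_le _ fun j _ =>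
      exists_norm_qPoch_natCast_div_le h.q_lt _ (h.mul_a_div_a_mul_pow_ne_one k j)

lemma exists_norm_compOneSided_le (h : Admissible q a b c) (i : Option (Fin N × Fin M))
    (j : Fin M) : ∃ K : ℝ, ∀ n, ‖compOneSided q a b c L i j n‖ ≤ K := by
  have h0 := exists_norm_qPoch_natCast_div_le h.q_lt (b j) h.mul_pow_ne_one
  rcases i with _ | ⟨k, l⟩
  · exact h0
  · simp only [compOneSided]
    split_ifs
    · exact h.exists_norm_pivotFactor_le k l
    · exact h0

end Admissible

/-- The region `D^{L,id}` in the coordinates `t`, as a subset of the torus. -/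
structure InRegion (q : ℂ) (a : Fin N → ℂ) (b : Fin M → ℂ) (c : Fin N → ℂ) (L : ℕ)
    (t : Fin M → ℂ) : Prop where
  ne_zero : ∀ i, t i ≠ 0
  small : ∀ i : Fin M, (i : ℕ) < L → ‖t i‖ < 1
  large : ∀ i : Fin M, L ≤ (i : ℕ) → ‖(∏ j, c j / a j) * (q / (b i * t i))‖ < 1
  ratio : ∀ i j : Fin M, i < j → ‖q * t i / (b j * t j)‖ < 1

namespace InRegion

variable {t : Fin M → ℂ}

lemma norm_compVar_lt_one (ht : InRegion q a b c L t) (i : Option (Fin N × Fin M)) {j : Fin M}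
    (hj : (j : ℕ) < compCut L i) : ‖compVar q a b c L t i j‖ < 1 := by
  rcases i with _ | ⟨k, l⟩ <;> simp only [compCut] at hj
  · simpa only [compVar, if_pos hj] using ht.small j hj
  rcases lt_trichotomy j l with h1 | rfl | h1
  · rw [compVar_some_of_lt q a b c t k h1]
    exact ht.ratio _ _ h1
  · have hl : ¬ (j : ℕ) < L := by grind
    rw [compVar_some_self, if_neg hl]
    exact ht.large j (not_lt.mp hl)
  · rw [Fin.lt_def] at h1
    grind

lemma compRate_mul_norm_compVar_lt_one (ht : InRegion q a b c L t) (hq : q ≠ 0)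
    (hb : ∀ i, b i ≠ 0) (i : Option (Fin N × Fin M)) {j : Fin M} (hj : ¬ (j : ℕ) < compCut L i) :
    compRate q a b c i * ‖compVar q a b c L t i j‖ < 1 := by
  rcases i with _ | ⟨k, l⟩ <;> simp only [compCut] at hj <;> rw [compRate, ← norm_mul]
  · simpa only [compVar, if_neg hj] using ht.large j (not_lt.mp hj)
  rcases lt_trichotomy j l with h1 | rfl | h1
  · rw [Fin.lt_def] at h1
    grind
  · have hl : (j : ℕ) < L := by grind
    rw [compVar_some_self, if_pos hl, div_mul_div_cancel₀' hq, mul_div_cancel_left₀ _ (hb j)]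
    exact ht.small j hl
  · rw [compVar_some_of_gt q a b c t k h1, ← mul_div_assoc, ← mul_assoc, div_mul_cancel₀ _ (hb l)]
    exact ht.ratio _ _ h1

lemma norm_compVar_mul_compVar_lt_one (ht : InRegion q a b c L t) (hq : q ≠ 0)
    (hb : ∀ i, b i ≠ 0) (i : Option (Fin N × Fin M)) {j j' : Fin M} (hj : (j : ℕ) < compCut L i)
    (hj' : ¬ (j' : ℕ) < compCut L i) :
    ‖compVar q a b c L t i j * compVar q a b c L t i j'‖ < 1 := by
  rcases i with _ | ⟨k, l⟩ <;> simp only [compCut] at hj hj'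
  · simp only [compVar, if_pos hj, if_neg hj']
    rw [← mul_div_assoc, mul_comm (t j)]
    exact ht.ratio _ _ (hj.trans_le (not_lt.mp hj'))
  have hlt := mul_ne_zero (hb l) (ht.ne_zero l)
  by_cases hl : (l : ℕ) < L
  · simp only [if_pos hl] at hj hj'
    rw [compVar_some_of_lt q a b c t k (show j < l from hj)]
    rcases (show l ≤ j' from not_lt.mp hj').lt_or_eq with h2 | rfl
    · rw [compVar_some_of_gt q a b c t k h2, div_mul_div_cancel₀ hlt]
      exact ht.ratio _ _ (lt_trans hj h2)
    · rw [compVar_some_self, if_pos hl, div_mul_div_cancel₀ hlt, mul_div_cancel_left₀ _ hq]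
      exact ht.small j (hj.trans hl)
  · simp only [if_neg hl] at hj hj'
    have h2 : l < j' := not_lt.mp hj'
    rw [compVar_some_of_gt q a b c t k h2]
    rcases (show j ≤ l from Nat.lt_succ_iff.mp hj).lt_or_eq with h3 | rfl
    · rw [compVar_some_of_lt q a b c t k h3, div_mul_div_cancel₀ hlt]
      exact ht.ratio _ _ (h3.trans h2)
    · rw [compVar_some_self, if_neg hl, mul_assoc, div_mul_div_cancel₀ hlt]
      exact ht.large j' ((not_lt.mp hl).trans h2.le)

end InRegion

lemma Admissible.summable_compTerm (h : Admissible q a b c) (hL : L ≤ M) {t : Fin M → ℂ}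
    (ht : InRegion q a b c L t) (i : Option (Fin N × Fin M)) :
    Summable (compTerm q a b c L t i) :=
  summable_signedTerm _ (compRate_nonneg i) (h.growthLE_compTwoSided hL i)
    (h.exists_norm_compOneSided_le i) (fun _ hj => ht.norm_compVar_lt_one i hj)
    (fun _ hj => ht.compRate_mul_norm_compVar_lt_one h.q_ne h.b_ne i hj) fun _ _ hj hj' =>
      norm_mul (compVar q a b c L t i _) _ ▸
        ht.norm_compVar_mul_compVar_lt_one h.q_ne h.b_ne i hj hj'

end Convergence

/-! ### The system in expanded form -/

section System

variable {N M : ℕ}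

/-- The polynomial `∏_j (1 - x_j X)`, whose value at the operator `T` is `prodOneSub τ x`. -/
noncomputable def oneSubPoly (x : Fin N → ℂ) : Polynomial ℂ :=
  ∏ j, (1 - Polynomial.C (x j) * Polynomial.X)

lemma eval_oneSubPoly (x : Fin N → ℂ) (w : ℂ) : (oneSubPoly x).eval w = ∏ j, (1 - x j * w) := by
  simp [oneSubPoly, Polynomial.eval_prod]

lemma natDegree_one_sub_C_mul_X_le (x : ℂ) :
    (1 - Polynomial.C x * Polynomial.X).natDegree ≤ 1 :=
  (Polynomial.natDegree_sub_le _ _).trans (by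
    simpa using Polynomial.natDegree_C_mul_le x Polynomial.X)

lemma natDegree_oneSubPoly_le (x : Fin N → ℂ) : (oneSubPoly x).natDegree ≤ N := by
  refine (Polynomial.natDegree_prod_le _ _).trans ?_
  simpa using sum_le_sum fun j (_ : j ∈ univ) => natDegree_one_sub_C_mul_X_le (x j)

lemma coeff_zero_oneSubPoly (x : Fin N → ℂ) : (oneSubPoly x).coeff 0 = 1 := by
  simp [Polynomial.coeff_zero_eq_eval_zero, eval_oneSubPoly]

lemma coeff_top_oneSubPoly (x : Fin N → ℂ) : (oneSubPoly x).coeff N = ∏ j, (-x j) := by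
  have h := Polynomial.coeff_prod_of_natDegree_le (s := univ)
    (fun j => 1 - Polynomial.C (x j) * Polynomial.X) 1 fun j _ => natDegree_one_sub_C_mul_X_le (x j)
  simp only [card_univ, Fintype.card_fin, mul_one] at h
  simp [oneSubPoly, h, Polynomial.coeff_one]

lemma shiftAllPt_iterate (τ : ℂ) (k : ℕ) (z : Fin M → ℂ) :
    (shiftAllPt τ)^[k] z = fun i => z i + k * τ := by
  induction k with
  | zero => simp
  | succ k ih =>
    rw [Function.iterate_succ_apply', ih]
    ext i
    simp only [shiftAllPt]
    push_cast
    ring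

lemma shiftPt_shiftAllPt_iterate (τ : ℂ) (k : ℕ) (s : Fin M) (z : Fin M → ℂ) :
    shiftPt τ s ((shiftAllPt τ)^[k] z) = (shiftAllPt τ)^[k] (shiftPt τ s z) := by
  rw [shiftAllPt_iterate, shiftAllPt_iterate]
  ext i
  rcases eq_or_ne i s with rfl | h
  · simp [shiftPt, add_right_comm]
  · simp [shiftPt, h]

lemma shiftPt_comm (τ : ℂ) (r s : Fin M) (z : Fin M → ℂ) :
    shiftPt τ r (shiftPt τ s z) = shiftPt τ s (shiftPt τ r z) := by
  ext i
  simp only [shiftPt, Function.update_apply]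
  grind

lemma TAll_pow_apply (τ : ℂ) (k : ℕ) (f : (Fin M → ℂ) → ℂ) (z : Fin M → ℂ) :
    ((TAll τ : Op M) ^ k) f z = f ((shiftAllPt τ)^[k] z) := by
  induction k generalizing z with
  | zero => simp
  | succ k ih =>
    rw [pow_succ', Module.End.mul_apply, Function.iterate_succ_apply]
    exact ih (shiftAllPt τ z)

lemma prodOneSub_apply (τ : ℂ) (x : Fin N → ℂ) (f : (Fin M → ℂ) → ℂ) (z : Fin M → ℂ) :
    (prodOneSub τ x : Op M) f z =
      ∑ k ∈ range (N + 1), (oneSubPoly x).coeff k * f ((shiftAllPt τ)^[k] z) := by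
  have h : (prodOneSub τ x : Op M) = Polynomial.aeval (TAll τ : Op M) (oneSubPoly x) := by
    rw [oneSubPoly, ← List.prod_ofFn, map_list_prod, List.map_ofFn, prodOneSub]
    congr 2
    ext1 j
    simp [Algebra.smul_def]
  rw [h, Polynomial.aeval_eq_sum_range' (Nat.lt_succ_of_le (natDegree_oneSubPoly_le x))]
  simp [LinearMap.sum_apply, TAll_pow_apply]

/-- The equation `eq_one` of the system with index `s` at the point `z`, written out in terms of the
values of `f`. -/
def EqOneAt (τ : ℂ) (a : Fin N → ℂ) (b : Fin M → ℂ) (c : Fin N → ℂ) (f : (Fin M → ℂ) → ℂ)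
    (s : Fin M) (z : Fin M → ℂ) : Prop :=
  Complex.exp (z s) * ∑ k ∈ range (N + 1), (oneSubPoly a).coeff k *
      (f ((shiftAllPt τ)^[k] z) - b s * f ((shiftAllPt τ)^[k] (shiftPt τ s z))) =
    ∑ k ∈ range (N + 1), (oneSubPoly fun j => c j * (Complex.exp τ)⁻¹).coeff k *
      (f ((shiftAllPt τ)^[k] z) - f ((shiftAllPt τ)^[k] (shiftPt τ s z)))

/-- The equation `eq_two` of the system with indices `r`, `s` at the point `z`, written out in terms
of the values of `f`. -/
def EqTwoAt (τ : ℂ) (b : Fin M → ℂ) (f : (Fin M → ℂ) → ℂ) (r s : Fin M) (z : Fin M → ℂ) : Prop :=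
  Complex.exp (z r) * (f z - f (shiftPt τ s z) -
      b r * (f (shiftPt τ r z) - f (shiftPt τ r (shiftPt τ s z)))) =
    Complex.exp (z s) * (f z - f (shiftPt τ r z) -
      b s * (f (shiftPt τ s z) - f (shiftPt τ r (shiftPt τ s z))))

lemma eqOneAt_iff (τ : ℂ) (a : Fin N → ℂ) (b : Fin M → ℂ) (c : Fin N → ℂ)
    (f : (Fin M → ℂ) → ℂ) (s : Fin M) (z : Fin M → ℂ) :
    EqOneAt τ a b c f s z ↔
      Complex.exp (z s) * (prodOneSub τ a * (1 - b s • T τ s) : Op M) f z -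
        (prodOneSub τ (fun j => c j * (Complex.exp τ)⁻¹) * (1 - T τ s) : Op M) f z = 0 := by
  rw [sub_eq_zero, Module.End.mul_apply, Module.End.mul_apply, prodOneSub_apply, prodOneSub_apply,
    EqOneAt]
  simp [T, shiftPt_shiftAllPt_iterate]

lemma eqTwoAt_iff (τ : ℂ) (b : Fin M → ℂ) (f : (Fin M → ℂ) → ℂ) (r s : Fin M) (z : Fin M → ℂ) :
    EqTwoAt τ b f r s z ↔
      Complex.exp (z r) * ((1 - b r • T τ r) * (1 - T τ s) : Op M) f z -
        Complex.exp (z s) * ((1 - b s • T τ s) * (1 - T τ r) : Op M) f z = 0 := by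
  rw [sub_eq_zero, Module.End.mul_apply, Module.End.mul_apply, EqTwoAt]
  simp [T, shiftPt_comm τ s r]

lemma eqTwoAt_comm (τ : ℂ) (b : Fin M → ℂ) (f : (Fin M → ℂ) → ℂ) (r s : Fin M) (z : Fin M → ℂ) :
    EqTwoAt τ b f r s z ↔ EqTwoAt τ b f s r z := by
  rw [EqTwoAt, EqTwoAt, shiftPt_comm τ s r, eq_comm]

lemma isSolutionOn_iff (τ : ℂ) (a : Fin N → ℂ) (b : Fin M → ℂ) (c : Fin N → ℂ)
    (D : Set (Fin M → ℂ)) (f : (Fin M → ℂ) → ℂ) :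
    IsSolutionOn τ a b c D f ↔
      (∀ s z, (∀ n ≤ N, (shiftAllPt τ)^[n] z ∈ D ∧ (shiftAllPt τ)^[n] (shiftPt τ s z) ∈ D) →
        EqOneAt τ a b c f s z) ∧
      (∀ r s, r ≠ s → ∀ z, z ∈ D → shiftPt τ r z ∈ D → shiftPt τ s z ∈ D →
        shiftPt τ r (shiftPt τ s z) ∈ D → EqTwoAt τ b f r s z) := by
  simp only [eqOneAt_iff]
  refine ⟨fun h => ⟨h.eq_one, fun r s hrs z hz hr hs hrs' => ?_⟩, fun ⟨h1, h2⟩ =>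
    ⟨h1, fun r s hrs z hz hr hs hrs' => (eqTwoAt_iff ..).mp (h2 r s hrs.ne z hz hr hs hrs')⟩⟩
  rcases lt_or_gt_of_ne hrs with hlt | hlt
  · exact (eqTwoAt_iff ..).mpr (h.eq_two r s hlt z hz hr hs hrs')
  · exact (eqTwoAt_comm ..).mp <| (eqTwoAt_iff ..).mpr <|
      h.eq_two s r hlt z hz hs hr (shiftPt_comm τ s r z ▸ hrs')

end System

/-! ### Formal solutions -/

section Formal

variable {N M : ℕ}

/-- The monomial `t^(δ+n)` at `t = exp z`. -/
noncomputable def latticeMonomial (δ : Fin M → ℂ) (n : Fin M → ℤ) (z : Fin M → ℂ) : ℂ :=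
  Complex.exp (∑ i, (δ i + n i) * z i)

lemma exp_mul_add_intCast (τ x : ℂ) (n : ℤ) :
    Complex.exp (τ * (x + n)) = Complex.exp (τ * x) * Complex.exp τ ^ n := by
  rw [← Complex.exp_int_mul, ← Complex.exp_add]
  ring_nf

lemma latticeMonomial_shiftPt (τ : ℂ) (δ : Fin M → ℂ) (n : Fin M → ℤ) (s : Fin M) (z : Fin M → ℂ) :
    latticeMonomial δ n (shiftPt τ s z) =
      Complex.exp (τ * δ s) * Complex.exp τ ^ n s * latticeMonomial δ n z := by
  have hterm (i) : (δ i + n i) * shiftPt τ s z i =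
      (if i = s then τ * (δ i + n i) else 0) + (δ i + n i) * z i := by
    simp only [shiftPt, Function.update_apply]
    grind
  rw [latticeMonomial, latticeMonomial, ← exp_mul_add_intCast, ← Complex.exp_add,
    sum_congr rfl fun i _ => hterm i, sum_add_distrib]
  simp

lemma latticeMonomial_shiftAllPt (τ : ℂ) (δ : Fin M → ℂ) (n : Fin M → ℤ) (k : ℕ) (z : Fin M → ℂ) :
    latticeMonomial δ n ((shiftAllPt τ)^[k] z) =
      (Complex.exp (τ * ∑ i, δ i) * Complex.exp τ ^ (∑ i, n i)) ^ k * latticeMonomial δ n z := by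
  rw [latticeMonomial, latticeMonomial, ← exp_mul_add_intCast, ← Complex.exp_nat_mul,
    ← Complex.exp_add, shiftAllPt_iterate]
  congr 1
  push_cast
  rw [← sum_add_distrib, mul_sum, mul_sum, ← sum_add_distrib]
  exact sum_congr rfl fun i _ => by ring

lemma latticeMonomial_add_single (δ : Fin M → ℂ) (n : Fin M → ℤ) (s : Fin M) (z : Fin M → ℂ) :
    latticeMonomial δ (n + Pi.single s 1) z = Complex.exp (z s) * latticeMonomial δ n z := by
  have hterm (i) : (δ i + ((n + Pi.single s 1 : Fin M → ℤ) i : ℤ)) * z i =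
      (if i = s then z i else 0) + (δ i + n i) * z i := by
    rw [Pi.add_apply, Pi.single_apply]
    split_ifs <;> push_cast <;> ring
  rw [latticeMonomial, latticeMonomial, ← Complex.exp_add, sum_congr rfl fun i _ => hterm i,
    sum_add_distrib]
  simp

lemma sum_add_single (n : Fin M → ℤ) (s : Fin M) :
    ∑ i, (n + Pi.single s 1 : Fin M → ℤ) i = ∑ i, n i + 1 := by
  simp [sum_add_distrib]

section Coefficients

variable {τ : ℂ} {a : Fin N → ℂ} {b : Fin M → ℂ} {c : Fin N → ℂ} {D : Set (Fin M → ℂ)}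
  {f : (Fin M → ℂ) → ℂ} {δ : Fin M → ℂ} {A : (Fin M → ℤ) → ℂ}

lemma hasSum_sum_coeff_oneSubPoly
    (hf : ∀ z ∈ D, HasSum (fun n => A n * latticeMonomial δ n z) (f z)) {s : Fin M} {z : Fin M → ℂ}
    (hz : ∀ k ≤ N, (shiftAllPt τ)^[k] z ∈ D ∧ (shiftAllPt τ)^[k] (shiftPt τ s z) ∈ D)
    (x : Fin N → ℂ) (y : ℂ) :
    HasSum (fun n : Fin M → ℤ =>
      (∏ j, (1 - x j * (Complex.exp (τ * ∑ i, δ i) * Complex.exp τ ^ ∑ i, n i))) *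
        (1 - y * (Complex.exp (τ * δ s) * Complex.exp τ ^ n s)) * (A n * latticeMonomial δ n z))
      (∑ k ∈ range (N + 1), (oneSubPoly x).coeff k * (f ((shiftAllPt τ)^[k] z) -
        y * f ((shiftAllPt τ)^[k] (shiftPt τ s z)))) := by
  have hle {k} (hk : k ∈ range (N + 1)) : k ≤ N := Nat.lt_succ_iff.mp (mem_range.mp hk)
  refine HasSum.congr_fun (hasSum_sum (s := range (N + 1)) fun k hk =>
    ((hf _ (hz k (hle hk)).1).sub ((hf _ (hz k (hle hk)).2).mul_left y)).mul_left
      ((oneSubPoly x).coeff k)) fun n => ?_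
  rw [← eval_oneSubPoly,
    Polynomial.eval_eq_sum_range' (Nat.lt_succ_of_le (natDegree_oneSubPoly_le x)), sum_mul, sum_mul]
  refine sum_congr rfl fun k _ => ?_
  rw [latticeMonomial_shiftAllPt, latticeMonomial_shiftAllPt, latticeMonomial_shiftPt]
  ring

lemma eqOneAt_of_hasSum
    (hf : ∀ z ∈ D, HasSum (fun n => A n * latticeMonomial δ n z) (f z)) {s : Fin M} {z : Fin M → ℂ}
    (hz : ∀ k ≤ N, (shiftAllPt τ)^[k] z ∈ D ∧ (shiftAllPt τ)^[k] (shiftPt τ s z) ∈ D)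
    (hA : ∀ n : Fin M → ℤ, A (n + Pi.single s 1) *
        ((∏ j, (1 - c j * (Complex.exp (τ * ∑ i, δ i) * Complex.exp τ ^ ∑ i, n i))) *
          (1 - Complex.exp (τ * δ s) * Complex.exp τ ^ (n s + 1))) =
      A n * ((∏ j, (1 - a j * (Complex.exp (τ * ∑ i, δ i) * Complex.exp τ ^ ∑ i, n i))) *
          (1 - b s * (Complex.exp (τ * δ s) * Complex.exp τ ^ n s)))) :
    EqOneAt τ a b c f s z := by
  have hleft := (hasSum_sum_coeff_oneSubPoly hf hz a (b s)).mul_left (Complex.exp (z s))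
  have hright := (Equiv.addRight (Pi.single s 1 : Fin M → ℤ)).hasSum_iff.mpr
    (hasSum_sum_coeff_oneSubPoly hf hz (fun j => c j * (Complex.exp τ)⁻¹) 1)
  simp only [one_mul] at hright
  refine hleft.unique (hright.congr_fun fun n => ?_)
  have hc : ∏ j, (1 - c j * (Complex.exp τ)⁻¹ *
        (Complex.exp (τ * ∑ i, δ i) * Complex.exp τ ^ (∑ i, n i + 1))) =
      ∏ j, (1 - c j * (Complex.exp (τ * ∑ i, δ i) * Complex.exp τ ^ ∑ i, n i)) := by
    refine prod_congr rfl fun j _ => ?_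
    rw [zpow_add_one₀ (Complex.exp_ne_zero τ)]
    field_simp
  simp only [Function.comp, Equiv.coe_addRight, sum_add_single, latticeMonomial_add_single, hc]
  simp only [Pi.add_apply, Pi.single_eq_same]
  linear_combination (-Complex.exp (z s) * latticeMonomial δ n z) * hA n

lemma eqTwoAt_of_hasSum
    (hf : ∀ z ∈ D, HasSum (fun n => A n * latticeMonomial δ n z) (f z)) {r s : Fin M} (hrs : r ≠ s)
    {z : Fin M → ℂ} (hz : z ∈ D) (hr : shiftPt τ r z ∈ D) (hs : shiftPt τ s z ∈ D)
    (hrs' : shiftPt τ r (shiftPt τ s z) ∈ D)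
    (hA : ∀ n : Fin M → ℤ, A (n + Pi.single s 1) *
        ((1 - b r * (Complex.exp (τ * δ r) * Complex.exp τ ^ n r)) *
          (1 - Complex.exp (τ * δ s) * Complex.exp τ ^ (n s + 1))) =
      A (n + Pi.single r 1) * ((1 - b s * (Complex.exp (τ * δ s) * Complex.exp τ ^ n s)) *
          (1 - Complex.exp (τ * δ r) * Complex.exp τ ^ (n r + 1)))) :
    EqTwoAt τ b f r s z := by
  have hleft := (Equiv.addRight (Pi.single s 1 : Fin M → ℤ)).hasSum_iff.mpr <|
    (((hf z hz).sub (hf _ hs)).sub (((hf _ hr).sub (hf _ hrs')).mul_left (b r))).mul_left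
      (Complex.exp (z r))
  have hright := (Equiv.addRight (Pi.single r 1 : Fin M → ℤ)).hasSum_iff.mpr <|
    (((hf z hz).sub (hf _ hr)).sub (((hf _ hs).sub (hf _ hrs')).mul_left (b s))).mul_left
      (Complex.exp (z s))
  refine hleft.unique (hright.congr_fun fun n => ?_)
  simp only [Function.comp, Equiv.coe_addRight, latticeMonomial_add_single,
    latticeMonomial_shiftPt, Pi.add_apply, Pi.single_eq_same, Pi.single_eq_of_ne hrs,
    Pi.single_eq_of_ne hrs.symm, add_zero]
  linear_combination (Complex.exp (z r) * Complex.exp (z s) * latticeMonomial δ n z) * hA n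

end Coefficients

lemma prod_apply_add_single_mul {ι R : Type*} [Fintype ι] [DecidableEq ι] [CommRing R]
    {φ : ι → ℤ → R} {n : ι → ℤ} {s : ι} {x y : R}
    (h : φ s (n s + 1) * x = φ s (n s) * y) :
    (∏ i, φ i ((n + Pi.single s 1 : ι → ℤ) i)) * x = (∏ i, φ i (n i)) * y := by
  have hne : ∏ i ∈ univ.erase s, φ i ((n + Pi.single s 1 : ι → ℤ) i) =
      ∏ i ∈ univ.erase s, φ i (n i) :=
    prod_congr rfl fun i hi => by simp [(mem_erase.mp hi).1]
  rw [← mul_prod_erase univ _ (mem_univ s), hne, ← mul_prod_erase univ (fun i => φ i (n i))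
    (mem_univ s), Pi.add_apply, Pi.single_eq_same]
  linear_combination (∏ i ∈ univ.erase s, φ i (n i)) * h

/-- The coefficient at `t^(δ+n+e_s)` of the first equations and at `t^(δ+n+e_r+e_s)` of the second
ones is a consequence of the first order recurrences of `Φ` and of the `φ_i`. -/
theorem isSolutionOn_of_recurrence {τ : ℂ} {a : Fin N → ℂ} {b : Fin M → ℂ} {c : Fin N → ℂ}
    {D : Set (Fin M → ℂ)} {f : (Fin M → ℂ) → ℂ} (δ : Fin M → ℂ) (Φ : ℤ → ℂ) (φ : Fin M → ℤ → ℂ)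
    (hΦ : ∀ n : ℤ, Φ (n + 1) * ∏ j, (1 - c j * (Complex.exp (τ * ∑ i, δ i) * Complex.exp τ ^ n)) =
      Φ n * ∏ j, (1 - a j * (Complex.exp (τ * ∑ i, δ i) * Complex.exp τ ^ n)))
    (hφ : ∀ i (n : ℤ), φ i (n + 1) * (1 - Complex.exp (τ * δ i) * Complex.exp τ ^ (n + 1)) =
      φ i n * (1 - b i * (Complex.exp (τ * δ i) * Complex.exp τ ^ n)))
    (hf : ∀ z ∈ D, HasSum (fun n : Fin M → ℤ =>
      Φ (∑ i, n i) * (∏ i, φ i (n i)) * latticeMonomial δ n z) (f z)) :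
    IsSolutionOn τ a b c D f := by
  have hprod (s : Fin M) (n : Fin M → ℤ) := prod_apply_add_single_mul (φ := φ) (hφ s (n s))
  refine (isSolutionOn_iff ..).mpr ⟨fun s z hz => eqOneAt_of_hasSum hf hz fun n => ?_,
    fun r s hrs z hz hr hs hrs' => eqTwoAt_of_hasSum hf hrs hz hr hs hrs' fun n => ?_⟩
  · rw [sum_add_single, mul_mul_mul_comm, hΦ, hprod, mul_mul_mul_comm]
  · rw [sum_add_single, sum_add_single, mul_comm (1 - b r * _), mul_comm (1 - b s * _), mul_assoc,
      mul_assoc, ← mul_assoc (∏ i, φ i _), ← mul_assoc (∏ i, φ i _), hprod, hprod]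
    ring

end Formal

/-! ### First order recurrences -/

section Recurrence

variable {q : ℂ}

/-- The factor `φ_i` of the exponents `n ≥ 0` of `t_i`: it is `(b)_n / (q)_n`, extended by `0`
to `n < 0`. -/
noncomputable def plusFactor (q b : ℂ) (n : ℤ) : ℂ :=
  if 0 ≤ n then qPoch q b n / qPoch q q n else 0

lemma plusFactor_recurrence (hq : ∀ n : ℕ, q * q ^ n ≠ 1) (hq0 : q ≠ 0) (b : ℂ) (n : ℤ) :
    plusFactor q b (n + 1) * (1 - q ^ (n + 1)) = plusFactor q b n * (1 - b * q ^ n) := by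
  unfold plusFactor
  rcases lt_or_ge n 0 with h | h
  · rw [if_neg h.not_ge, zero_mul]
    split_ifs
    · simp [show n + 1 = 0 by lia]
    · simp
  · rw [if_pos h, if_pos (by lia), zpow_add_one₀ hq0, mul_comm (q ^ n)]
    refine qPoch_div_add_one n (fun h2 => absurd h h2.not_ge) ?_
    lift n to ℕ using h
    exact_mod_cast hq n

/-- The factor `φ_i` of an exponent of `t_i` that is minus a signed sum of indices. -/
noncomputable def twoSidedFactor (q A b : ℂ) (n : ℤ) : ℂ :=
  (q / b) ^ (-n) * (qPoch q A (-n) / qPoch q (q * A / b) (-n))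

lemma twoSidedFactor_recurrence {A b : ℂ} (hq0 : q ≠ 0) (hA : A ≠ 0) (hb : b ≠ 0) (n : ℤ)
    (h1 : -(n + 1) < 0 → A * q ^ (-(n + 1)) ≠ 1) (h2 : q * A / b * q ^ (-(n + 1)) ≠ 1) :
    twoSidedFactor q A b (n + 1) * (1 - A⁻¹ * q ^ (n + 1)) =
      twoSidedFactor q A b n * (1 - b * (A⁻¹ * q ^ n)) := by
  obtain ⟨m, rfl⟩ : ∃ m, n = -(m + 1) := ⟨-n - 1, by ring⟩
  have hm : -(m + 1) + 1 = -m := by ring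
  rw [hm, neg_neg] at h1 h2
  have hr : q / b ≠ 0 := div_ne_zero hq0 hb
  have hx : A * q ^ m ≠ 0 := mul_ne_zero hA (zpow_ne_zero _ hq0)
  have hstep := qPoch_div_add_one m h1 h2
  have hleft : (1 - A⁻¹ * q ^ (-m)) * (A * q ^ m) = -(1 - A * q ^ m) := by
    rw [zpow_neg, ← mul_inv]
    field_simp
    ring
  have hright : (1 - b * (A⁻¹ * q ^ (-(m + 1)))) * (q / b * (A * q ^ m)) =
      -(1 - q * A / b * q ^ m) := by
    rw [zpow_neg, zpow_add_one₀ hq0]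
    field_simp
    ring
  rw [hm, twoSidedFactor, twoSidedFactor, neg_neg, neg_neg, zpow_add_one₀ hr]
  refine mul_right_cancel₀ hx ?_
  linear_combination (q / b) ^ m * (qPoch q A m / qPoch q (q * A / b) m) * hleft -
    (q / b) ^ m * (qPoch q A (m + 1) / qPoch q (q * A / b) (m + 1)) * hright +
    (q / b) ^ m * hstep

/-- The factor `φ_i` of the exponents `-β_i + n`, `n ≤ 0`, of `t_i`: the case `A = b` of
`twoSidedFactor`, cut off at `n = 0`. -/
noncomputable def minusFactor (q b : ℂ) (n : ℤ) : ℂ :=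
  if n ≤ 0 then twoSidedFactor q b b n else 0

lemma minusFactor_recurrence (hq : ∀ n : ℕ, q * q ^ n ≠ 1) (hq0 : q ≠ 0) {b : ℂ} (hb : b ≠ 0)
    (n : ℤ) :
    minusFactor q b (n + 1) * (1 - b⁻¹ * q ^ (n + 1)) =
      minusFactor q b n * (1 - b * (b⁻¹ * q ^ n)) := by
  unfold minusFactor
  rcases lt_or_ge n 0 with h | h
  · rw [if_pos h.le, if_pos (by lia)]
    refine twoSidedFactor_recurrence hq0 hb hb n (by lia) ?_
    obtain ⟨m, hm⟩ : ∃ m : ℕ, -(n + 1) = m := ⟨(-(n + 1)).toNat, by lia⟩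
    rw [mul_div_cancel_right₀ _ hb, hm]
    exact_mod_cast hq m
  · rw [if_neg (by lia), zero_mul]
    split_ifs
    · simp [show n = 0 by lia, hb]
    · simp

lemma plusFactor_mul_zpow (b t : ℂ) (m : ℕ) :
    plusFactor q b m * t ^ (m : ℤ) = qPoch q b m / qPoch q q m * t ^ m := by
  rw [plusFactor, if_pos (by lia), zpow_natCast]

lemma minusFactor_mul_zpow {b : ℂ} (hb : b ≠ 0) (t : ℂ) (m : ℕ) :
    minusFactor q b (-m) * t ^ (-m : ℤ) =
      qPoch q b m / qPoch q q m * (q / (b * t)) ^ m := by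
  rw [minusFactor, if_pos (by lia), twoSidedFactor, neg_neg, mul_div_cancel_right₀ _ hb,
    zpow_neg, zpow_natCast, zpow_natCast, ← div_div, div_pow _ t]
  ring

lemma twoSidedFactor_mul_zpow (A b t : ℂ) (s : ℤ) :
    twoSidedFactor q A b (-s) * t ^ (-s) =
      (q / (b * t)) ^ s * (qPoch q A s / qPoch q (q * A / b) s) := by
  rw [twoSidedFactor, neg_neg, zpow_neg, ← div_div, div_zpow _ t]
  ring

end Recurrence

/-! ### The components as series over the lattice of exponents -/

noncomputable section Lattice

variable {N M : ℕ}

/-- The exponent `δ` of the monomial prefactor of the component `i`. -/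
def compExp (α : Fin N → ℂ) (β : Fin M → ℂ) (γ : Fin N → ℂ) (L : ℕ) :
    Option (Fin N × Fin M) → Fin M → ℂ
  | none => fun i => if (i : ℕ) < L then 0 else -β i
  | some (k, l) => fun i =>
      if i < l then 0 else if l < i then -β i
      else if (l : ℕ) < L then 1 + (∑ i with l < i, β i) - γ k
      else -α k + ∑ i with l < i, β i

/-- The lattice point of the exponent of the term of index `μ` in the component `i`. -/
def compLattice (L : ℕ) (μ : Fin M → ℕ) : Option (Fin N × Fin M) → Fin M → ℤ
  | none => fun i => if (i : ℕ) < L then (μ i : ℤ) else -(μ i : ℤ)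
  | some (k, l) => fun i =>
      if i < l then (μ i : ℤ) else if l < i then -(μ i : ℤ)
      else -signedSum μ (compCut L (some (k, l)))

/-- The factor of the coefficient of `t^(δ+n)` that depends on `∑ n_i`. -/
def compTotalFactor (L : ℕ) (q : ℂ) (a : Fin N → ℂ) (b : Fin M → ℂ) (c : Fin N → ℂ) :
    Option (Fin N × Fin M) → ℤ → ℂ
  | none => compTwoSided q a b c L none
  | some (k, l) => fun n =>
      if (l : ℕ) < L then (if 0 ≤ n then pivotFactor q a c L k l n.toNat else 0)
      else (if n ≤ 0 then (∏ j, c j / a j) ^ (-n).toNat * pivotFactor q a c L k l (-n).toNat else 0)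

/-- The factors of the coefficient of `t^(δ+n)` that depend on a single `n_i`. -/
def compLocalFactor (L : ℕ) (q : ℂ) (a : Fin N → ℂ) (b : Fin M → ℂ) (c : Fin N → ℂ) :
    Option (Fin N × Fin M) → Fin M → ℤ → ℂ
  | none => fun i => if (i : ℕ) < L then plusFactor q (b i) else minusFactor q (b i)
  | some (k, l) => fun i =>
      if i < l then plusFactor q (b i) else if l < i then minusFactor q (b i)
      else twoSidedFactor q (twoSidedBase q a b c L k l) (b l)

section Exponents

variable (α : Fin N → ℂ) (β : Fin M → ℂ) (γ : Fin N → ℂ) (L : ℕ)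

variable {L} in
lemma compExp_some_of_lt (k : Fin N) {i l : Fin M} (h : i < l) :
    compExp α β γ L (some (k, l)) i = 0 :=
  if_pos h

variable {L} in
lemma compExp_some_of_gt (k : Fin N) {i l : Fin M} (h : l < i) :
    compExp α β γ L (some (k, l)) i = -β i :=
  (if_neg h.not_gt).trans (if_pos h)

lemma compExp_some_self (k : Fin N) (l : Fin M) :
    compExp α β γ L (some (k, l)) l = if (l : ℕ) < L then 1 + (∑ i with l < i, β i) - γ k
      else -α k + ∑ i with l < i, β i := by
  simp only [compExp, lt_irrefl, if_false]

lemma uMonomial_eq_latticeMonomial (z : Fin M → ℂ) (i : Option (Fin N × Fin M)) :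
    uMonomial α β γ L z i = latticeMonomial (compExp α β γ L i) 0 z := by
  simp only [latticeMonomial, Complex.exp_sum, Pi.zero_apply, Int.cast_zero, add_zero]
  rcases i with _ | ⟨k, l⟩
  · simp only [uMonomial, compExp, prod_filter]
    refine prod_congr rfl fun i _ => ?_
    split_ifs <;> first | rfl | lia | simp
  · have hlt : ∏ i with i < l, Complex.exp (compExp α β γ L (some (k, l)) i * z i) = 1 :=
      prod_eq_one fun i hi => by simp [compExp_some_of_lt α β γ k (show i < l by simpa using hi)]
    have hgt : ∏ i with l < i, Complex.exp (compExp α β γ L (some (k, l)) i * z i) =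
        ∏ i with l < i, Complex.exp (-β i * z i) :=
      prod_congr rfl fun i hi => by rw [compExp_some_of_gt α β γ k (by simpa using hi)]
    rw [uMonomial, ← prod_lt_mul_prod_gt_mul l, hlt, hgt, one_mul, compExp_some_self, mul_comm]
    split_ifs <;> rfl

end Exponents

section LatticePoints

variable (L : ℕ)

variable {L} in
lemma compLattice_some_of_lt (μ : Fin M → ℕ) (k : Fin N) {i l : Fin M} (h : i < l) :
    compLattice L μ (some (k, l)) i = μ i :=
  if_pos h

variable {L} in
lemma compLattice_some_of_gt (μ : Fin M → ℕ) (k : Fin N) {i l : Fin M} (h : l < i) :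
    compLattice L μ (some (k, l)) i = -μ i :=
  (if_neg h.not_gt).trans (if_pos h)

lemma compLattice_some_self (μ : Fin M → ℕ) (k : Fin N) (l : Fin M) :
    compLattice L μ (some (k, l)) l = -signedSum μ (compCut L (some (k, l))) := by
  simp only [compLattice, lt_irrefl, if_false]

lemma lt_compCut_of_lt (k : Fin N) {i l : Fin M} (h : i < l) :
    (i : ℕ) < compCut L (some (k, l)) := by
  simp only [compCut]
  split_ifs <;> lia

lemma not_lt_compCut_of_gt (k : Fin N) {i l : Fin M} (h : l < i) :
    ¬ (i : ℕ) < compCut L (some (k, l)) := by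
  simp only [compCut]
  split_ifs <;> lia

lemma lt_compCut_self_iff (k : Fin N) (l : Fin M) :
    (l : ℕ) < compCut L (some (k, l)) ↔ ¬ (l : ℕ) < L := by
  simp only [compCut]
  split_ifs <;> lia

lemma sum_compLattice_some (μ : Fin M → ℕ) (k : Fin N) (l : Fin M) :
    ∑ i, compLattice L μ (some (k, l)) i = if (l : ℕ) < L then (μ l : ℤ) else -(μ l : ℤ) := by
  have hcut : signedSum μ (compCut L (some (k, l))) = (∑ i with i < l, (μ i : ℤ)) +
      (∑ i with l < i, -(μ i : ℤ)) + if ¬ (l : ℕ) < L then (μ l : ℤ) else -(μ l : ℤ) := by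
    rw [signedSum, ← sum_lt_add_sum_gt_add l]
    simp only [lt_compCut_self_iff]
    congr 2 <;> refine sum_congr rfl fun i hi => ?_
    · exact if_pos (lt_compCut_of_lt L k (by simpa using hi))
    · exact if_neg (not_lt_compCut_of_gt L k (by simpa using hi))
  rw [← sum_lt_add_sum_gt_add l, compLattice_some_self, hcut,
    sum_congr rfl fun i hi => compLattice_some_of_lt μ k (show i < l by simpa using hi),
    sum_congr rfl fun i hi => compLattice_some_of_gt μ k (show l < i by simpa using hi)]
  split_ifs <;> ring

lemma compLattice_injective (i : Option (Fin N × Fin M)) :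
    Function.Injective fun μ => compLattice L μ i := by
  intro μ ν (h : compLattice L μ i = compLattice L ν i)
  ext j
  have hj := congrFun h j
  rcases i with _ | ⟨k, l⟩
  · simp only [compLattice] at hj
    split_ifs at hj <;> lia
  rcases lt_trichotomy j l with hjl | rfl | hjl
  · simpa only [compLattice_some_of_lt _ k hjl, Nat.cast_inj] using hj
  · have hsum := sum_compLattice_some L μ k j
    rw [h, sum_compLattice_some] at hsum
    split_ifs at hsum <;> lia
  · simpa only [compLattice_some_of_gt _ k hjl, neg_inj, Nat.cast_inj] using hj

end LatticePoints

section Coefficients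

variable {L : ℕ} {q : ℂ} {a : Fin N → ℂ} {b : Fin M → ℂ} {c : Fin N → ℂ}

lemma compLocalFactor_some_of_lt (k : Fin N) {i l : Fin M} (h : i < l) :
    compLocalFactor L q a b c (some (k, l)) i = plusFactor q (b i) :=
  if_pos h

lemma compLocalFactor_some_of_gt (k : Fin N) {i l : Fin M} (h : l < i) :
    compLocalFactor L q a b c (some (k, l)) i = minusFactor q (b i) :=
  (if_neg h.not_gt).trans (if_pos h)

lemma compLocalFactor_some_self (k : Fin N) (l : Fin M) :
    compLocalFactor L q a b c (some (k, l)) l =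
      twoSidedFactor q (twoSidedBase q a b c L k l) (b l) := by
  simp only [compLocalFactor, lt_irrefl, if_false]

lemma nonneg_of_plusFactor_ne_zero {x : ℂ} {n : ℤ} (h : plusFactor q x n ≠ 0) : 0 ≤ n :=
  not_lt.mp fun hn => h (if_neg hn.not_ge)

lemma nonpos_of_minusFactor_ne_zero {x : ℂ} {n : ℤ} (h : minusFactor q x n ≠ 0) : n ≤ 0 :=
  not_lt.mp fun hn => h (if_neg hn.not_ge)

lemma exists_compLattice_none_eq {n : Fin M → ℤ}
    (h : ∀ j, compLocalFactor L q a b c none j (n j) ≠ 0) :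
    ∃ μ, compLattice L μ (none : Option (Fin N × Fin M)) = n := by
  refine ⟨fun j => (n j).natAbs, funext fun j => ?_⟩
  have hj := h j
  simp only [compLattice]
  simp only [compLocalFactor] at hj
  split_ifs at hj ⊢
  · exact Int.natAbs_of_nonneg (nonneg_of_plusFactor_ne_zero hj)
  · have := nonpos_of_minusFactor_ne_zero hj
    lia

lemma exists_compLattice_some_eq {n : Fin M → ℤ} {k : Fin N} {l : Fin M}
    (htotal : compTotalFactor L q a b c (some (k, l)) (∑ j, n j) ≠ 0)
    (hlocal : ∀ j, compLocalFactor L q a b c (some (k, l)) j (n j) ≠ 0) :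
    ∃ μ, compLattice L μ (some (k, l)) = n := by
  set μ : Fin M → ℕ := fun j => if j = l then (∑ i, n i).natAbs else (n j).natAbs
  have hlt (j) (hj : j < l) : compLattice L μ (some (k, l)) j = n j := by
    have h := hlocal j
    rw [compLocalFactor_some_of_lt k hj] at h
    have := nonneg_of_plusFactor_ne_zero h
    rw [compLattice_some_of_lt μ k hj]
    simp only [μ, if_neg hj.ne]
    lia
  have hgt (j) (hj : l < j) : compLattice L μ (some (k, l)) j = n j := by
    have h := hlocal j
    rw [compLocalFactor_some_of_gt k hj] at h
    have := nonpos_of_minusFactor_ne_zero h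
    rw [compLattice_some_of_gt μ k hj]
    simp only [μ, if_neg hj.ne']
    lia
  have hsum : ∑ j, compLattice L μ (some (k, l)) j = ∑ j, n j := by
    simp only [sum_compLattice_some, μ, if_true]
    simp only [compTotalFactor] at htotal
    grind
  refine ⟨μ, funext fun j => ?_⟩
  rcases lt_trichotomy j l with hj | rfl | hj
  · exact hlt j hj
  · rw [← sum_lt_add_sum_gt_add j, ← sum_lt_add_sum_gt_add j n,
      sum_congr rfl fun i hi => hlt i (by simpa using hi),
      sum_congr rfl fun i hi => hgt i (by simpa using hi)] at hsum
    exact add_left_cancel hsum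
  · exact hgt j hj

lemma coeff_eq_zero_of_notMem_range (i : Option (Fin N × Fin M)) (n : Fin M → ℤ)
    (hn : n ∉ Set.range fun μ => compLattice L μ i) :
    compTotalFactor L q a b c i (∑ j, n j) * ∏ j, compLocalFactor L q a b c i j (n j) = 0 := by
  contrapose! hn
  obtain ⟨htotal, hlocal⟩ := ne_zero_and_ne_zero_of_mul hn
  simp only [prod_ne_zero_iff, mem_univ, true_imp_iff] at hlocal
  rcases i with _ | ⟨k, l⟩
  · exact exists_compLattice_none_eq hlocal
  · exact exists_compLattice_some_eq htotal hlocal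

lemma latticeMonomial_eq_mul_prod (δ : Fin M → ℂ) (n : Fin M → ℤ) (z : Fin M → ℂ) :
    latticeMonomial δ n z = latticeMonomial δ 0 z * ∏ i, Complex.exp (z i) ^ n i := by
  simp only [latticeMonomial, ← Complex.exp_int_mul, ← Complex.exp_sum, ← Complex.exp_add,
    ← sum_add_distrib, Pi.zero_apply, Int.cast_zero, add_zero, add_mul]

lemma zpow_signedSum {y : ℂ} (hy : y ≠ 0) (m : Fin M → ℕ) (l : ℕ) :
    y ^ signedSum m l = ∏ j : Fin M, if (j : ℕ) < l then y ^ m j else y⁻¹ ^ m j := by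
  rw [signedSum_eq_sub, zpow_sub₀ hy, zpow_natCast, zpow_natCast, ← prod_pow_eq_pow_sum,
    ← prod_pow_eq_pow_sum, prod_ite, div_eq_mul_inv, ← prod_inv_distrib]
  simp only [inv_pow]

variable {t : Fin M → ℂ} {k : Fin N} {l : Fin M}

lemma compLocalFactor_mul_zpow_of_ne (hq : q ≠ 0) (hb : ∀ i, b i ≠ 0) (ht : ∀ i, t i ≠ 0)
    (μ : Fin M → ℕ) {j : Fin M} (hj : j ≠ l) :
    (if (j : ℕ) < compCut L (some (k, l)) then (q / (b l * t l)) ^ μ j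
        else (q / (b l * t l))⁻¹ ^ μ j) *
      (compLocalFactor L q a b c (some (k, l)) j (compLattice L μ (some (k, l)) j) *
        t j ^ compLattice L μ (some (k, l)) j) =
    compOneSided q a b c L (some (k, l)) j (μ j) * compVar q a b c L t (some (k, l)) j ^ μ j := by
  have hone : compOneSided q a b c L (some (k, l)) j (μ j) =
      qPoch q (b j) (μ j) / qPoch q q (μ j) := if_neg hj
  rcases lt_or_gt_of_ne hj with h | h
  · rw [if_pos (lt_compCut_of_lt L k h), compLocalFactor_some_of_lt k h,
      compLattice_some_of_lt μ k h, compVar_some_of_lt q a b c t k h, plusFactor_mul_zpow, hone,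
      mul_div_right_comm, mul_pow]
    ring
  · have hbl := hb l
    have htl := ht l
    have hvar : b l * t l / (b j * t j) = (q / (b l * t l))⁻¹ * (q / (b j * t j)) := by
      field_simp
    rw [if_neg (not_lt_compCut_of_gt L k h), compLocalFactor_some_of_gt k h,
      compLattice_some_of_gt μ k h, compVar_some_of_gt q a b c t k h, minusFactor_mul_zpow (hb j),
      hone, hvar, mul_pow]
    ring

lemma compTotalFactor_mul_pow (μ : Fin M → ℕ) :
    compTotalFactor L q a b c (some (k, l)) (∑ j, compLattice L μ (some (k, l)) j) *
      (if (l : ℕ) < compCut L (some (k, l)) then (q / (b l * t l)) ^ μ l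
        else (q / (b l * t l))⁻¹ ^ μ l) =
    compOneSided q a b c L (some (k, l)) l (μ l) * compVar q a b c L t (some (k, l)) l ^ μ l := by
  have hone : compOneSided q a b c L (some (k, l)) l (μ l) = pivotFactor q a c L k l (μ l) :=
    if_pos rfl
  rw [hone, compVar_some_self, sum_compLattice_some]
  by_cases hl : (l : ℕ) < L
  · simp [compTotalFactor, compCut, hl]
  · simp only [compTotalFactor, compCut, hl, if_false, if_pos (Nat.lt_succ_self (l : ℕ))]
    rw [if_pos (by lia), neg_neg, Int.toNat_natCast, mul_pow]
    ring

/-- The factors `(q / (b_l t_l))^m(l)` of the two-sided factor at `l` are distributed over the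
variables of the series. -/
lemma coeff_mul_prod_zpow (hq : q ≠ 0) (hb : ∀ i, b i ≠ 0) (ht : ∀ i, t i ≠ 0)
    (i : Option (Fin N × Fin M)) (μ : Fin M → ℕ) :
    compTotalFactor L q a b c i (∑ j, compLattice L μ i j) *
      (∏ j, compLocalFactor L q a b c i j (compLattice L μ i j)) *
      ∏ j, t j ^ compLattice L μ i j = compTerm q a b c L t i μ := by
  rw [compTerm, signedTerm, mul_assoc, mul_assoc, ← prod_mul_distrib, ← prod_mul_distrib]
  rcases i with _ | ⟨k, l⟩
  · congr 1
    refine prod_congr rfl fun j _ => ?_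
    simp only [compLocalFactor, compLattice, compOneSided, compVar]
    split_ifs
    · exact plusFactor_mul_zpow _ _ _
    · exact minusFactor_mul_zpow (hb j) _ _
  have hself : compLocalFactor L q a b c (some (k, l)) l (compLattice L μ (some (k, l)) l) *
        t l ^ compLattice L μ (some (k, l)) l =
      (∏ j : Fin M, if (j : ℕ) < compCut L (some (k, l)) then (q / (b l * t l)) ^ μ j
        else (q / (b l * t l))⁻¹ ^ μ j) *
      compTwoSided q a b c L (some (k, l)) (signedSum μ (compCut L (some (k, l)))) := by
    rw [compLocalFactor_some_self, compLattice_some_self, twoSidedFactor_mul_zpow,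
      zpow_signedSum (div_ne_zero hq (mul_ne_zero (hb l) (ht l)))]
    rfl
  rw [← mul_prod_erase univ _ (mem_univ l), hself,
    ← mul_prod_erase univ (fun j : Fin M => if (j : ℕ) < compCut L (some (k, l)) then _ else _)
      (mem_univ l),
    ← mul_prod_erase univ (fun j => compOneSided q a b c L (some (k, l)) j (μ j) *
      compVar q a b c L t (some (k, l)) j ^ μ j) (mem_univ l), ← compTotalFactor_mul_pow,
    ← prod_congr rfl fun j hj => compLocalFactor_mul_zpow_of_ne hq hb ht μ (mem_erase.mp hj).1,
    prod_mul_distrib (g := fun j => compLocalFactor L q a b c (some (k, l)) j _ * _)]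
  ring

end Coefficients

end Lattice

/-! ### The components are solutions -/

section ComponentSolution

section Recurrences

variable {N M : ℕ} {L : ℕ} {q : ℂ} {a : Fin N → ℂ} {b : Fin M → ℂ} {c : Fin N → ℂ}

namespace Admissible

lemma compTotalFactor_none_recurrence (h : Admissible q a b c) (hL : L ≤ M) (n : ℤ) :
    compTotalFactor L q a b c none (n + 1) * ∏ j, (1 - c j * ((tailProd b L)⁻¹ * q ^ n)) =
      compTotalFactor L q a b c none n * ∏ j, (1 - a j * ((tailProd b L)⁻¹ * q ^ n)) := by
  simp only [compTotalFactor, compTwoSided, ← prod_mul_distrib]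
  refine prod_congr rfl fun j _ => ?_
  simpa only [div_eq_mul_inv, mul_assoc] using
    qPoch_div_add_one n (fun _ => h.a_div_tailProd_mul_zpow_ne_one j hL n)
      (h.c_div_tailProd_mul_zpow_ne_one j hL n)

lemma pivotFactor_recurrence_of_lt (h : Admissible q a b c) (k : Fin N) {l : Fin M}
    (hl : (l : ℕ) < L) (m : ℕ) :
    pivotFactor q a c L k l (m + 1) * ∏ j, (1 - c j * (q / c k * q ^ m)) =
      pivotFactor q a c L k l m * ∏ j, (1 - a j * (q / c k * q ^ m)) := by
  simp only [pivotFactor, if_pos hl, ← prod_mul_distrib]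
  refine prod_congr rfl fun j _ => ?_
  have hstep := qPoch_div_add_one (q := q) (x := q * a j / c k) (y := q * c j / c k) (m : ℤ)
    (by lia) (by exact_mod_cast h.mul_c_div_c_mul_pow_ne_one j k m)
  rw [zpow_natCast] at hstep
  push_cast
  linear_combination hstep

lemma pivotFactor_recurrence_of_ge (h : Admissible q a b c) (k : Fin N) {l : Fin M}
    (hl : ¬ (l : ℕ) < L) (m : ℕ) :
    pivotFactor q a c L k l m * ∏ j, (1 - c j * ((a k)⁻¹ * q ^ (-(m + 1) : ℤ))) =
      (∏ j, c j / a j) * pivotFactor q a c L k l (m + 1) *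
        ∏ j, (1 - a j * ((a k)⁻¹ * q ^ (-(m + 1) : ℤ))) := by
  simp only [pivotFactor, if_neg hl, ← prod_mul_distrib]
  refine prod_congr rfl fun j _ => ?_
  have hden := h.mul_a_div_a_mul_pow_ne_one k j m
  have hq := h.q_ne
  have hak := h.a_ne k
  have haj := h.a_ne j
  have hcj := h.c_ne j
  have hqm : q ^ m ≠ 0 := pow_ne_zero _ hq
  have hstep := qPoch_div_add_one (q := q) (x := q * a k / c j) (y := q * a k / a j) (m : ℤ)
    (by lia) (by exact_mod_cast hden)
  rw [zpow_natCast] at hstep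
  have hinv (x : ℂ) : x * ((a k)⁻¹ * q ^ (-(m + 1) : ℤ)) = (q * a k / x * q ^ m)⁻¹ := by
    rw [zpow_neg, zpow_add_one₀ hq, zpow_natCast]
    field_simp
  have hfactor : (1 - (q * a k / c j * q ^ m)⁻¹) * (1 - q * a k / a j * q ^ m) =
      c j / a j * (1 - q * a k / c j * q ^ m) * (1 - (q * a k / a j * q ^ m)⁻¹) := by
    field_simp
    ring
  rw [hinv, hinv]
  push_cast
  refine mul_right_cancel₀ (sub_ne_zero.mpr hden.symm) ?_
  linear_combination (qPoch q (q * a k / c j) m / qPoch q (q * a k / a j) m) * hfactor -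
    c j / a j * (1 - (q * a k / a j * q ^ m)⁻¹) * hstep

lemma compTotalFactor_some_recurrence_of_lt (h : Admissible q a b c) (k : Fin N) {l : Fin M}
    (hl : (l : ℕ) < L) (n : ℤ) :
    compTotalFactor L q a b c (some (k, l)) (n + 1) * ∏ j, (1 - c j * (q / c k * q ^ n)) =
      compTotalFactor L q a b c (some (k, l)) n * ∏ j, (1 - a j * (q / c k * q ^ n)) := by
  simp only [compTotalFactor, if_pos hl]
  rcases lt_trichotomy n (-1) with hn | rfl | hn
  · rw [if_neg (by lia), if_neg (by lia), zero_mul, zero_mul]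
  · have hzero : 1 - c k * (q / c k * q ^ (-1 : ℤ)) = 0 := by
      have := h.q_ne
      have := h.c_ne k
      field_simp
      ring
    rw [prod_eq_zero (mem_univ k) hzero, if_neg (show ¬ (0 : ℤ) ≤ -1 by lia), mul_zero, zero_mul]
  · lift n to ℕ using by lia
    rw [if_pos (by lia), if_pos (by lia), Int.toNat_natCast, zpow_natCast]
    exact h.pivotFactor_recurrence_of_lt k hl n

lemma compTotalFactor_some_recurrence_of_ge (h : Admissible q a b c) (k : Fin N) {l : Fin M}
    (hl : ¬ (l : ℕ) < L) (n : ℤ) :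
    compTotalFactor L q a b c (some (k, l)) (n + 1) * ∏ j, (1 - c j * ((a k)⁻¹ * q ^ n)) =
      compTotalFactor L q a b c (some (k, l)) n * ∏ j, (1 - a j * ((a k)⁻¹ * q ^ n)) := by
  simp only [compTotalFactor, if_neg hl]
  rcases lt_trichotomy n 0 with hn | rfl | hn
  · obtain ⟨m, rfl⟩ : ∃ m : ℕ, n = -(m + 1) := ⟨(-n - 1).toNat, by lia⟩
    rw [if_pos (by lia), if_pos (by lia), show (-(-((m : ℤ) + 1) + 1)).toNat = m by lia,
      show (-(-((m : ℤ) + 1))).toNat = m + 1 by lia]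
    linear_combination (∏ j, c j / a j) ^ m * h.pivotFactor_recurrence_of_ge k hl m
  · have hzero : 1 - a k * ((a k)⁻¹ * q ^ (0 : ℤ)) = 0 := by simp [h.a_ne k]
    rw [if_neg (by lia), zero_mul]
    exact (mul_eq_zero_of_right _ (prod_eq_zero (mem_univ k) hzero)).symm
  · rw [if_neg (by lia), if_neg (by lia), zero_mul, zero_mul]

end Admissible

end Recurrences

variable {N M : ℕ} {τ : ℂ} {α : Fin N → ℂ} {β : Fin M → ℂ} {γ : Fin N → ℂ} {L : ℕ}

lemma qPow_ne_zero {ι : Type*} (τ : ℂ) (x : ι → ℂ) (i : ι) : qPow τ x i ≠ 0 :=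
  Complex.exp_ne_zero _

lemma tailProd_qPow (τ : ℂ) (β : Fin M → ℂ) (l : ℕ) :
    tailProd (qPow τ β) l = Complex.exp (τ * ∑ i : Fin M with l ≤ i.val, β i) := by
  rw [mul_sum, Complex.exp_sum]
  rfl

lemma exp_mul_neg_eq_inv_qPow {ι : Type*} (β : ι → ℂ) (i : ι) :
    Complex.exp (τ * -β i) = (qPow τ β i)⁻¹ := by
  rw [qPow, ← Complex.exp_neg, mul_neg]

lemma exp_mul_compExp_some_self (k : Fin N) (l : Fin M) :
    Complex.exp (τ * compExp α β γ L (some (k, l)) l) =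
      (twoSidedBase (Complex.exp τ) (qPow τ α) (qPow τ β) (qPow τ γ) L k l)⁻¹ := by
  have htail : tailProd (qPow τ β) (l + 1) = Complex.exp (τ * ∑ i with l < i, β i) :=
    tailProd_qPow τ β (l + 1)
  rw [compExp_some_self, twoSidedBase, htail]
  simp only [qPow]
  split_ifs
  · rw [← Complex.exp_add, ← Complex.exp_sub, ← Complex.exp_neg]
    ring_nf
  · rw [← Complex.exp_sub, ← Complex.exp_neg]
    ring_nf

lemma exp_mul_sum_compExp_none :
    Complex.exp (τ * ∑ i, compExp α β γ L none i) = (tailProd (qPow τ β) L)⁻¹ := by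
  rw [tailProd_qPow, ← Complex.exp_neg, ← mul_neg, ← sum_neg_distrib, sum_filter]
  simp only [compExp, ← not_lt, ite_not]

lemma sum_compExp_some (k : Fin N) (l : Fin M) :
    ∑ i, compExp α β γ L (some (k, l)) i = if (l : ℕ) < L then 1 - γ k else -α k := by
  rw [← sum_lt_add_sum_gt_add l, compExp_some_self,
    sum_congr rfl fun i hi => compExp_some_of_lt α β γ k (show i < l by simpa using hi),
    sum_congr rfl fun i hi => compExp_some_of_gt α β γ k (show l < i by simpa using hi),
    sum_const_zero, sum_neg_distrib]
  split_ifs <;> ring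

lemma exp_mul_sum_compExp_some (k : Fin N) (l : Fin M) :
    Complex.exp (τ * ∑ i, compExp α β γ L (some (k, l)) i) =
      if (l : ℕ) < L then Complex.exp τ / qPow τ γ k else (qPow τ α k)⁻¹ := by
  rw [sum_compExp_some]
  split_ifs
  · rw [qPow, ← Complex.exp_sub, mul_sub, mul_one]
  · exact exp_mul_neg_eq_inv_qPow α k

lemma compLocalFactor_recurrence (h : Admissible (Complex.exp τ) (qPow τ α) (qPow τ β) (qPow τ γ))
    (i : Option (Fin N × Fin M)) (j : Fin M) (n : ℤ) :
    compLocalFactor L (Complex.exp τ) (qPow τ α) (qPow τ β) (qPow τ γ) i j (n + 1) *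
        (1 - Complex.exp (τ * compExp α β γ L i j) * Complex.exp τ ^ (n + 1)) =
      compLocalFactor L (Complex.exp τ) (qPow τ α) (qPow τ β) (qPow τ γ) i j n *
        (1 - qPow τ β j * (Complex.exp (τ * compExp α β γ L i j) * Complex.exp τ ^ n)) := by
  have hplus := plusFactor_recurrence h.mul_pow_ne_one h.q_ne (qPow τ β j) n
  have hminus := minusFactor_recurrence h.mul_pow_ne_one h.q_ne (h.b_ne j) n
  rcases i with _ | ⟨k, l⟩
  · simp only [compLocalFactor, compExp]
    split_ifs
    · simpa using hplus
    · rwa [exp_mul_neg_eq_inv_qPow]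
  rcases lt_trichotomy j l with hj | rfl | hj
  · rw [compLocalFactor_some_of_lt k hj, compExp_some_of_lt _ _ _ k hj]
    simpa using hplus
  · rw [compLocalFactor_some_self, exp_mul_compExp_some_self]
    exact twoSidedFactor_recurrence h.q_ne (h.twoSidedBase_ne k j) (h.b_ne j) n
      (fun _ => h.twoSidedBase_mul_zpow_ne_one k j _) (h.mul_twoSidedBase_div_mul_zpow_ne_one k j _)
  · rwa [compLocalFactor_some_of_gt k hj, compExp_some_of_gt _ _ _ k hj, exp_mul_neg_eq_inv_qPow]

lemma compTotalFactor_recurrence (h : Admissible (Complex.exp τ) (qPow τ α) (qPow τ β) (qPow τ γ))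
    (hL : L ≤ M) (i : Option (Fin N × Fin M)) (n : ℤ) :
    compTotalFactor L (Complex.exp τ) (qPow τ α) (qPow τ β) (qPow τ γ) i (n + 1) *
        ∏ j, (1 - qPow τ γ j *
          (Complex.exp (τ * ∑ j, compExp α β γ L i j) * Complex.exp τ ^ n)) =
      compTotalFactor L (Complex.exp τ) (qPow τ α) (qPow τ β) (qPow τ γ) i n *
        ∏ j, (1 - qPow τ α j *
          (Complex.exp (τ * ∑ j, compExp α β γ L i j) * Complex.exp τ ^ n)) := by
  rcases i with _ | ⟨k, l⟩
  · rw [exp_mul_sum_compExp_none]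
    exact h.compTotalFactor_none_recurrence hL n
  rw [exp_mul_sum_compExp_some]
  split_ifs with hl
  · exact h.compTotalFactor_some_recurrence_of_lt k hl n
  · exact h.compTotalFactor_some_recurrence_of_ge k hl n

lemma mem_region_one_iff {q : ℂ} {a : Fin N → ℂ} {b : Fin M → ℂ} {c : Fin N → ℂ}
    {z : Fin M → ℂ} : z ∈ region q a b c L 1 ↔ InRegion q a b c L fun i => Complex.exp (z i) :=
  ⟨fun hz => ⟨fun _ => Complex.exp_ne_zero _, hz.1, hz.2.1, hz.2.2⟩,
    fun hz => ⟨hz.small, hz.large, hz.ratio⟩⟩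

lemma exists_equiv_uSeriesTerm_one_eq (hL : L ≤ M) (i : Option (Fin N × Fin M)) :
    ∃ s : (Fin M → ℕ) ≃ (Fin M → ℕ), ∀ z : Fin M → ℂ,
      uSeriesTerm τ α β γ L hL 1 i z =
        compTerm (Complex.exp τ) (qPow τ α) (qPow τ β) (qPow τ γ) L (fun i => Complex.exp (z i)) i ∘
          s := by
  obtain ⟨s, hs⟩ := exists_perm_uTerm_eq_compTerm (qPow τ α) (qPow τ γ) (L := L)
    (Complex.exp_ne_zero τ) (qPow_ne_zero τ β) hL i
  exact ⟨s.symm.arrowCongr (Equiv.refl ℕ), fun z => funext fun m => hs _ m⟩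

theorem summable_uSeriesTerm_one (h : Admissible (Complex.exp τ) (qPow τ α) (qPow τ β) (qPow τ γ))
    (hL : L ≤ M) (i : Option (Fin N × Fin M)) {z : Fin M → ℂ}
    (hz : z ∈ region (Complex.exp τ) (qPow τ α) (qPow τ β) (qPow τ γ) L 1) :
    Summable (uSeriesTerm τ α β γ L hL 1 i z) := by
  obtain ⟨s, hs⟩ := exists_equiv_uSeriesTerm_one_eq (τ := τ) (α := α) (β := β) (γ := γ) hL i
  rw [hs z, s.summable_iff]
  exact h.summable_compTerm hL (mem_region_one_iff.mp hz) i

lemma u_one_eq (hL : L ≤ M) (i : Option (Fin N × Fin M)) (z : Fin M → ℂ) :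
    u τ α β γ L hL 1 i z = latticeMonomial (compExp α β γ L i) 0 z *
      ∑' μ, compTerm (Complex.exp τ) (qPow τ α) (qPow τ β) (qPow τ γ) L
        (fun i => Complex.exp (z i)) i μ := by
  obtain ⟨s, hs⟩ := exists_equiv_uSeriesTerm_one_eq (τ := τ) (α := α) (β := β) (γ := γ) hL i
  rw [u, hs z, ← uMonomial_eq_latticeMonomial]
  exact congrArg _ (s.tsum_eq _)

theorem isSolutionOn_u_one (h : Admissible (Complex.exp τ) (qPow τ α) (qPow τ β) (qPow τ γ))
    (hL : L ≤ M) (i : Option (Fin N × Fin M)) :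
    IsSolutionOn τ (qPow τ α) (qPow τ β) (qPow τ γ)
      (region (Complex.exp τ) (qPow τ α) (qPow τ β) (qPow τ γ) L 1) (u τ α β γ L hL 1 i) := by
  refine isSolutionOn_of_recurrence (compExp α β γ L i)
    (compTotalFactor L (Complex.exp τ) (qPow τ α) (qPow τ β) (qPow τ γ) i)
    (compLocalFactor L (Complex.exp τ) (qPow τ α) (qPow τ β) (qPow τ γ) i)
    (compTotalFactor_recurrence h hL i) (compLocalFactor_recurrence h i) fun z hz => ?_
  rw [← (compLattice_injective L i).hasSum_iff fun n hn => by
    rw [coeff_eq_zero_of_notMem_range i n hn, zero_mul], u_one_eq]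
  refine ((h.summable_compTerm hL (mem_region_one_iff.mp hz) i).hasSum.mul_left _).congr_fun
    fun μ => ?_
  rw [← coeff_mul_prod_zpow h.q_ne h.b_ne (fun _ => Complex.exp_ne_zero _), Function.comp,
    latticeMonomial_eq_mul_prod]
  ring

end ComponentSolution

/-! ### Linear independence -/

section Asymptotics

variable {ι : Type*} [Fintype ι] {d v : ι → ℂ}

lemma tendsto_sum_mul_pow_zero {g : ι → ℕ → ℂ} (hv : ∀ i, d i ≠ 0 → ‖v i‖ ≤ 1)
    (hg : ∀ i, Tendsto (g i) atTop (𝓝 1)) (h0 : ∀ᶠ k in atTop, ∑ i, d i * v i ^ k * g i k = 0) :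
    Tendsto (fun k => ∑ i, d i * v i ^ k) atTop (𝓝 0) := by
  have hdiff : Tendsto (fun k => ∑ i, d i * v i ^ k * (1 - g i k)) atTop (𝓝 0) := by
    rw [← sum_const_zero (ι := ι) (s := univ)]
    refine tendsto_finsetSum _ fun i _ => ?_
    refine isBoundedUnder_le_mul_tendsto_zero (isBoundedUnder_of ⟨‖d i‖, fun k => ?_⟩) ?_
    · rcases eq_or_ne (d i) 0 with hi | hi
      · simp [hi]
      · simp only [Function.comp, norm_mul, norm_pow]
        exact mul_le_of_le_one_right (norm_nonneg _) (pow_le_one₀ (norm_nonneg _) (hv i hi))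
    · simpa using (hg i).const_sub 1
  refine hdiff.congr' ?_
  filter_upwards [h0] with k hk
  simp only [mul_sub, mul_one, sum_sub_distrib, hk, sub_zero]

lemma sum_filter_eq_one_eq_zero_of_tendsto [DecidablePred fun i => v i = 1]
    (h : Tendsto (fun k => ∑ i, d i * v i ^ k) atTop (𝓝 0)) : ∑ i with v i = 1, d i = 0 := by
  classical
  -- `P` selects the exponential sequences with base `1`.
  set P : Polynomial ℂ := ∏ w ∈ (univ.image v).erase 1, (Polynomial.X - Polynomial.C w)
  have hPv : ∀ i, v i ≠ 1 → P.eval (v i) = 0 := fun i hi => by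
    rw [Polynomial.eval_prod]
    exact prod_eq_zero (mem_erase.mpr ⟨hi, mem_image_of_mem v (mem_univ i)⟩) (by simp)
  have hP1 : P.eval 1 ≠ 0 := by
    rw [Polynomial.eval_prod, prod_ne_zero_iff]
    intro w hw
    simpa [sub_eq_zero] using (ne_of_mem_erase hw).symm
  have hcomb : ∀ k, ∑ p ∈ range (P.natDegree + 1), P.coeff p * ∑ i, d i * v i ^ (k + p) =
      (∑ i with v i = 1, d i) * P.eval 1 := fun k => by
    have hterm : ∀ i, ∑ p ∈ range (P.natDegree + 1), P.coeff p * (d i * v i ^ (k + p)) =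
        d i * v i ^ k * P.eval (v i) := fun i => by
      rw [Polynomial.eval_eq_sum_range, mul_sum]
      exact sum_congr rfl fun p _ => by ring
    simp only [mul_sum]
    rw [sum_comm, sum_congr rfl fun i _ => hterm i, sum_filter, sum_mul]
    refine sum_congr rfl fun i _ => ?_
    split_ifs with hi
    · rw [hi, one_pow, mul_one]
    · rw [hPv i hi, mul_zero, zero_mul]
  have hlim : Tendsto (fun _ : ℕ => (∑ i with v i = 1, d i) * P.eval 1) atTop (𝓝 0) := by
    rw [← funext hcomb, ← sum_const_zero (s := range (P.natDegree + 1))]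
    refine tendsto_finsetSum _ fun p _ => ?_
    simpa using ((tendsto_add_atTop_iff_nat p).mpr h).const_mul (P.coeff p)
  exact (mul_eq_zero.mp (tendsto_nhds_unique tendsto_const_nhds hlim)).resolve_right hP1

lemma sum_filter_eq_zero_of_eventually_sum_eq_zero {x : ι → ℂ} {g : ι → ℕ → ℂ} {y : ℂ}
    (hg : ∀ i, Tendsto (g i) atTop (𝓝 1)) (h0 : ∀ᶠ k in atTop, ∑ i, d i * x i ^ k * g i k = 0)
    (hy : y ≠ 0) (hmax : ∀ i, d i ≠ 0 → ‖x i‖ ≤ ‖y‖) [DecidablePred fun i => x i = y] :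
    ∑ i with x i = y, d i = 0 := by
  classical
  have hnormal : ∀ᶠ k in atTop, ∑ i, d i * (x i / y) ^ k * g i k = 0 := by
    filter_upwards [h0] with k hk
    rw [← zero_div (y ^ k), ← hk, sum_div]
    exact sum_congr rfl fun i _ => by ring
  have hle : ∀ i, d i ≠ 0 → ‖x i / y‖ ≤ 1 := fun i hi => by
    rw [norm_div]
    exact (div_le_one (norm_pos_iff.mpr hy)).mpr (hmax i hi)
  simpa only [div_eq_one_iff_eq hy] using
    sum_filter_eq_one_eq_zero_of_tendsto (tendsto_sum_mul_pow_zero hle hg hnormal)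

end Asymptotics

noncomputable section LatticePoints

variable {M : ℕ}

/-- The points `q^n t` of the orbit of `t = exp z` under the `q`-shifts, in logarithmic
coordinates. -/
def latticePt (τ : ℂ) (z : Fin M → ℂ) (n : Fin M → ℤ) : Fin M → ℂ := fun i => z i + τ * n i

lemma exp_latticePt (τ : ℂ) (z : Fin M → ℂ) (n : Fin M → ℤ) (i : Fin M) :
    Complex.exp (latticePt τ z n i) = Complex.exp (z i) * Complex.exp τ ^ n i := by
  rw [latticePt, Complex.exp_add, mul_comm τ, Complex.exp_int_mul]

/-- The character `n ↦ ∏ Q_i^{n_i}` of `ℤ^M`. -/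
def latticeChar (Q : Fin M → ℂ) (hQ : ∀ i, Q i ≠ 0) : Multiplicative (Fin M → ℤ) →* ℂ where
  toFun n := ∏ i, Q i ^ (Multiplicative.toAdd n) i
  map_one' := by simp
  map_mul' m n := by
    rw [← prod_mul_distrib]
    exact prod_congr rfl fun i _ => by simp [zpow_add₀ (hQ i)]

lemma latticeChar_single {Q : Fin M → ℂ} (hQ : ∀ i, Q i ≠ 0) (j : Fin M) :
    latticeChar Q hQ (Multiplicative.ofAdd (Pi.single j 1)) = Q j := by
  simp only [latticeChar, MonoidHom.coe_mk, OneHom.coe_mk, toAdd_ofAdd]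
  rw [prod_eq_single j (fun i _ hi => by simp [hi]) (by simp)]
  simp

lemma latticeChar_injective {Q Q' : Fin M → ℂ} {hQ : ∀ i, Q i ≠ 0} {hQ' : ∀ i, Q' i ≠ 0}
    (h : latticeChar Q hQ = latticeChar Q' hQ') : Q = Q' := by
  ext j
  rw [← latticeChar_single hQ, h, latticeChar_single]

lemma latticeMonomial_latticePt (τ : ℂ) (δ : Fin M → ℂ) (z : Fin M → ℂ) (n : Fin M → ℤ) :
    latticeMonomial δ 0 (latticePt τ z n) = latticeMonomial δ 0 z *
      latticeChar (fun i => Complex.exp (τ * δ i)) (fun _ => Complex.exp_ne_zero _)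
        (Multiplicative.ofAdd n) := by
  simp only [latticeMonomial, latticeChar, MonoidHom.coe_mk, OneHom.coe_mk, toAdd_ofAdd,
    ← Complex.exp_int_mul]
  rw [← Complex.exp_sum, ← Complex.exp_add, ← sum_add_distrib]
  congr 1
  refine sum_congr rfl fun i _ => ?_
  simp only [latticePt, Pi.zero_apply]
  push_cast
  ring

end LatticePoints

section DeepPoints

variable {N M : ℕ} {q τ : ℂ} {a : Fin N → ℂ} {b : Fin M → ℂ} {c : Fin N → ℂ} {L : ℕ}

/-- The sequence `t k` goes to the corner of the region, where all the variables of the power series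
in `u` vanish. -/
structure TendstoCorner (L : ℕ) (t : ℕ → Fin M → ℂ) : Prop where
  tendsto_of_lt : ∀ i : Fin M, (i : ℕ) < L → Tendsto (fun k => t k i) atTop (𝓝 0)
  tendsto_inv_of_ge : ∀ i : Fin M, L ≤ (i : ℕ) → Tendsto (fun k => (t k i)⁻¹) atTop (𝓝 0)
  tendsto_div : ∀ i j : Fin M, i < j → Tendsto (fun k => t k i / t k j) atTop (𝓝 0)

lemma Admissible.compVar_ne_zero (h : Admissible q a b c) {t : Fin M → ℂ} (ht : ∀ i, t i ≠ 0)
    (i : Option (Fin N × Fin M)) (j : Fin M) : compVar q a b c L t i j ≠ 0 := by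
  have hprod : ∏ j, c j / a j ≠ 0 :=
    prod_ne_zero_iff.mpr fun j _ => div_ne_zero (h.c_ne j) (h.a_ne j)
  rcases i with _ | ⟨k, l⟩ <;> simp only [compVar] <;> split_ifs <;>
    simp [-prod_div_distrib, ht, hprod, h.q_ne, h.b_ne]

namespace TendstoCorner

variable {t : ℕ → Fin M → ℂ}

lemma tendsto_const_div (ht : TendstoCorner L t) {i : Fin M} (hi : L ≤ (i : ℕ)) (x y : ℂ) :
    Tendsto (fun k => x / (y * t k i)) atTop (𝓝 0) := by
  simpa [div_eq_mul_inv, mul_assoc, mul_comm] using (ht.tendsto_inv_of_ge i hi).const_mul (x * y⁻¹)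

lemma tendsto_mul_div_mul (ht : TendstoCorner L t) {i j : Fin M} (hij : i < j) (x y : ℂ) :
    Tendsto (fun k => x * t k i / (y * t k j)) atTop (𝓝 0) := by
  simpa [mul_div_mul_comm] using (ht.tendsto_div i j hij).const_mul (x / y)

lemma tendsto_compVar (ht : TendstoCorner L t) (i : Option (Fin N × Fin M)) (j : Fin M) :
    Tendsto (fun k => compVar q a b c L (t k) i j) atTop (𝓝 0) := by
  rcases i with _ | ⟨k, l⟩
  · by_cases hj : (j : ℕ) < L
    · simpa only [compVar, if_pos hj] using ht.tendsto_of_lt j hj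
    · simpa only [compVar, if_neg hj] using ht.tendsto_const_div (not_lt.mp hj) _ _
  rcases lt_trichotomy j l with hj | rfl | hj
  · simpa only [compVar_some_of_lt q a b c _ k hj] using ht.tendsto_mul_div_mul hj _ _
  · by_cases hj : (j : ℕ) < L
    · simpa only [compVar_some_self, if_pos hj, mul_div_right_comm, mul_zero] using
        (ht.tendsto_of_lt j hj).const_mul (b j / q)
    · simpa only [compVar_some_self, if_neg hj, mul_zero] using
        (ht.tendsto_const_div (not_lt.mp hj) _ _).const_mul (∏ j, c j / a j)
  · simpa only [compVar_some_of_gt q a b c _ k hj] using ht.tendsto_mul_div_mul hj _ _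

lemma eventually_inRegion (ht : TendstoCorner L t) (h0 : ∀ k i, t k i ≠ 0) :
    ∀ᶠ k in atTop, InRegion q a b c L (t k) := by
  have eventually_lt {f : ℕ → ℂ} (hf : Tendsto f atTop (𝓝 0)) : ∀ᶠ k in atTop, ‖f k‖ < 1 :=
    (tendsto_zero_iff_norm_tendsto_zero.mp hf).eventually_lt_const one_pos
  have hsmall : ∀ᶠ k in atTop, ∀ i : Fin M, (i : ℕ) < L → ‖t k i‖ < 1 :=
    eventually_all.mpr fun i => eventually_imp_distrib_left.mpr fun hi =>
      eventually_lt (ht.tendsto_of_lt i hi)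
  have hlarge : ∀ᶠ k in atTop, ∀ i : Fin M, L ≤ (i : ℕ) →
      ‖(∏ j, c j / a j) * (q / (b i * t k i))‖ < 1 :=
    eventually_all.mpr fun i => eventually_imp_distrib_left.mpr fun hi =>
      eventually_lt <| by simpa using (ht.tendsto_const_div hi q (b i)).const_mul (∏ j, c j / a j)
  have hratio : ∀ᶠ k in atTop, ∀ i j : Fin M, i < j → ‖q * t k i / (b j * t k j)‖ < 1 :=
    eventually_all.mpr fun i => eventually_all.mpr fun j => eventually_imp_distrib_left.mpr
      fun hij => eventually_lt (ht.tendsto_mul_div_mul hij q (b j))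
  filter_upwards [hsmall, hlarge, hratio] with k h1 h2 h3 using ⟨h0 k, h1, h2, h3⟩

lemma tendsto_tsum_compTerm (ht : TendstoCorner L t) (h0 : ∀ k i, t k i ≠ 0)
    (h : Admissible q a b c) (hL : L ≤ M) (i : Option (Fin N × Fin M)) :
    Tendsto (fun k => ∑' m, compTerm q a b c L (t k) i m) atTop (𝓝 1) := by
  obtain ⟨k₀, hk₀⟩ := (ht.eventually_inRegion (q := q) (a := a) (b := b) (c := c) h0).exists
  refine tendsto_tsum_signedTerm_one _ (h.summable_compTerm hL hk₀ i)
    (compTwoSided_zero q a b c L i) (compOneSided_zero q a b c L i)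
    (eventually_all.mpr fun j => ?_) (ht.tendsto_compVar i)
  have hpos := norm_pos_iff.mpr (h.compVar_ne_zero (L := L) (h0 k₀) i j)
  exact (((tendsto_zero_iff_norm_tendsto_zero.mp (ht.tendsto_compVar i j)).eventually_lt_const
    hpos).mono fun _ => le_of_lt)

end TendstoCorner

/-- A direction in `ℤ^M` in which the orbit of every point goes to the corner of the region. -/
def deepDir (M L : ℕ) (i : Fin M) : ℤ := if (i : ℕ) < L then (L : ℤ) - i else (L : ℤ) - i - 1

lemma deepDir_pos {i : Fin M} (h : (i : ℕ) < L) : 0 < deepDir M L i := by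
  rw [deepDir, if_pos h]
  lia

lemma deepDir_neg {i : Fin M} (h : L ≤ (i : ℕ)) : deepDir M L i < 0 := by
  rw [deepDir, if_neg h.not_gt]
  lia

lemma deepDir_lt {i j : Fin M} (h : i < j) : deepDir M L j < deepDir M L i := by
  rw [Fin.lt_def] at h
  unfold deepDir
  split_ifs <;> lia

lemma exp_latticePt_nsmul_add (τ : ℂ) (z : Fin M → ℂ) (v w : Fin M → ℤ) (k : ℕ) (i : Fin M) :
    Complex.exp (latticePt τ z (k • v + w) i) =
      Complex.exp (latticePt τ z w i) * (Complex.exp τ ^ v i) ^ k := by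
  rw [exp_latticePt, exp_latticePt, mul_assoc, ← zpow_natCast (_ ^ v i), ← zpow_mul,
    ← zpow_add₀ (Complex.exp_ne_zero τ)]
  congr 2
  rw [Pi.add_apply, Pi.smul_apply, nsmul_eq_mul]
  ring

lemma tendsto_const_mul_zpow_pow (hq0 : q ≠ 0) (hq1 : ‖q‖ < 1) (x : ℂ) {n : ℤ} (hn : 0 < n) :
    Tendsto (fun k : ℕ => x * (q ^ n) ^ k) atTop (𝓝 0) := by
  have hlt : ‖q ^ n‖ < 1 := by
    rw [norm_zpow]
    exact zpow_lt_one₀ (norm_pos_iff.mpr hq0) hq1 hn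
  simpa using (tendsto_pow_atTop_nhds_zero_of_norm_lt_one hlt).const_mul x

lemma tendstoCorner_latticePt (hτ : ‖Complex.exp τ‖ < 1) (z : Fin M → ℂ) (w : Fin M → ℤ) :
    TendstoCorner L fun k i => Complex.exp (latticePt τ z (k • deepDir M L + w) i) where
  tendsto_of_lt i hi := by
    simp only [exp_latticePt_nsmul_add]
    exact tendsto_const_mul_zpow_pow (Complex.exp_ne_zero τ) hτ _ (deepDir_pos hi)
  tendsto_inv_of_ge i hi := by
    simp only [exp_latticePt_nsmul_add, mul_inv, ← inv_pow, ← zpow_neg]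
    exact tendsto_const_mul_zpow_pow (Complex.exp_ne_zero τ) hτ _ (neg_pos.mpr (deepDir_neg hi))
  tendsto_div i j hij := by
    simp only [exp_latticePt_nsmul_add, mul_div_mul_comm, ← div_pow,
      ← zpow_sub₀ (Complex.exp_ne_zero τ)]
    exact tendsto_const_mul_zpow_pow (Complex.exp_ne_zero τ) hτ _ (sub_pos.mpr (deepDir_lt hij))

lemma eventually_latticePt_mem_region (hτ : ‖Complex.exp τ‖ < 1) (z : Fin M → ℂ)
    (w : Fin M → ℤ) :
    ∀ᶠ k : ℕ in atTop, latticePt τ z (k • deepDir M L + w) ∈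
      region (Complex.exp τ) a b c L 1 :=
  ((tendstoCorner_latticePt hτ z w).eventually_inRegion fun _ _ => Complex.exp_ne_zero _).mono
    fun _ => mem_region_one_iff.mpr

end DeepPoints

section Independence

variable {N M : ℕ} {τ : ℂ} {L : ℕ} {α : Fin N → ℂ} {β : Fin M → ℂ} {γ : Fin N → ℂ}

lemma exp_mul_compExp_some_self_ne_one
    (h : Admissible (Complex.exp τ) (qPow τ α) (qPow τ β) (qPow τ γ)) (k : Fin N) (l : Fin M) :
    Complex.exp (τ * compExp α β γ L (some (k, l)) l) ≠ 1 := by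
  rw [exp_mul_compExp_some_self, Ne, inv_eq_one]
  simpa using h.twoSidedBase_mul_zpow_ne_one (L := L) k l 0

lemma exp_mul_compExp_none_ne
    (h : Admissible (Complex.exp τ) (qPow τ α) (qPow τ β) (qPow τ γ)) (k : Fin N) (l : Fin M) :
    Complex.exp (τ * compExp α β γ L none l) ≠
      Complex.exp (τ * compExp α β γ L (some (k, l)) l) := by
  by_cases hl : (l : ℕ) < L
  · rw [show compExp α β γ L none l = 0 from if_pos hl, mul_zero, Complex.exp_zero]
    exact (exp_mul_compExp_some_self_ne_one h k l).symm
  · intro heq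
    rw [exp_mul_compExp_some_self] at heq
    simp only [compExp, if_neg hl] at heq
    rw [exp_mul_neg_eq_inv_qPow, inv_inj] at heq
    refine h.mul_twoSidedBase_div_mul_zpow_ne_one (L := L) k l (-1) ?_
    rw [← heq, mul_div_cancel_right₀ _ (h.b_ne l), zpow_neg_one, mul_inv_cancel₀ h.q_ne]

lemma exp_mul_compExp_some_ne_of_lt
    (h : Admissible (Complex.exp τ) (qPow τ α) (qPow τ β) (qPow τ γ)) (k k' : Fin N)
    {l l' : Fin M} (hl : l < l') :
    Complex.exp (τ * compExp α β γ L (some (k, l)) l) ≠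
      Complex.exp (τ * compExp α β γ L (some (k', l')) l) := by
  rw [compExp_some_of_lt _ _ _ _ hl, mul_zero, Complex.exp_zero]
  exact exp_mul_compExp_some_self_ne_one h k l

lemma Admissible.eq_of_twoSidedBase_eq {q : ℂ} {a : Fin N → ℂ} {b : Fin M → ℂ} {c : Fin N → ℂ}
    (h : Admissible q a b c) {k k' : Fin N} {l : Fin M}
    (heq : twoSidedBase q a b c L k l = twoSidedBase q a b c L k' l) : k = k' := by
  by_contra hk
  unfold twoSidedBase at heq
  have htail := h.tailProd_ne (l + 1)
  split_ifs at heq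
  · rw [div_left_inj' (mul_ne_zero h.q_ne htail)] at heq
    exact h.c_div_c k k' hk 0 (by rw [heq, div_self (h.c_ne k'), zpow_zero])
  · rw [div_left_inj' htail] at heq
    exact h.a_div_a k k' hk 0 (by rw [heq, div_self (h.a_ne k'), zpow_zero])

lemma exp_mul_compExp_injective
    (h : Admissible (Complex.exp τ) (qPow τ α) (qPow τ β) (qPow τ γ)) :
    Function.Injective fun (i : Option (Fin N × Fin M)) (j : Fin M) =>
      Complex.exp (τ * compExp α β γ L i j) := by
  rintro (_ | ⟨k, l⟩) (_ | ⟨k', l'⟩) hi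
  · rfl
  · exact absurd (congrFun hi l') (exp_mul_compExp_none_ne h k' l')
  · exact absurd (congrFun hi l).symm (exp_mul_compExp_none_ne h k l)
  · rcases lt_trichotomy l l' with hl | rfl | hl
    · exact absurd (congrFun hi l) (exp_mul_compExp_some_ne_of_lt h k k' hl)
    · have hbase := congrFun hi l
      simp only [exp_mul_compExp_some_self, inv_inj] at hbase
      rw [h.eq_of_twoSidedBase_eq hbase]
    · exact absurd (congrFun hi l').symm (exp_mul_compExp_some_ne_of_lt h k' k hl)

theorem eq_zero_of_sum_mul_u_one_latticePt_eq_zero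
    (h : Admissible (Complex.exp τ) (qPow τ α) (qPow τ β) (qPow τ γ)) (hL : L ≤ M)
    (z : Fin M → ℂ) (C : Option (Fin N × Fin M) → ℂ)
    (hC : ∀ n, latticePt τ z n ∈ region (Complex.exp τ) (qPow τ α) (qPow τ β) (qPow τ γ) L 1 →
      ∑ i, C i * u τ α β γ L hL 1 i (latticePt τ z n) = 0) : C = 0 := by
  classical
  let χ : Option (Fin N × Fin M) → Multiplicative (Fin M → ℤ) →* ℂ := fun i =>
    latticeChar (fun j => Complex.exp (τ * compExp α β γ L i j)) fun _ => Complex.exp_ne_zero _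
  have hχ : LinearIndependent ℂ fun i => (χ i : Multiplicative (Fin M → ℤ) → ℂ) :=
    (linearIndependent_monoidHom _ ℂ).comp χ fun _ _ hi =>
      exp_mul_compExp_injective h (latticeChar_injective hi)
  let A : Option (Fin N × Fin M) → ℂ := fun i => latticeMonomial (compExp α β γ L i) 0 z
  let v := Multiplicative.ofAdd (deepDir M L)
  have hrel (w : Fin M → ℤ) : ∀ᶠ k : ℕ in atTop,
      ∑ i, (C i * A i * χ i (Multiplicative.ofAdd w)) * χ i v ^ k *
        ∑' m, compTerm (Complex.exp τ) (qPow τ α) (qPow τ β) (qPow τ γ) L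
          (fun j => Complex.exp (latticePt τ z (k • deepDir M L + w) j)) i m = 0 := by
    filter_upwards [eventually_latticePt_mem_region h.q_lt z w] with k hk
    rw [← hC _ hk]
    refine sum_congr rfl fun i _ => ?_
    rw [u_one_eq, latticeMonomial_latticePt, ofAdd_add, map_mul, ofAdd_nsmul, map_pow]
    ring
  -- The terms with the largest growth in the deep direction already sum up to zero.
  by_contra hne
  obtain ⟨i₁, hi₁⟩ := Function.ne_iff.mp hne
  obtain ⟨i₀, hi₀, hmax⟩ := exists_max_image ({i | C i ≠ 0} : Finset (Option (Fin N × Fin M)))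
    (fun i => ‖χ i v‖) ⟨i₁, by simpa using hi₁⟩
  have hlead (w : Fin M → ℤ) : ∑ i with χ i v = χ i₀ v,
      C i * A i * χ i (Multiplicative.ofAdd w) = 0 :=
    sum_filter_eq_zero_of_eventually_sum_eq_zero
      (fun i => (tendstoCorner_latticePt h.q_lt z w).tendsto_tsum_compTerm
        (fun _ _ => Complex.exp_ne_zero _) h hL i) (hrel w)
      ((Group.isUnit v).map (χ i₀)).ne_zero fun i hi =>
      hmax i (by simpa using left_ne_zero_of_mul (left_ne_zero_of_mul hi))
  have hzero := linearIndependent_iff'.mp hχ _ (fun i => C i * A i) (by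
    ext w
    simpa [Finset.sum_apply] using hlead (Multiplicative.toAdd w)) i₀ (by simp)
  exact mul_ne_zero (by simpa using hi₀) (Complex.exp_ne_zero _) hzero

end Independence

/-! ### Propagation of zeros on polyhedral regions of the lattice -/

section Polyhedron

variable {m : ℕ}

/-- The polyhedron `{P ; D_{ab} ≤ P_a - P_b for a < b}`: the shape, in partial sums of the lattice
coordinates, of the part of an orbit that lies in the region. -/
def polyhedron (D : Fin m → Fin m → ℤ) : Set (Fin m → ℤ) :=
  {P | ∀ a b, a < b → D a b ≤ P a - P b}

/-- The point `P + u e_a - w e_b`, with which the rectangles in the directions `e_a` and `-e_b` are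
described. -/
def movePt (P : Fin m → ℤ) (a b : Fin m) (u w : ℕ) : Fin m → ℤ :=
  P + Pi.single a (u : ℤ) - Pi.single b (w : ℤ)

/-- The total amount by which `P` violates the inequalities of `polyhedron R`. -/
def polyhedronDefect (R : Fin m → Fin m → ℤ) (P : Fin m → ℤ) : ℕ :=
  ∑ x : Fin m × Fin m, if x.1 < x.2 then (R x.1 x.2 - (P x.1 - P x.2)).toNat else 0

variable {D R : Fin m → Fin m → ℤ} {P Q : Fin m → ℤ}

lemma polyhedronDefect_lt (hmin : ∀ x y, x < y → min (P x - P y) (R x y) ≤ Q x - Q y)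
    {a b : Fin m} (hab : a < b) (hP : P a - P b < R a b) (hQ : P a - P b < Q a - Q b) :
    polyhedronDefect R Q < polyhedronDefect R P := by
  refine sum_lt_sum (fun x _ => ?_) ⟨(a, b), mem_univ _, ?_⟩
  · split_ifs with hx
    · have := hmin x.1 x.2 hx
      lia
    · exact le_rfl
  · rw [if_pos hab, if_pos hab]
    lia

lemma exists_outermost_violation (hP : P ∉ polyhedron R) :
    ∃ a b, a < b ∧ P a - P b < R a b ∧ (∀ y, b < y → R a y ≤ P a - P y) ∧
      ∀ x, x < a → R x b ≤ P x - P b := by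
  have hviol : ∃ x : Fin m × Fin m, x.1 < x.2 ∧ P x.1 - P x.2 < R x.1 x.2 := by
    simp only [polyhedron, Set.mem_ofPred_eq] at hP
    push Not at hP
    obtain ⟨a, b, h⟩ := hP
    exact ⟨(a, b), h⟩
  obtain ⟨⟨a, b⟩, hab, hmax⟩ := exists_max_image
    ({x | x.1 < x.2 ∧ P x.1 - P x.2 < R x.1 x.2} : Finset (Fin m × Fin m))
    (fun x => (x.2 : ℕ) - x.1) (by simpa [Finset.Nonempty] using hviol)
  simp only [mem_filter, mem_univ, true_and] at hab hmax
  refine ⟨a, b, hab.1, hab.2, fun y hy => ?_, fun x hx => ?_⟩ <;> by_contra! hlt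
  · have := hmax (a, y) ⟨hab.1.trans hy, hlt⟩
    simp only [Fin.lt_def] at *
    lia
  · have := hmax (x, b) ⟨hx.trans hab.1, hlt⟩
    simp only [Fin.lt_def] at *
    lia

lemma min_le_movePt_sub_movePt {N : ℕ} {a b : Fin m}
    (hR : ∀ a b c, a < b → b < c → R a b + R b c + N ≤ R a c) (hab : a < b)
    (hright : ∀ y, b < y → R a y ≤ P a - P y) (hleft : ∀ x, x < a → R x b ≤ P x - P b)
    {u w : ℕ} (hu : u ≤ N) (hw : w ≤ N) (hviol : P a - P b < R a b) {x y : Fin m} (hxy : x < y) :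
    min (P x - P y) (R x y) ≤ movePt P a b u w x - movePt P a b u w y := by
  simp only [movePt, Pi.add_apply, Pi.sub_apply, Pi.single_apply]
  rcases eq_or_ne x b with rfl | hxb
  · have := hright y hxy
    have := hR a x y hab hxy
    split_ifs <;> lia
  rcases eq_or_ne y a with rfl | hya
  · have := hleft x hxy
    have := hR x y b hxy hab
    split_ifs <;> lia
  · split_ifs <;> lia

theorem eq_zero_of_mem_polyhedron (N : ℕ) {F : (Fin m → ℤ) → ℂ}
    (hDR : ∀ a b, a < b → D a b ≤ R a b)
    (hR : ∀ a b c, a < b → b < c → R a b + R b c + N ≤ R a c)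
    (hrel : ∀ a b, a < b → ∀ P, (∀ u ≤ N, ∀ w ≤ N, movePt P a b u w ∈ polyhedron D) →
      (∀ u ≤ N, ∀ w ≤ N, u ≠ 0 ∨ w ≠ 0 → F (movePt P a b u w) = 0) → F P = 0)
    (hdeep : ∀ P ∈ polyhedron R, F P = 0) (hP : P ∈ polyhedron D) : F P = 0 := by
  induction hn : polyhedronDefect R P using Nat.strong_induction_on generalizing P with
  | _ n ih =>
  by_cases hPR : P ∈ polyhedron R
  · exact hdeep P hPR
  -- At an outermost violated inequality, a move creates no new violation.
  obtain ⟨a, b, hab, hviol, hright, hleft⟩ := exists_outermost_violation hPR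
  have hmin (u) (hu : u ≤ N) (w) (hw : w ≤ N) (x y) (hxy : x < y) :=
    min_le_movePt_sub_movePt hR hab hright hleft hu hw hviol hxy
  have hmem : ∀ u ≤ N, ∀ w ≤ N, movePt P a b u w ∈ polyhedron D := fun u hu w hw x y hxy =>
    (le_min (hP x y hxy) (hDR x y hxy)).trans (hmin u hu w hw x y hxy)
  refine hrel a b hab P hmem fun u hu w hw huw => ih _ ?_ (hmem u hu w hw) rfl
  rw [← hn]
  refine polyhedronDefect_lt (hmin u hu w hw) hab hviol ?_
  simp only [movePt, Pi.add_apply, Pi.sub_apply, Pi.single_apply]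
  split_ifs <;> lia

lemma exists_add_single_mem_polyhedron (hP : P ∈ polyhedron R) (hQ : Q ∈ polyhedron R)
    (h : ∃ r, P r < Q r) : ∃ r, P r < Q r ∧ P + Pi.single r 1 ∈ polyhedron R := by
  obtain ⟨r, hr, hmin⟩ := exists_min_image ({r | P r < Q r} : Finset (Fin m)) id
    (by simpa [Finset.Nonempty] using h)
  simp only [mem_filter, mem_univ, true_and, id] at hr hmin
  refine ⟨r, hr, fun a b hab => ?_⟩
  have hPab := hP a b hab
  simp only [Pi.add_apply, Pi.single_apply]
  rcases eq_or_ne b r with rfl | hbr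
  · have hQa : Q a ≤ P a := not_lt.mp fun hlt => (hmin a hlt).not_gt hab
    have hQab := hQ a b hab
    rw [if_pos rfl, if_neg hab.ne]
    lia
  · rw [if_neg hbr]
    split_ifs <;> lia

lemma sum_natAbs_add_single_sub_lt {r : Fin m} (h : P r < Q r) :
    ∑ a, ((P + Pi.single r 1 : Fin m → ℤ) a - Q a).natAbs < ∑ a, (P a - Q a).natAbs := by
  refine sum_lt_sum (fun a _ => ?_) ⟨r, mem_univ r, ?_⟩
  · rw [Pi.add_apply, Pi.single_apply]
    split_ifs with ha
    · subst ha
      lia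
    · simp
  · rw [Pi.add_apply, Pi.single_eq_same]
    lia

theorem iff_of_mem_polyhedron (s : Fin m) {Y : (Fin m → ℤ) → Prop}
    (hstep : ∀ r, r ≠ s → ∀ P ∈ polyhedron R, P + Pi.single r 1 ∈ polyhedron R →
      (Y P ↔ Y (P + Pi.single r 1)))
    (hP : P ∈ polyhedron R) (hQ : Q ∈ polyhedron R) (hs : P s = Q s) : Y P ↔ Y Q := by
  induction hn : ∑ a, (P a - Q a).natAbs using Nat.strong_induction_on generalizing P Q with
  | _ n ih =>
  have iff_of_lt : ∀ {P Q : Fin m → ℤ}, P ∈ polyhedron R → Q ∈ polyhedron R → P s = Q s →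
      ∑ a, (P a - Q a).natAbs = n → (∃ r, P r < Q r) → (Y P ↔ Y Q) := by
    intro P Q hP hQ hs hn hlt
    obtain ⟨r, hr, hmem⟩ := exists_add_single_mem_polyhedron hP hQ hlt
    have hrs : r ≠ s := fun h => hr.ne (h ▸ hs)
    exact (hstep r hrs P hP hmem).trans <|
      ih _ (hn ▸ sum_natAbs_add_single_sub_lt hr) hmem hQ (by simp [hrs.symm, hs]) rfl
  rcases eq_or_ne P Q with rfl | hne
  · rfl
  obtain ⟨r, hr⟩ := Function.ne_iff.mp hne
  rcases hr.lt_or_gt with hr | hr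
  · exact iff_of_lt hP hQ hs hn ⟨r, hr⟩
  · have hswap : ∑ a, (Q a - P a).natAbs = n := by
      rw [← hn]
      exact sum_congr rfl fun a _ => by rw [← Int.natAbs_neg, neg_sub]
    exact (iff_of_lt hQ hP hs.symm hswap ⟨r, hr⟩).symm

end Polyhedron

section LocalPropagation

variable {M : ℕ}

/-- The lattice point `(k, …, k)`. -/
def diagPt (M k : ℕ) : Fin M → ℤ := fun _ => k

/-- The indicator of `S`, as a lattice point: a vertex of the unit cube. -/
def indPt (S : Finset (Fin M)) : Fin M → ℤ := fun i => if i ∈ S then 1 else 0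

@[simp] lemma diagPt_zero : diagPt M 0 = 0 := by
  ext
  simp [diagPt]

lemma diagPt_succ (k : ℕ) : diagPt M (k + 1) = diagPt M k + indPt univ := by
  ext
  simp [diagPt, indPt]

@[simp] lemma indPt_empty : indPt (∅ : Finset (Fin M)) = 0 := by
  ext
  simp [indPt]

lemma indPt_insert {r : Fin M} {S : Finset (Fin M)} (h : r ∉ S) :
    indPt (insert r S) = indPt S + Pi.single r 1 := by
  ext i
  rcases eq_or_ne i r with rfl | hi
  · simp [indPt, h]
  · simp [indPt, hi]

lemma indPt_eq_erase_add {r : Fin M} {S : Finset (Fin M)} (h : r ∈ S) :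
    indPt S = indPt (S.erase r) + Pi.single r 1 := by
  rw [← indPt_insert (notMem_erase r S), insert_erase h]

/-- Zeros of `F` propagate from `p` along the unit squares (second family of equations) and along
the rectangles `{p + (k, …, k), p + (k, …, k) + e_s ; k ≤ N}` (first family of equations). -/
structure ZeroRules (N : ℕ) (F : (Fin M → ℤ) → ℂ) (p : Fin M → ℤ) : Prop where
  square_top : ∀ r s, r ≠ s → F p = 0 → F (p + Pi.single r 1) = 0 → F (p + Pi.single s 1) = 0 →
    F (p + Pi.single r 1 + Pi.single s 1) = 0
  square_side : ∀ r s, r ≠ s → F p = 0 → F (p + Pi.single s 1) = 0 →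
    F (p + Pi.single s 1 + Pi.single r 1) = 0 → F (p + Pi.single r 1) = 0
  rect_top : ∀ s, (∀ k ≤ N, F (p + diagPt M k) = 0) →
    (∀ k < N, F (p + diagPt M k + Pi.single s 1) = 0) → F (p + diagPt M N + Pi.single s 1) = 0
  rect_bot : ∀ s, (∀ k, 1 ≤ k → k ≤ N → F (p + diagPt M k) = 0) →
    (∀ k ≤ N, F (p + diagPt M k + Pi.single s 1) = 0) → F p = 0

/-- The rules `ZeroRules` hold on the cube with corner `n` and side `B`. -/
def RulesNear (N : ℕ) (F : (Fin M → ℤ) → ℂ) (B : ℕ) (n : Fin M → ℤ) : Prop :=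
  ∀ p, (∀ i, n i ≤ p i ∧ p i ≤ n i + B) → ZeroRules N F p

/-- The `N M + 1` initial values of `F` at `n` vanish. -/
def InitZero (N : ℕ) (F : (Fin M → ℤ) → ℂ) (n : Fin M → ℤ) : Prop :=
  F n = 0 ∧ ∀ k < N, ∀ s, F (n + diagPt M k + Pi.single s 1) = 0

lemma single_one_bounds (s i : Fin M) :
    0 ≤ (Pi.single s 1 : Fin M → ℤ) i ∧ (Pi.single s 1 : Fin M → ℤ) i ≤ 1 := by
  rw [Pi.single_apply]
  split_ifs <;> simp

lemma indPt_bounds (S : Finset (Fin M)) (i : Fin M) : 0 ≤ indPt S i ∧ indPt S i ≤ 1 := by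
  rw [indPt]
  split_ifs <;> simp

variable {N B : ℕ} {F : (Fin M → ℤ) → ℂ} {n p : Fin M → ℤ}

lemma RulesNear.mono {B' : ℕ} {n' : Fin M → ℤ} (h : RulesNear N F B n)
    (hn : ∀ i, n i ≤ n' i ∧ n' i + B' ≤ n i + B) : RulesNear N F B' n' := fun p hp =>
  h p fun i => ⟨(hn i).1.trans (hp i).1, (hp i).2.trans (hn i).2⟩

lemma RulesNear.add_single (h : RulesNear N F (B + 1) n) (r : Fin M) :
    RulesNear N F B (n + Pi.single r 1) :=
  h.mono fun i => by
    have := single_one_bounds r i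
    simp only [Pi.add_apply]
    lia

lemma RulesNear.add_diagPt {k : ℕ} (h : RulesNear N F (B + k) n) :
    RulesNear N F B (n + diagPt M k) :=
  h.mono fun i => by
    simp only [Pi.add_apply, diagPt]
    lia

lemma RulesNear.zeroRules_add_indPt (h : RulesNear N F 1 p) (S : Finset (Fin M)) :
    ZeroRules N F (p + indPt S) :=
  h _ fun i => by
    have := indPt_bounds S i
    simp only [Pi.add_apply]
    lia

lemma eq_zero_add_indPt (hG : RulesNear N F 1 p) {A : Finset (Fin M)} (h0 : F p = 0)
    (h1 : ∀ s ∈ A, F (p + Pi.single s 1) = 0) {S : Finset (Fin M)} (hS : S ⊆ A) :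
    F (p + indPt S) = 0 := by
  induction S using Finset.strongInduction with
  | _ S ih =>
  rcases S.eq_empty_or_nonempty with rfl | ⟨r, hr⟩
  · simpa using h0
  rcases (S.erase r).eq_empty_or_nonempty with he | ⟨s, hs⟩
  · rw [indPt_eq_erase_add hr, he, indPt_empty, zero_add]
    exact h1 r (hS hr)
  have hsr := ne_of_mem_erase hs
  have hrs : r ∈ S.erase s := mem_erase.mpr ⟨hsr.symm, hr⟩
  have eq_zero : ∀ {S'}, S' ⊂ S → F (p + indPt S') = 0 := fun h => ih _ h (h.subset.trans hS)
  have f0 := eq_zero ((erase_ssubset hs).trans (erase_ssubset hr))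
  have f1 := eq_zero (erase_ssubset hr)
  have f2 := eq_zero (erase_ssubset (mem_of_mem_erase hs))
  rw [indPt_eq_erase_add hs, ← add_assoc] at f1
  rw [indPt_eq_erase_add hrs, erase_right_comm, ← add_assoc] at f2
  rw [indPt_eq_erase_add hr, indPt_eq_erase_add hs, ← add_assoc, ← add_assoc]
  exact (hG.zeroRules_add_indPt _).square_top s r hsr f0 f1 f2

lemma eq_zero_add_single_of_diag (hG : RulesNear N F 1 p) {r : Fin M} (h0 : F p = 0)
    (h1 : ∀ s, s ≠ r → F (p + Pi.single s 1) = 0) (hd : F (p + indPt univ) = 0) :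
    F (p + Pi.single r 1) = 0 := by
  have hcube : ∀ {S}, S ⊆ univ.erase r → F (p + indPt S) = 0 :=
    eq_zero_add_indPt hG h0 fun s hs => h1 s (ne_of_mem_erase hs)
  have descend : ∀ S : Finset (Fin M), S ⊆ univ.erase r →
      F (p + indPt S + Pi.single r 1) = 0 → F (p + Pi.single r 1) = 0 := by
    intro S
    induction S using Finset.induction_on with
    | empty => exact fun _ h => by simpa using h
    | insert s S hs ih =>
      intro hS h
      have hS' : S ⊆ univ.erase r := (subset_insert s S).trans hS
      have hsr : s ≠ r := ne_of_mem_erase (hS (mem_insert_self s S))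
      have f1 := hcube hS
      rw [indPt_insert hs, ← add_assoc] at h f1
      exact ih hS' ((hG.zeroRules_add_indPt S).square_side r s hsr.symm (hcube hS') f1 h)
  refine descend (univ.erase r) subset_rfl ?_
  rwa [add_assoc, ← indPt_eq_erase_add (mem_univ r)]

namespace InitZero

lemma add_diagPt_eq_zero (h : InitZero N F n) (hG : RulesNear N F (N + 1) n) {k : ℕ}
    (hk : k ≤ N) : F (n + diagPt M k) = 0 := by
  induction k with
  | zero => simpa using h.1
  | succ k ih =>
    rw [diagPt_succ, ← add_assoc]
    have hG' : RulesNear N F (1 + k) n := hG.mono fun i => by lia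
    exact eq_zero_add_indPt hG'.add_diagPt (ih (by lia)) (fun s _ => h.2 k hk s)
      (subset_univ _)

lemma add_diagPt_add_single_eq_zero (h : InitZero N F n) (hG : RulesNear N F (N + 1) n) {k : ℕ}
    (hk : k ≤ N) (s : Fin M) : F (n + diagPt M k + Pi.single s 1) = 0 := by
  rcases hk.lt_or_eq with hk | rfl
  · exact h.2 k hk s
  · exact (hG n fun i => by lia).rect_top s (fun j hj => h.add_diagPt_eq_zero hG hj)
      fun j hj => h.2 j hj s

lemma add_diagPt_add_indPt_eq_zero (h : InitZero N F n) (hG : RulesNear N F (N + 1) n) {k : ℕ}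
    (hk : k ≤ N) (S : Finset (Fin M)) : F (n + diagPt M k + indPt S) = 0 := by
  have hG' : RulesNear N F (1 + k) n := hG.mono fun i => by lia
  exact eq_zero_add_indPt hG'.add_diagPt (h.add_diagPt_eq_zero hG hk)
    (fun s _ => h.add_diagPt_add_single_eq_zero hG hk s) (subset_univ S)

lemma add_single (h : InitZero N F n) (hG : RulesNear N F (N + 2) n) (r : Fin M) :
    InitZero N F (n + Pi.single r 1) := by
  have hG' : RulesNear N F (N + 1) n := hG.mono fun i => by lia
  have hside : ∀ k ≤ N, ∀ s, s ≠ r → F (n + diagPt M k + Pi.single r 1 + Pi.single s 1) = 0 := by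
    intro k hk s hs
    have := h.add_diagPt_add_indPt_eq_zero hG' hk (insert s (insert r ∅))
    rwa [indPt_insert (by simpa using hs), indPt_insert (notMem_empty r), indPt_empty, zero_add,
      ← add_assoc] at this
  refine ⟨by simpa using h.add_diagPt_add_single_eq_zero hG' (Nat.zero_le _) r, fun k hk s => ?_⟩
  rw [add_right_comm n]
  rcases eq_or_ne s r with rfl | hs
  · have hGk : RulesNear N F (1 + 1 + k) n := hG.mono fun i => by lia
    refine eq_zero_add_single_of_diag (hGk.add_diagPt.add_single s) (h.2 k hk s)
      (hside k hk.le) ?_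
    rw [add_right_comm, add_assoc n, ← diagPt_succ]
    exact h.add_diagPt_add_single_eq_zero hG' hk s
  · exact hside k hk.le s hs

lemma of_add_single {r : Fin M} (h : InitZero N F (n + Pi.single r 1))
    (hG : RulesNear N F (N + 3) n) : InitZero N F n := by
  have hGr : RulesNear N F (N + 2) (n + Pi.single r 1) := hG.add_single r
  have hGr' : RulesNear N F (N + 1) (n + Pi.single r 1) := hGr.mono fun i => by lia
  have diagPt_succ' : ∀ (x : Fin M → ℤ) (k : ℕ), x + diagPt M (k + 1) =
      x + Pi.single r 1 + diagPt M k + indPt (univ.erase r) := fun x k => by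
    rw [diagPt_succ, indPt_eq_erase_add (mem_univ r)]
    abel
  have f1 : ∀ k ≤ N, F (n + diagPt M (k + 1)) = 0 := fun k hk => by
    rw [diagPt_succ']
    exact h.add_diagPt_add_indPt_eq_zero hGr' hk _
  have f2 : ∀ s, ∀ k ≤ N, F (n + diagPt M (k + 1) + Pi.single s 1) = 0 := fun s k hk => by
    rw [add_right_comm, diagPt_succ', add_right_comm n]
    exact (h.add_single hGr s).add_diagPt_add_indPt_eq_zero (hGr.add_single s) hk _
  have f3 : ∀ k ≤ N, F (n + diagPt M k + Pi.single r 1) = 0 := fun k hk => by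
    rw [add_right_comm]
    exact h.add_diagPt_eq_zero hGr' hk
  have hrules : ZeroRules N F n := hG n fun i => by lia
  have f0 : F n = 0 := hrules.rect_bot r
    (fun k hk1 hk2 => by simpa [Nat.sub_add_cancel hk1] using f1 (k - 1) (by lia)) f3
  refine ⟨f0, fun k hk s => ?_⟩
  rcases eq_or_ne s r with rfl | hs
  · exact f3 k hk.le
  rcases k with _ | k
  · rw [diagPt_zero, add_zero]
    exact hrules.square_side s r hs f0 h.1
      (by simpa using h.add_diagPt_add_single_eq_zero hGr' (Nat.zero_le _) s)
  · exact f2 s k (by lia)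

end InitZero

lemma initZero_add_single_iff (hG : RulesNear N F (N + 3) n) (r : Fin M) :
    InitZero N F n ↔ InitZero N F (n + Pi.single r 1) :=
  ⟨fun h => h.add_single (hG.mono fun i => by lia) r, fun h => h.of_add_single hG⟩

end LocalPropagation

/-! ### Solutions on an orbit are determined by finitely many values -/

section Orbit

variable {N M : ℕ} {τ : ℂ} {a : Fin N → ℂ} {b : Fin M → ℂ} {c : Fin N → ℂ}
  {D : Set (Fin M → ℂ)} {f : (Fin M → ℂ) → ℂ} {z : Fin M → ℂ}

lemma latticePt_zero (z : Fin M → ℂ) : latticePt τ z 0 = z := by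
  ext
  simp [latticePt]

lemma latticePt_latticePt (z : Fin M → ℂ) (n n' : Fin M → ℤ) :
    latticePt τ (latticePt τ z n) n' = latticePt τ z (n + n') := by
  ext
  simp [latticePt, mul_add, add_assoc]

lemma shiftPt_latticePt (s : Fin M) (n : Fin M → ℤ) :
    shiftPt τ s (latticePt τ z n) = latticePt τ z (n + Pi.single s 1) := by
  ext i
  rcases eq_or_ne i s with rfl | h
  · simp [shiftPt, latticePt, mul_add, add_assoc]
  · simp [shiftPt, latticePt, h]

lemma shiftAllPt_latticePt (k : ℕ) (n : Fin M → ℤ) :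
    (shiftAllPt τ)^[k] (latticePt τ z n) = latticePt τ z (n + diagPt M k) := by
  rw [shiftAllPt_iterate]
  ext
  simp [latticePt, diagPt, mul_add, add_assoc, mul_comm]

lemma IsSolutionOn.lattice_eq_two (hf : IsSolutionOn τ a b c D f) {r s : Fin M} (hrs : r ≠ s)
    {n : Fin M → ℤ} (h0 : latticePt τ z n ∈ D) (hr : latticePt τ z (n + Pi.single r 1) ∈ D)
    (hs : latticePt τ z (n + Pi.single s 1) ∈ D)
    (hrs' : latticePt τ z (n + Pi.single s 1 + Pi.single r 1) ∈ D) :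
    Complex.exp (latticePt τ z n r) *
      (f (latticePt τ z n) - f (latticePt τ z (n + Pi.single s 1)) -
        b r * (f (latticePt τ z (n + Pi.single r 1)) -
          f (latticePt τ z (n + Pi.single s 1 + Pi.single r 1)))) =
    Complex.exp (latticePt τ z n s) *
      (f (latticePt τ z n) - f (latticePt τ z (n + Pi.single r 1)) -
        b s * (f (latticePt τ z (n + Pi.single s 1)) -
          f (latticePt τ z (n + Pi.single s 1 + Pi.single r 1)))) := by
  have := ((isSolutionOn_iff τ a b c D f).mp hf).2 r s hrs (latticePt τ z n) h0
    (by rwa [shiftPt_latticePt]) (by rwa [shiftPt_latticePt])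
    (by rwa [shiftPt_latticePt, shiftPt_latticePt])
  simpa only [EqTwoAt, shiftPt_latticePt] using this

lemma IsSolutionOn.lattice_eq_one (hf : IsSolutionOn τ a b c D f) {s : Fin M} {n : Fin M → ℤ}
    (h0 : ∀ k ≤ N, latticePt τ z (n + diagPt M k) ∈ D)
    (h1 : ∀ k ≤ N, latticePt τ z (n + diagPt M k + Pi.single s 1) ∈ D) :
    Complex.exp (latticePt τ z n s) * ∑ k ∈ range (N + 1), (oneSubPoly a).coeff k *
      (f (latticePt τ z (n + diagPt M k)) -
        b s * f (latticePt τ z (n + diagPt M k + Pi.single s 1))) =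
    ∑ k ∈ range (N + 1), (oneSubPoly fun j => c j * (Complex.exp τ)⁻¹).coeff k *
      (f (latticePt τ z (n + diagPt M k)) -
        f (latticePt τ z (n + diagPt M k + Pi.single s 1))) := by
  have := ((isSolutionOn_iff τ a b c D f).mp hf).1 s (latticePt τ z n) fun k hk => by
    rw [shiftPt_latticePt, shiftAllPt_latticePt, shiftAllPt_latticePt, add_right_comm]
    exact ⟨h0 k hk, h1 k hk⟩
  simpa only [EqOneAt, shiftPt_latticePt, shiftAllPt_latticePt, add_right_comm n] using this

lemma IsSolutionOn.eq_zero_square_side (hf : IsSolutionOn τ a b c D f) {r s : Fin M} (hrs : r ≠ s)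
    {n : Fin M → ℤ} (h0 : latticePt τ z n ∈ D) (hr : latticePt τ z (n + Pi.single r 1) ∈ D)
    (hs : latticePt τ z (n + Pi.single s 1) ∈ D)
    (hrs' : latticePt τ z (n + Pi.single s 1 + Pi.single r 1) ∈ D)
    (hne : Complex.exp (latticePt τ z n r) * b r ≠ Complex.exp (latticePt τ z n s))
    (e0 : f (latticePt τ z n) = 0) (es : f (latticePt τ z (n + Pi.single s 1)) = 0)
    (ers : f (latticePt τ z (n + Pi.single s 1 + Pi.single r 1)) = 0) :
    f (latticePt τ z (n + Pi.single r 1)) = 0 := by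
  have h := hf.lattice_eq_two hrs h0 hr hs hrs'
  rw [e0, es, ers] at h
  refine (mul_eq_zero.mp ?_).resolve_left (sub_ne_zero.mpr hne)
  linear_combination -h

lemma IsSolutionOn.eq_zero_square_top (hf : IsSolutionOn τ a b c D f) {r s : Fin M} (hrs : r ≠ s)
    {n : Fin M → ℤ} (h0 : latticePt τ z n ∈ D) (hr : latticePt τ z (n + Pi.single r 1) ∈ D)
    (hs : latticePt τ z (n + Pi.single s 1) ∈ D)
    (hrs' : latticePt τ z (n + Pi.single s 1 + Pi.single r 1) ∈ D)
    (hne : Complex.exp (latticePt τ z n r) * b r ≠ Complex.exp (latticePt τ z n s) * b s)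
    (e0 : f (latticePt τ z n) = 0) (er : f (latticePt τ z (n + Pi.single r 1)) = 0)
    (es : f (latticePt τ z (n + Pi.single s 1)) = 0) :
    f (latticePt τ z (n + Pi.single s 1 + Pi.single r 1)) = 0 := by
  have h := hf.lattice_eq_two hrs h0 hr hs hrs'
  rw [e0, es, er] at h
  refine (mul_eq_zero.mp ?_).resolve_left (sub_ne_zero.mpr hne)
  linear_combination h

lemma IsSolutionOn.eq_zero_rect_top (hf : IsSolutionOn τ a b c D f) {s : Fin M} {n : Fin M → ℤ}
    (h0 : ∀ k ≤ N, latticePt τ z (n + diagPt M k) ∈ D)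
    (h1 : ∀ k ≤ N, latticePt τ z (n + diagPt M k + Pi.single s 1) ∈ D)
    (hne : Complex.exp (latticePt τ z n s) * b s * ∏ j, (-a j) ≠
      ∏ j, (-(c j * (Complex.exp τ)⁻¹)))
    (e0 : ∀ k ≤ N, f (latticePt τ z (n + diagPt M k)) = 0)
    (e1 : ∀ k < N, f (latticePt τ z (n + diagPt M k + Pi.single s 1)) = 0) :
    f (latticePt τ z (n + diagPt M N + Pi.single s 1)) = 0 := by
  have h := hf.lattice_eq_one h0 h1
  have hzero (y : ℂ) : ∀ k ∈ range N, f (latticePt τ z (n + diagPt M k)) -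
      y * f (latticePt τ z (n + diagPt M k + Pi.single s 1)) = 0 := fun k hk => by
    rw [e0 k (mem_range.mp hk).le, e1 k (mem_range.mp hk), mul_zero, sub_zero]
  have hzero_one := hzero 1
  simp only [one_mul] at hzero_one
  rw [sum_range_succ, sum_range_succ, sum_eq_zero fun k hk => by rw [hzero _ k hk, mul_zero],
    sum_eq_zero fun k hk => by rw [hzero_one k hk, mul_zero], e0 N le_rfl,
    coeff_top_oneSubPoly, coeff_top_oneSubPoly] at h
  refine (mul_eq_zero.mp ?_).resolve_left (sub_ne_zero.mpr hne)
  linear_combination -h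

lemma IsSolutionOn.eq_zero_rect_bot (hf : IsSolutionOn τ a b c D f) {s : Fin M} {n : Fin M → ℤ}
    (h0 : ∀ k ≤ N, latticePt τ z (n + diagPt M k) ∈ D)
    (h1 : ∀ k ≤ N, latticePt τ z (n + diagPt M k + Pi.single s 1) ∈ D)
    (hne : Complex.exp (latticePt τ z n s) ≠ 1)
    (e0 : ∀ k, 1 ≤ k → k ≤ N → f (latticePt τ z (n + diagPt M k)) = 0)
    (e1 : ∀ k ≤ N, f (latticePt τ z (n + diagPt M k + Pi.single s 1)) = 0) :
    f (latticePt τ z n) = 0 := by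
  have h := hf.lattice_eq_one h0 h1
  have hzero (y : ℂ) : ∀ k ∈ range N, f (latticePt τ z (n + diagPt M (k + 1))) -
      y * f (latticePt τ z (n + diagPt M (k + 1) + Pi.single s 1)) = 0 := fun k hk => by
    have hk := mem_range.mp hk
    rw [e0 (k + 1) (by lia) hk, e1 (k + 1) hk, mul_zero, sub_zero]
  have hzero_one := hzero 1
  simp only [one_mul] at hzero_one
  rw [sum_range_succ', sum_range_succ',
    sum_eq_zero fun k hk => by rw [hzero _ k hk, mul_zero],
    sum_eq_zero fun k hk => by rw [hzero_one k hk, mul_zero],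
    e1 0 (Nat.zero_le _), coeff_zero_oneSubPoly, coeff_zero_oneSubPoly, diagPt_zero, add_zero] at h
  refine (mul_eq_zero.mp ?_).resolve_left (sub_ne_zero.mpr hne)
  linear_combination h

/-- The point `w` avoids the zeros of the coefficients by which the propagation of zeros divides:
one field for each field of `ZeroRules`. -/
structure GenericAt (τ : ℂ) (a : Fin N → ℂ) (b : Fin M → ℂ) (c : Fin N → ℂ)
    (w : Fin M → ℂ) : Prop where
  ne_top : ∀ r s, r ≠ s → Complex.exp (w r) * b r ≠ Complex.exp (w s) * b s
  ne_side : ∀ r s, r ≠ s → Complex.exp (w r) * b r ≠ Complex.exp (w s)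
  ne_rect_top : ∀ s, Complex.exp (w s) * b s * ∏ j, (-a j) ≠ ∏ j, (-(c j * (Complex.exp τ)⁻¹))
  ne_rect_bot : ∀ s, Complex.exp (w s) ≠ 1

lemma IsSolutionOn.zeroRules (hf : IsSolutionOn τ a b c D f) {n : Fin M → ℤ}
    (hD : ∀ p, (∀ i, n i ≤ p i ∧ p i ≤ n i + (N + 2)) → latticePt τ z p ∈ D)
    (hgen : GenericAt τ a b c (latticePt τ z n)) :
    ZeroRules N (fun p => f (latticePt τ z p)) n := by
  have h0 : latticePt τ z n ∈ D := hD _ fun i => by lia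
  have h1 (r) : latticePt τ z (n + Pi.single r 1) ∈ D := hD _ fun i => by
    have := single_one_bounds r i
    simp only [Pi.add_apply]
    lia
  have h2 (r s) : latticePt τ z (n + Pi.single r 1 + Pi.single s 1) ∈ D := hD _ fun i => by
    have := single_one_bounds r i
    have := single_one_bounds s i
    simp only [Pi.add_apply]
    lia
  have hdiag : ∀ k ≤ N, latticePt τ z (n + diagPt M k) ∈ D := fun k hk => hD _ fun i => by
    simp only [Pi.add_apply, diagPt]
    lia
  have hdiag' (s) : ∀ k ≤ N, latticePt τ z (n + diagPt M k + Pi.single s 1) ∈ D :=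
    fun k hk => hD _ fun i => by
      have := single_one_bounds s i
      simp only [Pi.add_apply, diagPt]
      lia
  exact
    { square_top := fun r s hrs e0 er es =>
        hf.eq_zero_square_top hrs.symm h0 (h1 s) (h1 r) (h2 r s) (hgen.ne_top s r hrs.symm) e0 es er
      square_side := fun r s hrs e0 es ers =>
        hf.eq_zero_square_side hrs h0 (h1 r) (h1 s) (h2 s r) (hgen.ne_side r s hrs) e0 es ers
      rect_top := fun s e0 e1 => hf.eq_zero_rect_top hdiag (hdiag' s) (hgen.ne_rect_top s) e0 e1
      rect_bot := fun s e0 e1 => hf.eq_zero_rect_bot hdiag (hdiag' s) (hgen.ne_rect_bot s) e0 e1 }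

end Orbit

/-! ### The region in homogeneous lattice coordinates -/

section Homogeneous

variable {M : ℕ}

/-- Dehomogenization of lattice points with respect to the coordinate `p`. The `M + 1` homogeneous
coordinates give all inequalities that define the region on an orbit the same shape. -/
def dehom (p : Fin (M + 1)) : (Fin (M + 1) → ℤ) →+ (Fin M → ℤ) where
  toFun H i := H (p.succAbove i) - H p
  map_zero' := by
    ext
    simp
  map_add' H H' := by
    ext
    simp only [Pi.add_apply]
    ring

lemma dehom_apply (p : Fin (M + 1)) (H : Fin (M + 1) → ℤ) (i : Fin M) :
    dehom p H i = H (p.succAbove i) - H p := rfl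

lemma dehom_insertNth (p : Fin (M + 1)) (x : ℤ) (n : Fin M → ℤ) :
    dehom p (p.insertNth x fun i => n i + x) = n := by
  ext i
  simp [dehom_apply]

lemma dehom_sub_const (p : Fin (M + 1)) (H : Fin (M + 1) → ℤ) (x : ℤ) :
    dehom p (fun y => H y - x) = dehom p H := by
  ext i
  simp [dehom_apply]

lemma dehom_single_succAbove (p : Fin (M + 1)) (i : Fin M) (x : ℤ) :
    dehom p (Pi.single (p.succAbove i) x) = Pi.single i x := by
  ext j
  simp [dehom_apply, Pi.single_apply, (Fin.succAbove_ne p i).symm]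

lemma dehom_single_self (p : Fin (M + 1)) (w : ℕ) :
    dehom p (Pi.single p (w : ℤ)) = -diagPt M w := by
  ext j
  simp [dehom_apply, diagPt, Fin.succAbove_ne]

lemma dehom_movePt_succAbove (p : Fin (M + 1)) (H : Fin (M + 1) → ℤ) (i j : Fin M) (u w : ℕ) :
    dehom p (movePt H (p.succAbove i) (p.succAbove j) u w) =
      dehom p H + Pi.single i (u : ℤ) - Pi.single j (w : ℤ) := by
  simp only [movePt, map_add, map_sub, dehom_single_succAbove]

lemma dehom_movePt_self_right (p : Fin (M + 1)) (H : Fin (M + 1) → ℤ) (i : Fin M) (u w : ℕ) :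
    dehom p (movePt H (p.succAbove i) p u w) = dehom p H + Pi.single i (u : ℤ) + diagPt M w := by
  simp only [movePt, map_add, map_sub, dehom_single_succAbove, dehom_single_self, sub_neg_eq_add]

lemma dehom_movePt_self_left (p : Fin (M + 1)) (H : Fin (M + 1) → ℤ) (j : Fin M) (u w : ℕ) :
    dehom p (movePt H p (p.succAbove j) u w) = dehom p H - diagPt M u - Pi.single j (w : ℤ) := by
  simp only [movePt, map_add, map_sub, dehom_single_succAbove, dehom_single_self, ← sub_eq_add_neg]

lemma forall_lt_iff_succAbove (p : Fin (M + 1)) (Q : Fin (M + 1) → Fin (M + 1) → Prop) :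
    (∀ a b, a < b → Q a b) ↔ (∀ i, p.succAbove i < p → Q (p.succAbove i) p) ∧
      (∀ i, p < p.succAbove i → Q p (p.succAbove i)) ∧
      ∀ i j, i < j → Q (p.succAbove i) (p.succAbove j) := by
  constructor
  · exact fun h => ⟨fun i => h _ _, fun i => h _ _, fun i j hij =>
      h _ _ (Fin.succAbove_lt_succAbove_iff.mpr hij)⟩
  · rintro ⟨hright, hleft, hpair⟩ a b hab
    rcases Fin.eq_self_or_eq_succAbove p a with rfl | ⟨i, rfl⟩
    · rcases Fin.eq_self_or_eq_succAbove a b with rfl | ⟨j, rfl⟩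
      · exact absurd hab (lt_irrefl _)
      · exact hleft j hab
    · rcases Fin.eq_self_or_eq_succAbove p b with rfl | ⟨j, rfl⟩
      · exact hright i hab
      · exact hpair i j (Fin.succAbove_lt_succAbove_iff.mp hab)

lemma succAbove_mk_lt_iff {L : ℕ} (hL : L < M + 1) (i : Fin M) :
    (⟨L, hL⟩ : Fin (M + 1)).succAbove i < ⟨L, hL⟩ ↔ (i : ℕ) < L := by
  rw [Fin.succAbove_lt_iff_castSucc_lt]
  rfl

lemma lt_succAbove_mk_iff {L : ℕ} (hL : L < M + 1) (i : Fin M) :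
    (⟨L, hL⟩ : Fin (M + 1)) < (⟨L, hL⟩ : Fin (M + 1)).succAbove i ↔ L ≤ (i : ℕ) := by
  rw [Fin.lt_succAbove_iff_le_castSucc]
  rfl

lemma exists_dehom_eq_of_near (p : Fin (M + 1)) {H : Fin (M + 1) → ℤ} {κ : ℤ} (B : ℕ)
    (hH : ∀ x y, x < y → κ + B ≤ H x - H y) {n : Fin M → ℤ}
    (hn : ∀ i, dehom p H i ≤ n i ∧ n i ≤ dehom p H i + B) :
    ∃ H', dehom p H' = n ∧ ∀ x y, x < y → κ ≤ H' x - H' y := by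
  refine ⟨p.insertNth (H p) fun i => n i + H p, dehom_insertNth p _ n, ?_⟩
  rw [forall_lt_iff_succAbove p] at hH ⊢
  simp only [Fin.insertNth_apply_succAbove, Fin.insertNth_apply_same]
  simp only [dehom_apply] at hn
  refine ⟨fun i hi => ?_, fun i hi => ?_, fun i j hij => ?_⟩
  · have := hH.1 i hi
    have := hn i
    lia
  · have := hH.2.1 i hi
    have := hn i
    lia
  · have := hH.2.2 i j hij
    have := hn i
    have := hn j
    lia

lemma exists_norm_mul_zpow_lt_one_iff {q x : ℂ} (hx : x ≠ 0) (hq0 : q ≠ 0) (hq1 : ‖q‖ < 1) :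
    ∃ d : ℤ, ∀ k : ℤ, ‖x * q ^ k‖ < 1 ↔ d ≤ k := by
  refine ⟨⌊Real.log ‖x‖ / -Real.log ‖q‖⌋ + 1, fun k => ?_⟩
  have hx := norm_pos_iff.mpr hx
  have hq0 := norm_pos_iff.mpr hq0
  have hlog : 0 < -Real.log ‖q‖ := neg_pos.mpr (Real.log_neg hq0 hq1)
  rw [Int.add_one_le_iff, Int.floor_lt, div_lt_iff₀ hlog, norm_mul, norm_zpow,
    ← Real.log_neg_iff (by positivity), Real.log_mul hx.ne' (by positivity), Real.log_zpow]
  constructor <;> intro h <;> linarith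

variable {N : ℕ} {q τ : ℂ} {a : Fin N → ℂ} {b : Fin M → ℂ} {c : Fin N → ℂ} {L : ℕ}

/-- The coefficients of the inequalities that define the region: the one for `x < y` says that
`homCoeff q a b c p t x y` has norm less than `1`, where `p` marks the position of the cut `L`. -/
noncomputable def homCoeff (q : ℂ) (a : Fin N → ℂ) (b : Fin M → ℂ) (c : Fin N → ℂ)
    (p : Fin (M + 1)) (t : Fin M → ℂ) (x y : Fin (M + 1)) : ℂ :=
  (p.insertNth (∏ j, c j / a j) t : Fin (M + 1) → ℂ) x *
    (p.insertNth 1 fun i => q / (b i * t i) : Fin (M + 1) → ℂ) y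

lemma mem_region_latticePt_dehom_iff (hL : L < M + 1) (z : Fin M → ℂ) (H : Fin (M + 1) → ℤ) :
    latticePt τ z (dehom ⟨L, hL⟩ H) ∈ region (Complex.exp τ) a b c L 1 ↔
      ∀ x y, x < y → ‖homCoeff (Complex.exp τ) a b c ⟨L, hL⟩ (fun i => Complex.exp (z i)) x y *
        Complex.exp τ ^ (H x - H y)‖ < 1 := by
  have hq := Complex.exp_ne_zero τ
  rw [forall_lt_iff_succAbove ⟨L, hL⟩]
  simp only [succAbove_mk_lt_iff, lt_succAbove_mk_iff, homCoeff, Fin.insertNth_apply_succAbove,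
    Fin.insertNth_apply_same, region, Set.mem_ofPred_eq, Equiv.Perm.coe_one, id, exp_latticePt,
    dehom_apply]
  refine and_congr (forall₂_congr fun i _ => ?_)
    (and_congr (forall₂_congr fun i _ => ?_) (forall₃_congr fun i j _ => ?_))
  · rw [mul_one]
  · rw [← neg_sub (H (Fin.succAbove _ i)) (H ⟨L, hL⟩), zpow_neg]
    congr! 2
    ring
  · have hcancel : Complex.exp τ ^ (H (Fin.succAbove ⟨L, hL⟩ i) - H (Fin.succAbove ⟨L, hL⟩ j)) =
        Complex.exp τ ^ (H (Fin.succAbove ⟨L, hL⟩ i) - H ⟨L, hL⟩) /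
          Complex.exp τ ^ (H (Fin.succAbove ⟨L, hL⟩ j) - H ⟨L, hL⟩) := by
      rw [← zpow_sub₀ hq, sub_sub_sub_cancel_right]
    rw [hcancel]
    congr! 2
    ring

namespace Admissible

lemma homCoeff_ne_zero (h : Admissible q a b c) (p : Fin (M + 1)) {t : Fin M → ℂ}
    (ht : ∀ i, t i ≠ 0) (x y : Fin (M + 1)) : homCoeff q a b c p t x y ≠ 0 := by
  refine mul_ne_zero ?_ ?_
  · revert x
    simpa only [Fin.forall_iff_succAbove p, Fin.insertNth_apply_succAbove,
      Fin.insertNth_apply_same] using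
      ⟨prod_ne_zero_iff.mpr fun j _ => div_ne_zero (h.c_ne j) (h.a_ne j), ht⟩
  · revert y
    simpa only [Fin.forall_iff_succAbove p, Fin.insertNth_apply_succAbove,
      Fin.insertNth_apply_same] using
      ⟨one_ne_zero, fun i => div_ne_zero h.q_ne (mul_ne_zero (h.b_ne i) (ht i))⟩

lemma exists_mem_region_iff_mem_polyhedron (h : Admissible (Complex.exp τ) a b c)
    (hL : L < M + 1) (z : Fin M → ℂ) :
    ∃ D : Fin (M + 1) → Fin (M + 1) → ℤ, ∀ H,
      latticePt τ z (dehom ⟨L, hL⟩ H) ∈ region (Complex.exp τ) a b c L 1 ↔ H ∈ polyhedron D := by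
  choose D hD using fun x y => exists_norm_mul_zpow_lt_one_iff
    (h.homCoeff_ne_zero ⟨L, hL⟩ (fun i => Complex.exp_ne_zero (z i)) x y) h.q_ne h.q_lt
  refine ⟨D, fun H => ?_⟩
  simp only [mem_region_latticePt_dehom_iff, hD]
  rfl

lemma eventually_mul_zpow_ne_one (h : Admissible q a b c) (x : ℂ) :
    ∀ᶠ K : ℕ in atTop, ∀ k : ℤ, (K : ℤ) ≤ |k| → x * q ^ k ≠ 1 := by
  by_cases! hx : ∀ k : ℤ, x * q ^ k ≠ 1
  · exact .of_forall fun _ k _ => hx k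
  obtain ⟨k₀, hk₀⟩ := hx
  filter_upwards [eventually_gt_atTop k₀.natAbs] with K hK k hk hk1
  have hne : k - k₀ ≠ 0 := by
    rintro hkk
    rw [sub_eq_zero.mp hkk, Int.abs_eq_natAbs] at hk
    lia
  refine h.zpow_ne_one hne ?_
  rw [zpow_sub₀ h.q_ne, div_eq_one_iff_eq (zpow_ne_zero _ h.q_ne)]
  exact mul_left_cancel₀ (left_ne_zero_of_mul_eq_one hk₀) (hk1.trans hk₀.symm)

end Admissible

lemma genericAt_latticePt (hb : ∀ i, b i ≠ 0) (hc : ∀ j, c j ≠ 0) {z : Fin M → ℂ}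
    {n : Fin M → ℤ}
    (htop : ∀ r s, r ≠ s →
      Complex.exp (z r) * b r / (Complex.exp (z s) * b s) * Complex.exp τ ^ (n r - n s) ≠ 1)
    (hside : ∀ r s, r ≠ s →
      Complex.exp (z r) * b r / Complex.exp (z s) * Complex.exp τ ^ (n r - n s) ≠ 1)
    (hrect_top : ∀ s, Complex.exp (z s) * b s * (∏ j, (-a j)) /
      (∏ j, (-(c j * (Complex.exp τ)⁻¹))) * Complex.exp τ ^ n s ≠ 1)
    (hrect_bot : ∀ s, Complex.exp (z s) * Complex.exp τ ^ n s ≠ 1) :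
    GenericAt τ a b c (latticePt τ z n) := by
  have hq := Complex.exp_ne_zero τ
  have hz (s) := Complex.exp_ne_zero (z s)
  have hqn (s) := zpow_ne_zero (n s) hq
  have hC : ∏ j, (-(c j * (Complex.exp τ)⁻¹)) ≠ 0 := prod_ne_zero_iff.mpr fun j _ =>
    neg_ne_zero.mpr (mul_ne_zero (hc j) (inv_ne_zero hq))
  constructor
  · intro r s hrs heq
    refine htop r s hrs ?_
    simp only [exp_latticePt] at heq
    rw [zpow_sub₀ hq, div_mul_div_comm,
      div_eq_one_iff_eq (mul_ne_zero (mul_ne_zero (hz s) (hb s)) (hqn s))]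
    linear_combination heq
  · intro r s hrs heq
    refine hside r s hrs ?_
    simp only [exp_latticePt] at heq
    rw [zpow_sub₀ hq, div_mul_div_comm, div_eq_one_iff_eq (mul_ne_zero (hz s) (hqn s))]
    linear_combination heq
  · intro s heq
    refine hrect_top s ?_
    rw [exp_latticePt] at heq
    rw [div_mul_eq_mul_div, div_eq_one_iff_eq hC]
    linear_combination heq
  · intro s heq
    exact hrect_bot s (by rwa [exp_latticePt] at heq)

lemma Admissible.eventually_genericAt (h : Admissible (Complex.exp τ) a b c) (p : Fin (M + 1))
    (z : Fin M → ℂ) :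
    ∀ᶠ K : ℕ in atTop, ∀ H : Fin (M + 1) → ℤ, (∀ x y, x < y → (K : ℤ) ≤ H x - H y) →
      GenericAt τ a b c (latticePt τ z (dehom p H)) := by
  have htop := eventually_all.mpr fun r => eventually_all.mpr fun s =>
    h.eventually_mul_zpow_ne_one (Complex.exp (z r) * b r / (Complex.exp (z s) * b s))
  have hside := eventually_all.mpr fun r => eventually_all.mpr fun s =>
    h.eventually_mul_zpow_ne_one (Complex.exp (z r) * b r / Complex.exp (z s))
  have hrect_top := eventually_all.mpr fun s => h.eventually_mul_zpow_ne_one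
    (Complex.exp (z s) * b s * (∏ j, (-a j)) / ∏ j, (-(c j * (Complex.exp τ)⁻¹)))
  have hrect_bot := eventually_all.mpr fun s => h.eventually_mul_zpow_ne_one (Complex.exp (z s))
  filter_upwards [htop, hside, hrect_top, hrect_bot] with K htop hside hrect_top hrect_bot H hH
  have habs {x y} (hxy : x ≠ y) : (K : ℤ) ≤ |H x - H y| := by
    rcases lt_or_gt_of_ne hxy with hlt | hlt
    · exact (hH x y hlt).trans (le_abs_self _)
    · rw [abs_sub_comm]
      exact (hH y x hlt).trans (le_abs_self _)
  have hpair {r s} (hrs : r ≠ s) : (K : ℤ) ≤ |dehom p H r - dehom p H s| := by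
    simpa only [dehom_apply, sub_sub_sub_cancel_right] using
      habs (p.succAbove_right_injective.ne hrs)
  have hone (s) : (K : ℤ) ≤ |dehom p H s| := habs (Fin.succAbove_ne p s)
  exact genericAt_latticePt h.b_ne h.c_ne (fun r s hrs => htop r s _ (hpair hrs))
    (fun r s hrs => hside r s _ (hpair hrs)) (fun s => hrect_top s _ (hone s))
    fun s => hrect_bot s _ (hone s)

end Homogeneous

section Uniqueness

variable {N M : ℕ} {τ : ℂ} {a : Fin N → ℂ} {b : Fin M → ℂ} {c : Fin N → ℂ} {L : ℕ}
  {f : (Fin M → ℂ) → ℂ} {z : Fin M → ℂ} {n : Fin M → ℤ}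

lemma exp_latticePt_add (z : Fin M → ℂ) (n n' : Fin M → ℤ) (i : Fin M) :
    Complex.exp (latticePt τ z (n + n') i) =
      Complex.exp (latticePt τ z n i) * Complex.exp τ ^ n' i := by
  rw [← latticePt_latticePt, exp_latticePt]

lemma Admissible.mul_prod_neg_ne_of_norm_lt_one {q : ℂ} (h : Admissible q a b c) {j : Fin M} {t : ℂ}
    (ht : t ≠ 0) (hlt : ‖(∏ k, c k / a k) * (q / (b j * t))‖ < 1) :
    t * (q ^ N)⁻¹ * q⁻¹ * b j * ∏ k, (-a k) ≠ ∏ k, (-(c k * q⁻¹)) := by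
  intro heq
  have hneg_a : ∏ k, (-a k) ≠ 0 := prod_ne_zero_iff.mpr fun k _ => neg_ne_zero.mpr (h.a_ne k)
  have hneg_c : ∏ k, (-(c k * q⁻¹)) = (∏ k, (-a k)) * (∏ k, c k / a k) * (q ^ N)⁻¹ := by
    have hpow : (q ^ N)⁻¹ = ∏ _k : Fin N, q⁻¹ := by
      rw [prod_const, card_univ, Fintype.card_fin, inv_pow]
    rw [hpow, ← prod_mul_distrib, ← prod_mul_distrib]
    refine prod_congr rfl fun k _ => ?_
    rw [neg_mul, mul_div_cancel₀ _ (h.a_ne k), neg_mul]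
  have hprod : ∏ k, c k / a k = t * q⁻¹ * b j := by
    refine mul_right_cancel₀ (mul_ne_zero hneg_a (inv_ne_zero (pow_ne_zero N h.q_ne))) ?_
    linear_combination -heq + -hneg_c
  have hq := h.q_ne
  have hb := h.b_ne j
  rw [hprod, show t * q⁻¹ * b j * (q / (b j * t)) = 1 by field_simp, norm_one] at hlt
  exact lt_irrefl _ hlt

lemma IsSolutionOn.eq_zero_corner_side (h : Admissible (Complex.exp τ) a b c)
    (hf : IsSolutionOn τ a b c (region (Complex.exp τ) a b c L 1) f) {i j : Fin M} (hij : i < j)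
    (hD : ∀ u : ℕ, u ≤ 1 → ∀ w : ℕ, w ≤ 1 →
      latticePt τ z (n + Pi.single i (u : ℤ) - Pi.single j (w : ℤ)) ∈
        region (Complex.exp τ) a b c L 1)
    (hz : ∀ u : ℕ, u ≤ 1 → ∀ w : ℕ, w ≤ 1 → u ≠ 0 ∨ w ≠ 0 →
      f (latticePt τ z (n + Pi.single i (u : ℤ) - Pi.single j (w : ℤ))) = 0) :
    f (latticePt τ z n) = 0 := by
  have hD00 := hD 0 zero_le_one 0 zero_le_one
  have hD01 := hD 0 zero_le_one 1 le_rfl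
  have hD10 := hD 1 le_rfl 0 zero_le_one
  have hD11 := hD 1 le_rfl 1 le_rfl
  have hz01 := hz 0 zero_le_one 1 le_rfl (by simp)
  have hz10 := hz 1 le_rfl 0 zero_le_one (by simp)
  have hz11 := hz 1 le_rfl 1 le_rfl (by simp)
  simp only [Nat.cast_zero, Nat.cast_one, Pi.single_zero, add_zero, sub_zero,
    add_sub_right_comm n] at hD00 hD01 hD10 hD11 hz01 hz10 hz11
  have hstep : n - Pi.single j 1 + Pi.single i 1 + Pi.single j 1 = n + Pi.single i 1 := by abel
  rw [← sub_add_cancel n (Pi.single j 1)]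
  refine hf.eq_zero_square_side hij.ne' hD01 (by rwa [sub_add_cancel]) hD11 (by rwa [hstep]) ?_
    hz01 hz11 (by rwa [hstep])
  intro heq
  have hratio := (mem_region_one_iff.mp hD00).ratio i j hij
  rw [sub_eq_add_neg, exp_latticePt_add, exp_latticePt_add, Pi.neg_apply, Pi.neg_apply,
    Pi.single_eq_same, Pi.single_eq_of_ne hij.ne, neg_zero, zpow_zero, mul_one, zpow_neg_one] at heq
  have hq := h.q_ne
  have hb := h.b_ne j
  have hzj := Complex.exp_ne_zero (latticePt τ z n j)
  have hone : Complex.exp τ * Complex.exp (latticePt τ z n i) /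
      (b j * Complex.exp (latticePt τ z n j)) = 1 := by
    rw [← heq]
    field_simp
  rw [hone, norm_one] at hratio
  exact lt_irrefl _ hratio

lemma IsSolutionOn.eq_zero_corner_bot (hN : 1 ≤ N)
    (hf : IsSolutionOn τ a b c (region (Complex.exp τ) a b c L 1) f) {i : Fin M} (hi : (i : ℕ) < L)
    (hD : ∀ u ≤ N, ∀ w ≤ N, latticePt τ z (n + Pi.single i (u : ℤ) + diagPt M w) ∈
      region (Complex.exp τ) a b c L 1)
    (hz : ∀ u ≤ N, ∀ w ≤ N, u ≠ 0 ∨ w ≠ 0 →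
      f (latticePt τ z (n + Pi.single i (u : ℤ) + diagPt M w)) = 0) :
    f (latticePt τ z n) = 0 := by
  have hD0 := hD 0 N.zero_le
  have hD1 := hD 1 hN
  have hz0 := hz 0 N.zero_le
  have hz1 := hz 1 hN
  simp only [Nat.cast_zero, Nat.cast_one, Pi.single_zero, add_zero,
    add_right_comm n (Pi.single i 1)] at hD0 hD1 hz0 hz1
  refine hf.eq_zero_rect_bot hD0 hD1 (fun heq => ?_) (fun k hk0 hk => hz0 k hk (.inr (by lia)))
    fun k hk => hz1 k hk (.inl one_ne_zero)
  have hsmall := (mem_region_one_iff.mp (hD0 0 N.zero_le)).small i hi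
  rw [diagPt_zero, add_zero, heq, norm_one] at hsmall
  exact lt_irrefl _ hsmall

lemma IsSolutionOn.eq_zero_corner_top (h : Admissible (Complex.exp τ) a b c) (hN : 1 ≤ N)
    (hf : IsSolutionOn τ a b c (region (Complex.exp τ) a b c L 1) f) {j : Fin M} (hj : L ≤ (j : ℕ))
    (hD : ∀ u ≤ N, ∀ w ≤ N, latticePt τ z (n - diagPt M u - Pi.single j (w : ℤ)) ∈
      region (Complex.exp τ) a b c L 1)
    (hz : ∀ u ≤ N, ∀ w ≤ N, u ≠ 0 ∨ w ≠ 0 →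
      f (latticePt τ z (n - diagPt M u - Pi.single j (w : ℤ))) = 0) :
    f (latticePt τ z n) = 0 := by
  -- The rectangle with top corner `n` starts at `n - (N, …, N) - e_j`.
  have hsub {k : ℕ} (hk : k ≤ N) : n - diagPt M N - Pi.single j 1 + diagPt M k =
      n - diagPt M (N - k) - Pi.single j ((1 : ℕ) : ℤ) := by
    ext i
    simp only [diagPt, Pi.add_apply, Pi.sub_apply, Nat.cast_one, Nat.cast_sub hk]
    ring
  have hsub' {k : ℕ} (hk : k ≤ N) : n - diagPt M N - Pi.single j 1 + diagPt M k + Pi.single j 1 =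
      n - diagPt M (N - k) - Pi.single j ((0 : ℕ) : ℤ) := by
    rw [hsub hk, Nat.cast_one, sub_add_cancel, Nat.cast_zero, Pi.single_zero, sub_zero]
  have htop := hsub' le_rfl
  rw [Nat.sub_self, diagPt_zero, sub_zero, Nat.cast_zero, Pi.single_zero, sub_zero] at htop
  rw [← htop]
  refine hf.eq_zero_rect_top (fun k hk => hsub hk ▸ hD _ (N.sub_le k) 1 hN)
    (fun k hk => hsub' hk ▸ hD _ (N.sub_le k) 0 N.zero_le) ?_
    (fun k hk => hsub hk ▸ hz _ (N.sub_le k) 1 hN (.inr one_ne_zero))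
    (fun k hk => hsub' hk.le ▸ hz _ (N.sub_le k) 0 N.zero_le (.inl (by lia)))
  have hlarge := (mem_region_one_iff.mp (hD 0 N.zero_le 0 N.zero_le)).large j hj
  rw [Nat.cast_zero, Pi.single_zero, sub_zero, diagPt_zero, sub_zero] at hlarge
  rw [sub_eq_add_neg, sub_eq_add_neg, exp_latticePt_add, exp_latticePt_add, Pi.neg_apply,
    Pi.neg_apply, Pi.single_eq_same, diagPt, zpow_neg, zpow_natCast, zpow_neg_one]
  exact h.mul_prod_neg_ne_of_norm_lt_one (Complex.exp_ne_zero _) hlarge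

lemma IsSolutionOn.eq_zero_corner (h : Admissible (Complex.exp τ) a b c) (hN : 1 ≤ N)
    (hL : L < M + 1) (hf : IsSolutionOn τ a b c (region (Complex.exp τ) a b c L 1) f)
    {x y : Fin (M + 1)} (hxy : x < y) {P : Fin (M + 1) → ℤ}
    (hD : ∀ u ≤ N, ∀ w ≤ N, latticePt τ z (dehom ⟨L, hL⟩ (movePt P x y u w)) ∈
      region (Complex.exp τ) a b c L 1)
    (hz : ∀ u ≤ N, ∀ w ≤ N, u ≠ 0 ∨ w ≠ 0 →
      f (latticePt τ z (dehom ⟨L, hL⟩ (movePt P x y u w))) = 0) :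
    f (latticePt τ z (dehom ⟨L, hL⟩ P)) = 0 := by
  revert x y
  rw [forall_lt_iff_succAbove ⟨L, hL⟩]
  refine ⟨fun i hi hD hz => ?_, fun j hj hD hz => ?_, fun i j hij hD hz => ?_⟩
  · exact hf.eq_zero_corner_bot hN ((succAbove_mk_lt_iff hL i).mp hi)
      (fun u hu w hw => dehom_movePt_self_right _ P i u w ▸ hD u hu w hw)
      fun u hu w hw huw => dehom_movePt_self_right _ P i u w ▸ hz u hu w hw huw
  · exact hf.eq_zero_corner_top h hN ((lt_succAbove_mk_iff hL j).mp hj)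
      (fun u hu w hw => dehom_movePt_self_left _ P j u w ▸ hD u hu w hw)
      fun u hu w hw huw => dehom_movePt_self_left _ P j u w ▸ hz u hu w hw huw
  · exact hf.eq_zero_corner_side h hij
      (fun u hu w hw => dehom_movePt_succAbove _ P i j u w ▸ hD u (hu.trans hN) w (hw.trans hN))
      fun u hu w hw huw =>
        dehom_movePt_succAbove _ P i j u w ▸ hz u (hu.trans hN) w (hw.trans hN) huw

/-- Lower bounds that are at least `κ` and superadditive with defect `N`, as propagation of zeros
from `polyhedron (deepBounds m κ N)` requires. -/
def deepBounds (m κ N : ℕ) (x y : Fin m) : ℤ := ((y : ℤ) - x) * (κ + N) - N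

lemma le_deepBounds {m : ℕ} (κ N : ℕ) {x y : Fin m} (hxy : x < y) : κ ≤ deepBounds m κ N x y := by
  have := Fin.lt_def.mp hxy
  have := mul_le_mul_of_nonneg_right (show (1 : ℤ) ≤ (y : ℤ) - x by lia)
    (show (0 : ℤ) ≤ κ + N by positivity)
  rw [deepBounds]
  lia

lemma deepBounds_add_add {m : ℕ} (κ N : ℕ) (x y w : Fin m) :
    deepBounds m κ N x y + deepBounds m κ N y w + N = deepBounds m κ N x w := by
  simp only [deepBounds]
  ring

lemma neg_mul_mem_polyhedron_deepBounds (m κ N : ℕ) :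
    (fun x : Fin m => -((κ + N : ℤ) * x)) ∈ polyhedron (deepBounds m κ N) := fun x y _ => by
  rw [deepBounds]
  linarith

lemma eq_zero_dehom_of_initZero (p : Fin (M + 1)) {R : Fin (M + 1) → Fin (M + 1) → ℤ}
    {F : (Fin M → ℤ) → ℂ} (hnear : ∀ H ∈ polyhedron R, RulesNear N F (N + 3) (dehom p H))
    {H₀ H : Fin (M + 1) → ℤ} (hH₀ : H₀ ∈ polyhedron R) (hinit : InitZero N F (dehom p H₀))
    (hH : H ∈ polyhedron R) : F (dehom p H) = 0 := by
  have hshift : (fun x => H x - (H p - H₀ p)) ∈ polyhedron R := fun x y hxy => by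
    simpa only [sub_sub_sub_cancel_right] using hH x y hxy
  have hiff := iff_of_mem_polyhedron p (Y := fun H => InitZero N F (dehom p H))
    (fun r hr P hP _ => by
      obtain ⟨i, rfl⟩ := Fin.exists_succAbove_eq hr
      rw [map_add, dehom_single_succAbove]
      exact initZero_add_single_iff (hnear P hP) i) hH₀ hshift (sub_sub_cancel _ _).symm
  rw [← dehom_sub_const p H (H p - H₀ p)]
  exact (hiff.mp hinit).1

lemma IsSolutionOn.rulesNear {D : Set (Fin M → ℂ)} (hf : IsSolutionOn τ a b c D f)
    (hn : ∀ n', (∀ i, n i ≤ n' i ∧ n' i ≤ n i + (2 * N + 5 : ℕ)) →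
      latticePt τ z n' ∈ D ∧ GenericAt τ a b c (latticePt τ z n')) :
    RulesNear N (fun n => f (latticePt τ z n)) (N + 3) n := fun p hp =>
  hf.zeroRules (fun p' hp' => (hn p' fun i => by have := hp i; have := hp' i; lia).1)
    (hn p fun i => by have := hp i; lia).2

lemma Admissible.exists_mem_region_and_genericAt (h : Admissible (Complex.exp τ) a b c)
    (p : Fin (M + 1)) (z : Fin M → ℂ) (D : Fin (M + 1) → Fin (M + 1) → ℤ) (B : ℕ) :
    ∃ κ : ℕ, (∀ x y, D x y ≤ κ) ∧ ∀ H : Fin (M + 1) → ℤ, (∀ x y, x < y → κ ≤ H x - H y) →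
      ∀ n, (∀ i, dehom p H i ≤ n i ∧ n i ≤ dehom p H i + B) →
        (∃ H' ∈ polyhedron D, dehom p H' = n) ∧ GenericAt τ a b c (latticePt τ z n) := by
  have hD : ∀ᶠ κ : ℕ in atTop, ∀ x y, D x y ≤ κ := eventually_all.mpr fun x =>
    eventually_all.mpr fun y => (eventually_ge_atTop (D x y).toNat).mono fun κ hκ =>
      Int.toNat_le.mp hκ
  obtain ⟨κ, hDκ, hκ⟩ := (hD.and (h.eventually_genericAt p z)).exists
  refine ⟨κ + B, fun x y => (hDκ x y).trans (by lia), fun H hH n hn => ?_⟩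
  obtain ⟨H', rfl, hH'⟩ := exists_dehom_eq_of_near p (κ := κ) B (by exact_mod_cast hH) hn
  exact ⟨⟨H', fun x y hxy => (hDκ x y).trans (hH' x y hxy), rfl⟩, hκ H' hH'⟩

theorem exists_initZero_determines (h : Admissible (Complex.exp τ) a b c) (hN : 1 ≤ N) (hL : L ≤ M)
    (z : Fin M → ℂ) :
    ∃ n₀ : Fin M → ℤ, ∀ f, IsSolutionOn τ a b c (region (Complex.exp τ) a b c L 1) f →
      InitZero N (fun n => f (latticePt τ z n)) n₀ →
      ∀ n, latticePt τ z n ∈ region (Complex.exp τ) a b c L 1 → f (latticePt τ z n) = 0 := by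
  have hL' : L < M + 1 := Nat.lt_succ_iff.mpr hL
  obtain ⟨D, hD⟩ := h.exists_mem_region_iff_mem_polyhedron hL' z
  obtain ⟨κ, hDκ, hκ⟩ := h.exists_mem_region_and_genericAt ⟨L, hL'⟩ z D (2 * N + 5)
  have hdeep := neg_mul_mem_polyhedron_deepBounds (M + 1) κ N
  refine ⟨dehom ⟨L, hL'⟩ fun x => -((κ + N : ℤ) * x), fun f hf hinit n hn => ?_⟩
  have hnear : ∀ H ∈ polyhedron (deepBounds (M + 1) κ N),
      RulesNear N (fun n => f (latticePt τ z n)) (N + 3) (dehom ⟨L, hL'⟩ H) := fun H hH =>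
    hf.rulesNear fun n hn => by
      obtain ⟨⟨H', hH', rfl⟩, hgen⟩ :=
        hκ H (fun x y hxy => (le_deepBounds κ N hxy).trans (hH x y hxy)) n hn
      exact ⟨(hD H').mpr hH', hgen⟩
  obtain ⟨H, rfl⟩ : ∃ H, dehom ⟨L, hL'⟩ H = n := ⟨_, dehom_insertNth _ 0 n⟩
  refine eq_zero_of_mem_polyhedron N (F := fun H => f (latticePt τ z (dehom ⟨L, hL'⟩ H)))
    (fun x y hxy => (hDκ x y).trans (le_deepBounds κ N hxy))
    (fun x y w _ _ => (deepBounds_add_add κ N x y w).le) (fun x y hxy P hP hz => ?_)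
    (fun H hH => eq_zero_dehom_of_initZero _ hnear hdeep hinit hH) ((hD H).mp hn)
  exact hf.eq_zero_corner h hN hL' hxy (fun u hu w hw => (hD _).mpr (hP u hu w hw)) hz

end Uniqueness

/-! ### Fundamental solutions -/

section Fundamental

variable {N M : ℕ} {τ : ℂ}

lemma exists_eq_sum_of_determined {K E ι : Type*} [Field K] [Fintype ι] {S : Submodule K (E → K)}
    {X : Set E} {pt : ι → E} (hdet : ∀ f ∈ S, (∀ i, f (pt i) = 0) → ∀ x ∈ X, f x = 0)
    {v : ι → E → K} (hv : ∀ i, v i ∈ S)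
    (hind : ∀ C : ι → K, (∀ x ∈ X, ∑ i, C i * v i x = 0) → C = 0) {f : E → K} (hf : f ∈ S) :
    ∃ C : ι → K, ∀ x ∈ X, f x = ∑ i, C i * v i x := by
  have hcomb (C x) : Fintype.linearCombination K v C x = ∑ i, C i * v i x := by
    simp [Fintype.linearCombination_apply]
  have hcomb_mem (C) : Fintype.linearCombination K v C ∈ S :=
    S.sum_mem fun i _ => S.smul_mem _ (hv i)
  have hinj : Function.Injective (LinearMap.funLeft K K pt ∘ₗ Fintype.linearCombination K v) := by
    rw [← LinearMap.ker_eq_bot, LinearMap.ker_eq_bot']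
    intro C hC
    refine hind C fun x hx => ?_
    rw [← hcomb]
    exact hdet _ (hcomb_mem C) (fun i => congrFun hC i) x hx
  obtain ⟨C, hC⟩ := LinearMap.injective_iff_surjective.mp hinj fun i => f (pt i)
  refine ⟨C, fun x hx => ?_⟩
  rw [← hcomb, ← sub_eq_zero]
  exact hdet (f - Fintype.linearCombination K v C) (S.sub_mem hf (hcomb_mem C))
    (fun i => sub_eq_zero.mpr (congrFun hC i).symm) x hx

/-- The complex vector space of solutions in `D`. -/
def solutionSpace (τ : ℂ) (a : Fin N → ℂ) (b : Fin M → ℂ) (c : Fin N → ℂ)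
    (D : Set (Fin M → ℂ)) : Submodule ℂ ((Fin M → ℂ) → ℂ) where
  carrier := {f | IsSolutionOn τ a b c D f}
  zero_mem' := ⟨fun s z _ => by simp, fun r s _ z _ _ _ _ => by simp⟩
  add_mem' {f g} hf hg := by
    refine ⟨fun s z hz => ?_, fun r s hrs z h0 hr hs hrs' => ?_⟩
    · rw [map_add, map_add, Pi.add_apply, Pi.add_apply]
      linear_combination hf.eq_one s z hz + hg.eq_one s z hz
    · rw [map_add, map_add, Pi.add_apply, Pi.add_apply]
      linear_combination hf.eq_two r s hrs z h0 hr hs hrs' + hg.eq_two r s hrs z h0 hr hs hrs'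
  smul_mem' x f hf := by
    refine ⟨fun s z hz => ?_, fun r s hrs z h0 hr hs hrs' => ?_⟩
    · rw [map_smul, map_smul, Pi.smul_apply, Pi.smul_apply, smul_eq_mul, smul_eq_mul]
      linear_combination x * hf.eq_one s z hz
    · rw [map_smul, map_smul, Pi.smul_apply, Pi.smul_apply, smul_eq_mul, smul_eq_mul]
      linear_combination x * hf.eq_two r s hrs z h0 hr hs hrs'

lemma shiftPt_eq_latticePt (s : Fin M) (z : Fin M → ℂ) :
    shiftPt τ s z = latticePt τ z (Pi.single s 1) := by
  simpa only [latticePt_zero, zero_add] using shiftPt_latticePt (τ := τ) (z := z) s 0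

lemma range_latticePt_shiftPt (s : Fin M) (z : Fin M → ℂ) :
    Set.range (latticePt τ (shiftPt τ s z)) = Set.range (latticePt τ z) := by
  rw [shiftPt_eq_latticePt, ← (Equiv.addLeft (Pi.single s 1)).surjective.range_comp (latticePt τ z)]
  exact congrArg Set.range (funext fun n => latticePt_latticePt z _ n)

lemma IsPseudoConstant.latticePt {C : (Fin M → ℂ) → ℂ} (hC : IsPseudoConstant τ C)
    (z : Fin M → ℂ) (n : Fin M → ℤ) : C (latticePt τ z n) = C z := by
  let S : AddSubgroup (Fin M → ℤ) :=
    { carrier := {n | ∀ z, C (QHyp.latticePt τ z n) = C z}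
      zero_mem' := fun z => by rw [latticePt_zero]
      add_mem' := fun {n n'} hn hn' z => by rw [← latticePt_latticePt, hn', hn]
      neg_mem' := fun {n} hn z => by
        rw [← hn, latticePt_latticePt, neg_add_cancel, latticePt_zero] }
  have hsingle (s) : Pi.single s 1 ∈ S := fun z => by
    rw [← shiftPt_eq_latticePt]
    exact congrFun (hC s) z
  have hn : n = ∑ s, n s • Pi.single s (1 : ℤ) := by
    ext i
    simp [Finset.sum_apply, Pi.single_apply]
  have hmem : n ∈ S := by
    rw [hn]
    exact S.sum_mem fun s _ => S.zsmul_mem (hsingle s) _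
  exact hmem z

lemma exists_isPseudoConstant_eq_sum {ι : Type*} [Fintype ι] {D : Set (Fin M → ℂ)}
    {v : ι → (Fin M → ℂ) → ℂ} {f : (Fin M → ℂ) → ℂ}
    (h : ∀ z, ∃ C : ι → ℂ, ∀ w ∈ Set.range (latticePt τ z) ∩ D, f w = ∑ i, C i * v i w) :
    ∃ C : ι → (Fin M → ℂ) → ℂ, (∀ i, IsPseudoConstant τ (C i)) ∧
      ∀ z ∈ D, f z = ∑ i, C i z * v i z := by
  -- Coefficients chosen for each orbit, rather than for each point, are constant on orbits.
  choose! C hC using (Set.forall_mem_range.mpr h :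
    ∀ X ∈ Set.range fun z => Set.range (latticePt τ z), ∃ C : ι → ℂ, ∀ w ∈ X ∩ D,
      f w = ∑ i, C i * v i w)
  refine ⟨fun i z => C (Set.range (latticePt τ z)) i, fun i s => ?_, fun z hz => ?_⟩
  · ext z
    exact congrFun (congrArg C (range_latticePt_shiftPt s z)) i
  · exact hC _ ⟨z, rfl⟩ z ⟨⟨0, latticePt_zero z⟩, hz⟩

variable {α : Fin N → ℂ} {β : Fin M → ℂ} {γ : Fin N → ℂ} {L : ℕ}

lemma exists_eq_sum_u_one (h : Admissible (Complex.exp τ) (qPow τ α) (qPow τ β) (qPow τ γ))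
    (hN : 1 ≤ N) (hL : L ≤ M) {f : (Fin M → ℂ) → ℂ}
    (hf : IsSolutionOn τ (qPow τ α) (qPow τ β) (qPow τ γ)
      (region (Complex.exp τ) (qPow τ α) (qPow τ β) (qPow τ γ) L 1) f) (z : Fin M → ℂ) :
    ∃ C : Option (Fin N × Fin M) → ℂ, ∀ w ∈ Set.range (latticePt τ z) ∩
      region (Complex.exp τ) (qPow τ α) (qPow τ β) (qPow τ γ) L 1,
      f w = ∑ i, C i * u τ α β γ L hL 1 i w := by
  obtain ⟨n₀, hn₀⟩ := exists_initZero_determines h hN hL z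
  refine exists_eq_sum_of_determined
    (S := solutionSpace τ (qPow τ α) (qPow τ β) (qPow τ γ) (region _ _ _ _ L 1))
    (pt := fun i => latticePt τ z
      (i.elim n₀ fun (k, s) => n₀ + diagPt M k + Pi.single s 1))
    ?_ (isSolutionOn_u_one h hL) ?_ hf
  · rintro g hg hinit _ ⟨⟨n, rfl⟩, hn⟩
    exact hn₀ g hg ⟨hinit none, fun k hk s => hinit (some (⟨k, hk⟩, s))⟩ n hn
  · exact fun C hC => eq_zero_of_sum_mul_u_one_latticePt_eq_zero h hL z C fun n hn =>
      hC _ ⟨⟨n, rfl⟩, hn⟩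

theorem isFundamentalSolutionOn_u_one
    (h : Admissible (Complex.exp τ) (qPow τ α) (qPow τ β) (qPow τ γ)) (hN : 1 ≤ N) (hL : L ≤ M) :
    IsFundamentalSolutionOn τ (qPow τ α) (qPow τ β) (qPow τ γ)
      (region (Complex.exp τ) (qPow τ α) (qPow τ β) (qPow τ γ) L 1) (u τ α β γ L hL 1) where
  isSolution := isSolutionOn_u_one h hL
  linearIndependent C hC h0 i := by
    ext z
    refine congrFun (eq_zero_of_sum_mul_u_one_latticePt_eq_zero h hL z (fun i => C i z)
      fun n hn => ?_) i
    rw [← h0 _ hn]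
    exact sum_congr rfl fun i _ => by rw [(hC i).latticePt]
  spanning f hf := exists_isPseudoConstant_eq_sum (exists_eq_sum_u_one h hN hL hf)

end Fundamental

/-! ### Permutations of the variables -/

section Permutation

variable {N M : ℕ} {τ : ℂ} {a : Fin N → ℂ} {b : Fin M → ℂ} {c : Fin N → ℂ}

lemma shiftPt_comp_perm (σ : Equiv.Perm (Fin M)) (s : Fin M) (z : Fin M → ℂ) :
    (fun i => shiftPt τ s z (σ i)) = shiftPt τ (σ.symm s) fun i => z (σ i) := by
  ext i
  simp only [shiftPt, Function.update_apply, Equiv.apply_symm_apply, Equiv.eq_symm_apply]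

lemma shiftAllPt_iterate_comp_perm (σ : Equiv.Perm (Fin M)) (k : ℕ) (z : Fin M → ℂ) :
    (fun i => (shiftAllPt τ)^[k] z (σ i)) = (shiftAllPt τ)^[k] fun i => z (σ i) := by
  simp only [shiftAllPt_iterate]

lemma IsSolutionOn.comp_perm {σ : Equiv.Perm (Fin M)} {D : Set (Fin M → ℂ)}
    {f : (Fin M → ℂ) → ℂ} (hf : IsSolutionOn τ a (fun i => b (σ i)) c D f) :
    IsSolutionOn τ a b c {z | (fun i => z (σ i)) ∈ D} fun z => f fun i => z (σ i) := by
  rw [isSolutionOn_iff] at hf ⊢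
  simp only [Set.mem_ofPred_eq, EqOneAt, EqTwoAt, shiftAllPt_iterate_comp_perm,
    shiftPt_comp_perm] at hf ⊢
  refine ⟨fun s z hz => ?_, fun r s hrs z h0 hr hs hrs' => ?_⟩
  · simpa using hf.1 (σ.symm s) _ hz
  · simpa using hf.2 (σ.symm r) (σ.symm s) (σ.symm.injective.ne hrs) _ h0 hr hs hrs'

lemma IsPseudoConstant.comp_perm {C : (Fin M → ℂ) → ℂ} (hC : IsPseudoConstant τ C)
    (σ : Equiv.Perm (Fin M)) : IsPseudoConstant τ fun z => C fun i => z (σ i) := fun s => by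
  ext z
  have hshift := congrFun (hC (σ.symm s)) fun i => z (σ i)
  simp only [T, LinearMap.coe_mk, AddHom.coe_mk] at hshift ⊢
  rw [shiftPt_comp_perm, hshift]

theorem IsFundamentalSolutionOn.comp_perm {σ : Equiv.Perm (Fin M)} {D : Set (Fin M → ℂ)}
    {ι : Type*} [Fintype ι] {v : ι → (Fin M → ℂ) → ℂ}
    (hv : IsFundamentalSolutionOn τ a (fun i => b (σ i)) c D v) :
    IsFundamentalSolutionOn τ a b c {z | (fun i => z (σ i)) ∈ D}
      fun i z => v i fun j => z (σ j) where
  isSolution i := (hv.isSolution i).comp_perm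
  linearIndependent C hC h0 i := by
    have hzero := hv.linearIndependent (fun i z => C i fun j => z (σ.symm j))
      (fun i => (hC i).comp_perm σ.symm)
      (fun z hz => by simpa using h0 (fun j => z (σ.symm j)) (by simpa using hz)) i
    ext z
    simpa using congrFun hzero fun j => z (σ j)
  spanning f hf := by
    have hf' : IsSolutionOn τ a (fun i => b (σ i)) c D fun z => f fun i => z (σ.symm i) := by
      have hsymm := IsSolutionOn.comp_perm (σ := σ.symm) (b := fun i => b (σ i)) (by simpa using hf)
      simp only [Set.mem_ofPred_eq, Equiv.symm_apply_apply] at hsymm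
      exact hsymm
    obtain ⟨C, hC, hsum⟩ := hv.spanning _ hf'
    refine ⟨fun i z => C i fun j => z (σ j), fun i => (hC i).comp_perm σ, fun z hz => ?_⟩
    simpa using hsum _ hz

lemma NonResonant.admissible {q : ℂ} {σ : Equiv.Perm (Fin M)} (h : NonResonant q a b c σ)
    (hq0 : q ≠ 0) (hq1 : ‖q‖ < 1) (ha : ∀ j, a j ≠ 0) (hb : ∀ i, b i ≠ 0) (hc : ∀ j, c j ≠ 0) :
    Admissible q a (fun i => b (σ i)) c :=
  ⟨hq0, hq1, ha, fun i => hb (σ i), hc, h.a_div_a, h.c_div_c, h.a_div_b, h.c_div_b⟩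

end Permutation

end QHyp

end

theorem proposition4 {N M : ℕ} (hN : 1 ≤ N) (hM : 1 ≤ M)
    (q τ : ℂ) (hq0 : 0 < ‖q‖) (hq1 : ‖q‖ < 1) (hτ : Complex.exp τ = q)
    (α : Fin N → ℂ) (β : Fin M → ℂ) (γ : Fin N → ℂ)
    (a : Fin N → ℂ) (b : Fin M → ℂ) (c : Fin N → ℂ)
    (ha : a = QHyp.qPow τ α) (hb : b = QHyp.qPow τ β) (hc : c = QHyp.qPow τ γ)
    (L : ℕ) (hL : L ≤ M) (σ : Equiv.Perm (Fin M))
    (hres : QHyp.NonResonant q a b c σ) :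
    (∀ i : Option (Fin N × Fin M), ∀ z ∈ QHyp.region q a b c L σ,
      Summable (QHyp.uSeriesTerm τ α β γ L hL σ i z)) ∧
    QHyp.IsFundamentalSolutionOn τ a b c (QHyp.region q a b c L σ)
      (QHyp.u τ α β γ L hL σ) := by
  subst ha hb hc hτ
  have h : QHyp.Admissible (Complex.exp τ) (QHyp.qPow τ α) (QHyp.qPow τ fun i => β (σ i))
      (QHyp.qPow τ γ) := hres.admissible (norm_pos_iff.mp hq0) hq1 (QHyp.qPow_ne_zero τ α)
    (QHyp.qPow_ne_zero τ β) (QHyp.qPow_ne_zero τ γ)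
  refine ⟨fun i z hz => ?_, ?_⟩
  · exact QHyp.summable_uSeriesTerm_one h hL i (z := fun j => z (σ j)) hz
  · exact (QHyp.isFundamentalSolutionOn_u_one h hN hL).comp_perm (b := QHyp.qPow τ β)
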